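/- **Setting.** Let $S, A$ be finite sets ($A\neq\emptyset$), $P(\cdot|s,a)$ a transition kernel on $S$, $\rho$ an initial distribution on $S$, $\gamma\in(0,1)$. For a stationary policy $\pi:S\to\Delta(A)$ let $\lambda^{\pi}\in\mathbb R^{S\times A}$, $\lambda^\pi(s,a)=\sum_{t\ge 0}\gamma^t\,\mathbb P_{\rho,\pi}(s_t=s,a_t=a)$, be its occupancy measure, and let $\Lambda=\{\lambda^\pi\}$ be the set of all of them. Let $\pi_\theta(a|s)=e^{\psi(s,a;\theta)}/\sum_{a'}e^{\psi(s,a';\theta)}$ for $\theta\in\mathbb R^d$, $\lambda(\theta)=\lambda^{\pi_\theta}$, and let $F:\mathbb R^{S\times A}\to\mathbb R$ be such that $\theta\mapsto F(\lambda(\theta))$ is bounded above, with $F^\star=\sup_\theta F(\lambda(\theta))$. **Assumptions.** (1) Each $\psi(s,a;\cdot)$ is $C^2$ with $\|\nabla\psi(s,a;\theta)\|\le l_\psi$ and $\|\nabla^2\psi(s,a;\theta)\|\le L_\psi$ for all $\theta$ (spectral norm). (2) There is a set $D\subseteq\mathbb R^{S\times A}$ that contains $\Lambda$ and, almost surely,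 all estimates $\lambda_0,\dots,\lambda_{T-1}$ computed by the algorithm below, such that $F$ is differentiable at the points of $D$ and, for all $\lambda,\lambda'\in D$, $\|\nabla F(\lambda)\|_\infty\le l_\lambda$, $\|\nabla F(\lambda)-\nabla F(\lambda')\|_\infty\le L_\lambda\|\lambda-\lambda'\|_2$ and $\|\nabla F(\lambda)-\nabla F(\lambda')\|_\infty\le L_{\lambda,\infty}\|\lambda-\lambda'\|_1$. The constants $l_\psi,L_\psi,l_\lambda,L_\lambda,L_{\lambda,\infty}$ are positive. **Algorithm (N-VR-PG).** For a trajectory $\tau=(s_0,a_0,\dots,s_{H-1},a_{H-1})$ put $$\lambda(\tau)=\sum_{h=0}^{H-1}\gamma^h\delta_{s_h,a_h},\qquad g(\tau,\theta,r)=\sum_{t=0}^{H-1}\Big(\sum_{h=t}^{H-1}\gamma^h r(s_h,a_h)\Big)\nabla_\theta\log\pi_\theta(a_t|s_t),\qquad w(\tau|\theta',\theta)=\prod_{h=0}^{H-1}\frac{\pi_{\theta'}(a_h|s_h)}{\pi_\theta(a_h|s_h)}.$$ Given $\theta_0\in\mathbb R^d$, sample $\tau_0$ of length $H$ under $\rho$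 and $\pi_{\theta_0}$, and set $\lambda_0=\lambda(\tau_0)$, $r_{-1}=r_0=\nabla F(\lambda_0)$, $d_0=g(\tau_0,\theta_0,r_0)$, $\theta_1=\theta_0+\alpha_0^{\rm step}d_0/\|d_0\|$. For $t=1,\dots,T-1$ sample, given the past, $\tau_t$ of length $H$ under $\rho$ and $\pi_{\theta_t}$, and with $w_t=w(\tau_t|\theta_{t-1},\theta_t)$ set $$\lambda_t=\eta_t\lambda(\tau_t)+(1-\eta_t)\big(\lambda_{t-1}+(1-w_t)\lambda(\tau_t)\big),\qquad r_t=\nabla F(\lambda_t),$$ $$d_t=\eta_t\,g(\tau_t,\theta_t,r_{t-1})+(1-\eta_t)\big(d_{t-1}+g(\tau_t,\theta_t,r_{t-1})-w_t\,g(\tau_t,\theta_{t-1},r_{t-2})\big),\qquad \theta_{t+1}=\theta_t+\alpha_t^{\rm step}\,d_t/\|d_t\|,$$ with the convention $0/\|0\|=0$. For $\alpha_0>0$ and an integer $T\ge1$ use $\alpha_t^{\rm step}=\alpha_0T^{-2/3}$ for all $t\geq 0$, $\eta_t=(2/(t+1))^{2/3}$ and $H=\lceil\log(T+1)/(1-\gamma)\rceil$.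 Let $\bar\theta_T$ be uniform on $\{\theta_1,\dots,\theta_T\}$ (a uniformly random index, independent of the run), and $\Delta=F^\star-\mathbb E[F(\lambda(\theta_1))]$. **Theorem.** (a) Under the assumptions, $\theta\mapsto F(\lambda(\theta))$ is differentiable, and there is a constant $C>0$ that depends only on $l_\psi,L_\psi,l_\lambda,L_\lambda,L_{\lambda,\infty}$ (not on $S,A,d$, the MDP, $\psi$, $F$, $\gamma$, $\theta_0$, $\alpha_0$, $T$) such that $$\mathbb E\,\|\nabla_\theta F(\lambda(\bar\theta_T))\|\le C\;\frac{1+(1-\gamma)^3\Delta\,\alpha_0^{-1}+\sqrt{\log(T+1)}\,(1-\gamma)^{-1}\alpha_0}{(1-\gamma)^3\,T^{1/3}}.$$ If moreover $\alpha_0=(1-\gamma)^2\sqrt{\Delta}$, then $$\mathbb E\,\|\nabla_\theta F(\lambda(\bar\theta_T))\|\le C\;\frac{1+\sqrt{\log(T+1)}\,(1-\gamma)\sqrt{\Delta}}{(1-\gamma)^3\,T^{1/3}}.$$ (b) ($\tilde O(\varepsilon^{-3})$ sample complexity.) There is $K>0$, depending only on the five constants above, on $\gamma$, on $\alpha_0$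 and on an upper bound for $F^\star-F(\lambda(\theta_0))$, such that if (2) holds with one set $D$ for the runs with every $T\ge1$, then for every $0<\varepsilon\le 1/2$ there is $T\ge1$ such that the run with this $T$ uses $T\cdot H\le K\varepsilon^{-3}\log^3(1/\varepsilon)$ sampled state-action pairs and $\mathbb E\,\|\nabla_\theta F(\lambda(\bar\theta_T))\|\le\varepsilon$. -/

import Mathlib

universe u v

noncomputable section

/-- The expectation of a real function under a probability distribution on a finite type. -/
def expect {α : Type*} [Fintype α] (p : PMF α) (f : α → ℝ) : ℝ :=
  ∑ a, (p a).toReal * f a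

/-- The space `ℝ^d` of policy parameters, with the Euclidean norm. -/
abbrev Param (d : ℕ) : Type := EuclideanSpace ℝ (Fin d)

/-- The space `ℝ^(S × A)` of (signed) measures on `S × A`, with the Euclidean norm. -/
abbrev SAVec (S A : Type*) : Type _ := EuclideanSpace ℝ (S × A)

/-- A trajectory `(s_0, a_0, …, s_{H-1}, a_{H-1})` of length `H`. -/
abbrev Traj (S A : Type*) (H : ℕ) : Type _ := Fin H → S × A

/-- The `ℓ^∞` norm on `ℝ^(S × A)`. -/
def linfNorm {S A : Type*} [Fintype S] [Fintype A] (x : SAVec S A) : ℝ :=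
  ‖(fun p => x p : S × A → ℝ)‖

/-- The `ℓ^1` norm on `ℝ^(S × A)`. -/
def loneNorm {S A : Type*} [Fintype S] [Fintype A] (x : SAVec S A) : ℝ :=
  ∑ p, |x p|

/-- A discounted Markov decision process together with the function `ψ` of the softmax
parametrization and the utility `F`. -/
structure UtilityMDP (S A : Type*) (d : ℕ) where
  /-- transition kernel -/
  P : S → A → PMF S
  /-- initial state distribution -/
  ρ : PMF S
  /-- discount factor -/
  γ : ℝ
  γ_pos : 0 < γ
  γ_lt_one : γ < 1
  /-- the function in the exponent of the softmax policy -/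
  ψ : S → A → Param d → ℝ
  /-- the general utility, a function of the occupancy measure -/
  F : SAVec S A → ℝ

namespace UtilityMDP

variable {S A : Type*} {d : ℕ}

/-- The distribution of the next state after the state-action pairs seen so far. -/
def nextState (M : UtilityMDP S A d) : (n : ℕ) → Traj S A n → PMF S
  | 0, _ => M.ρ
  | n + 1, τ => M.P (τ (Fin.last n)).1 (τ (Fin.last n)).2

/-- The law of `(s_0, a_0, …, s_{n-1}, a_{n-1})` under the stationary policy `π`
and the initial distribution `ρ`. -/
def trajLaw (M : UtilityMDP S A d) (π : S → PMF A) : (n : ℕ) → PMF (Traj S A n)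
  | 0 => PMF.pure (fun i => i.elim0)
  | n + 1 =>
    (M.trajLaw π n).bind fun τ =>
      (M.nextState n τ).bind fun s =>
        (π s).map fun a => Fin.snoc (α := fun _ => S × A) τ (s, a)

/-- The law of `(s_t, a_t)`. -/
def pairLaw (M : UtilityMDP S A d) (π : S → PMF A) (t : ℕ) : PMF (S × A) :=
  (M.trajLaw π (t + 1)).map fun τ => τ (Fin.last t)

/-- The state-action occupancy measure
`λ^π(s,a) = ∑_{t ≥ 0} γ^t ℙ(s_t = s, a_t = a)`. -/
def occupancy (M : UtilityMDP S A d) (π : S → PMF A) : SAVec S A :=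
  WithLp.toLp 2 fun p => ∑' t : ℕ, M.γ ^ t * (M.pairLaw π t p).toReal

/-- The set `Λ` of the occupancy measures of all stationary policies. -/
def occupancySet (M : UtilityMDP S A d) : Set (SAVec S A) :=
  Set.range M.occupancy

/-- The softmax probability `π_θ(a|s)`. -/
def softmaxProb [Fintype A] (M : UtilityMDP S A d) (θ : Param d) (s : S) (a : A) : ℝ :=
  Real.exp (M.ψ s a θ) / ∑ a', Real.exp (M.ψ s a' θ)

theorem softmaxProb_sum [Fintype A] [Nonempty A] (M : UtilityMDP S A d) (θ : Param d) (s : S) :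
    ∑ a, ENNReal.ofReal (M.softmaxProb θ s a) = 1 := by
  have hpos : 0 < ∑ a', Real.exp (M.ψ s a' θ) :=
    Finset.sum_pos (fun a _ => Real.exp_pos _) Finset.univ_nonempty
  rw [← ENNReal.ofReal_sum_of_nonneg]
  · unfold softmaxProb
    rw [← Finset.sum_div, div_self hpos.ne', ENNReal.ofReal_one]
  · intro a _
    exact div_nonneg (Real.exp_pos _).le hpos.le

/-- The softmax policy `π_θ`. -/
def softmaxPolicy [Fintype A] [Nonempty A] (M : UtilityMDP S A d) (θ : Param d) (s : S) : PMF A :=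
  PMF.ofFintype (fun a => ENNReal.ofReal (M.softmaxProb θ s a)) (M.softmaxProb_sum θ s)

/-- The score `∇_θ log π_θ(a|s)`. -/
def score [Fintype A] (M : UtilityMDP S A d) (θ : Param d) (s : S) (a : A) : Param d :=
  gradient (fun θ' => Real.log (M.softmaxProb θ' s a)) θ

/-- The objective `θ ↦ F(λ(θ))`, where `λ(θ)` is the occupancy measure of `π_θ`. -/
def objective [Fintype A] [Nonempty A] (M : UtilityMDP S A d) (θ : Param d) : ℝ :=
  M.F (M.occupancy (M.softmaxPolicy θ))

/-- The optimal value `F^⋆ = sup_θ F(λ(θ))`. -/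
def optValue [Fintype A] [Nonempty A] (M : UtilityMDP S A d) : ℝ :=
  ⨆ θ : Param d, M.objective θ

/-- Regularity of the softmax parametrization: `ψ(s,a;·)` is `C²`, with gradient bounded by `l`
and Hessian bounded by `L` in the spectral norm. -/
structure PolicyRegular (M : UtilityMDP S A d) (l L : ℝ) : Prop where
  contDiff : ∀ s a, ContDiff ℝ 2 (M.ψ s a)
  gradient_le : ∀ s a θ, ‖gradient (M.ψ s a) θ‖ ≤ l
  hessian_le : ∀ s a θ, ‖fderiv ℝ (gradient (M.ψ s a)) θ‖ ≤ L

/-- Regularity of the utility on a set `D`: `F` is differentiable at the points of `D`, with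
gradient bounded in `ℓ^∞` by `l` and Lipschitz on `D` in the two senses. -/
structure UtilityRegular [Fintype S] [Fintype A] (M : UtilityMDP S A d) (D : Set (SAVec S A))
    (l L Linf : ℝ) : Prop where
  differentiableAt : ∀ x ∈ D, DifferentiableAt ℝ M.F x
  gradient_le : ∀ x ∈ D, linfNorm (gradient M.F x) ≤ l
  lipschitz_two : ∀ x ∈ D, ∀ y ∈ D, linfNorm (gradient M.F x - gradient M.F y) ≤ L * ‖x - y‖
  lipschitz_one : ∀ x ∈ D, ∀ y ∈ D,
    linfNorm (gradient M.F x - gradient M.F y) ≤ Linf * loneNorm (x - y)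

section Estimators

variable [Fintype S] [Fintype A] {H : ℕ}

/-- The truncated estimate `λ(τ) = ∑_{h<H} γ^h δ_{s_h,a_h}` of the occupancy measure. -/
def occEst [DecidableEq S] [DecidableEq A] (M : UtilityMDP S A d) (τ : Traj S A H) : SAVec S A :=
  ∑ h : Fin H, M.γ ^ (h : ℕ) • EuclideanSpace.single (τ h) (1 : ℝ)

/-- The policy gradient estimate
`g(τ,θ,r) = ∑_{t<H} (∑_{t≤h<H} γ^h r(s_h,a_h)) ∇ log π_θ(a_t|s_t)`. -/
def pgEst (M : UtilityMDP S A d) (τ : Traj S A H) (θ : Param d) (r : SAVec S A) : Param d :=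
  ∑ t : Fin H, (∑ h ∈ Finset.Ici t, M.γ ^ (h : ℕ) * r (τ h)) • M.score θ (τ t).1 (τ t).2

/-- The importance sampling weight `w(τ|θ',θ)`. -/
def isWeight (M : UtilityMDP S A d) (τ : Traj S A H) (θ' θ : Param d) : ℝ :=
  ∏ h : Fin H, M.softmaxProb θ' (τ h).1 (τ h).2 / M.softmaxProb θ (τ h).1 (τ h).2

end Estimators

/-- The memory of the algorithm after the samples `τ_0, …, τ_t`. -/
structure AlgState (S A : Type*) (d : ℕ) where
  /-- `θ_{t+1}` -/
  θ : Param d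
  /-- `θ_t` -/
  θprev : Param d
  /-- `λ_t` -/
  lam : SAVec S A
  /-- `r_t` -/
  r : SAVec S A
  /-- `r_{t-1}` -/
  rprev : SAVec S A
  /-- `d_t` -/
  dir : Param d

/-- The normalized update `θ + a · v / ‖v‖` (which is `θ` if `v = 0`). -/
def normStep (θ : Param d) (a : ℝ) (v : Param d) : Param d :=
  θ + (a / ‖v‖) • v

section Algorithm

variable [Fintype S] [DecidableEq S] [Fintype A] [DecidableEq A] {H : ℕ}

/-- The initialization of N-VR-PG with the sample `τ_0`. -/
def algInit (M : UtilityMDP S A d) (θ₀ : Param d) (α : ℕ → ℝ) (τ : Traj S A H) :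
    AlgState S A d :=
  let lam := M.occEst τ
  let r := gradient M.F lam
  let dir := M.pgEst τ θ₀ r
  { θ := normStep θ₀ (α 0) dir, θprev := θ₀, lam := lam, r := r, rprev := r, dir := dir }

/-- Iteration `t ≥ 1` of N-VR-PG with the sample `τ_t`; here `st.θ = θ_t`, `st.θprev = θ_{t-1}`,
`st.lam = λ_{t-1}`, `st.r = r_{t-1}`, `st.rprev = r_{t-2}`, `st.dir = d_{t-1}`. -/
def algStep (M : UtilityMDP S A d) (α η : ℕ → ℝ) (t : ℕ) (st : AlgState S A d)
    (τ : Traj S A H) : AlgState S A d :=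
  let w := M.isWeight τ st.θprev st.θ
  let u := (1 - w) • M.occEst τ
  let lam := η t • M.occEst τ + (1 - η t) • (st.lam + u)
  let v := M.pgEst τ st.θ st.r - w • M.pgEst τ st.θprev st.rprev
  let dir := η t • M.pgEst τ st.θ st.r + (1 - η t) • (st.dir + v)
  { θ := normStep st.θ (α t) dir, θprev := st.θ, lam := lam, r := gradient M.F lam,
    rprev := st.r, dir := dir }

/-- The memory of N-VR-PG after the samples `τ_0, …, τ_n`. -/
def algRun (M : UtilityMDP S A d) (θ₀ : Param d) (α η : ℕ → ℝ) :
    (n : ℕ) → (Fin (n + 1) → Traj S A H) → AlgState S A d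
  | 0, ω => M.algInit θ₀ α (ω 0)
  | n + 1, ω =>
    M.algStep α η (n + 1)
      (M.algRun θ₀ α η n (Fin.init (α := fun _ => Traj S A H) ω)) (ω (Fin.last (n + 1)))

/-- The iterate `θ_t`, as a function of the samples `τ_0, …, τ_{t-1}`. -/
def iterate (M : UtilityMDP S A d) (θ₀ : Param d) (α η : ℕ → ℝ) :
    (t : ℕ) → (Fin t → Traj S A H) → Param d
  | 0, _ => θ₀
  | n + 1, ω => (M.algRun θ₀ α η n ω).θ

/-- The joint law of the samples `τ_0, …, τ_{t-1}`: given the past, `τ_t` is a trajectory of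
length `H` of the policy `π_{θ_t}`. -/
def runLaw [Nonempty A] (M : UtilityMDP S A d) (θ₀ : Param d) (α η : ℕ → ℝ) (H : ℕ) :
    (t : ℕ) → PMF (Fin t → Traj S A H)
  | 0 => PMF.pure (fun i => i.elim0)
  | t + 1 =>
    (M.runLaw θ₀ α η H t).bind fun ω =>
      (M.trajLaw (M.softmaxPolicy (M.iterate θ₀ α η t ω)) H).map fun τ =>
        Fin.snoc (α := fun _ => Traj S A H) ω τ

/-- The iterate `θ_t`, `t ≤ T`, along the samples `τ_0, …, τ_{T-1}`. -/
def thetaAt (M : UtilityMDP S A d) (θ₀ : Param d) (α η : ℕ → ℝ) {T : ℕ}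
    (ω : Fin T → Traj S A H) (t : ℕ) (ht : t ≤ T) : Param d :=
  M.iterate θ₀ α η t fun i => ω (Fin.castLE ht i)

/-- The estimate `λ_t`, `t < T`, along the samples `τ_0, …, τ_{T-1}`. -/
def lamAt (M : UtilityMDP S A d) (θ₀ : Param d) (α η : ℕ → ℝ) {T : ℕ}
    (ω : Fin T → Traj S A H) (t : Fin T) : SAVec S A :=
  (M.algRun θ₀ α η t fun i => ω (Fin.castLE t.isLt i)).lam

/-- The step size `α_t = α₀ T^{-2/3}`. -/
def stepSize (α₀ : ℝ) (T : ℕ) : ℕ → ℝ := fun _ => α₀ / (T : ℝ) ^ (2 / 3 : ℝ)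

/-- The momentum parameter `η_t = (2/(t+1))^{2/3}`. -/
def momentum : ℕ → ℝ := fun t => (2 / ((t : ℝ) + 1)) ^ (2 / 3 : ℝ)

/-- The horizon `H = log(T+1)/(1-γ)`, rounded up. -/
def horizon (γ : ℝ) (T : ℕ) : ℕ := ⌈Real.log ((T : ℝ) + 1) / (1 - γ)⌉₊

variable [Nonempty A]

/-- The law of the samples `τ_0, …, τ_{T-1}` of N-VR-PG with the above parameters. -/
def sampleLaw (M : UtilityMDP S A d) (θ₀ : Param d) (α₀ : ℝ) (T : ℕ) :
    PMF (Fin T → Traj S A (horizon M.γ T)) :=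
  M.runLaw θ₀ (stepSize α₀ T) momentum (horizon M.γ T) T

/-- The joint law of the samples and of an independent uniform index `i` in `{0, …, T-1}`;
the output is `θ_{i+1}`. -/
def outputLaw (M : UtilityMDP S A d) (θ₀ : Param d) (α₀ : ℝ) (T : ℕ) [NeZero T] :
    PMF ((Fin T → Traj S A (horizon M.γ T)) × Fin T) :=
  (M.sampleLaw θ₀ α₀ T).bind fun ω =>
    (PMF.uniformOfFintype (Fin T)).map fun i => (ω, i)

/-- `𝔼 ‖∇_θ F(λ(θ̄_T))‖` for `θ̄_T` uniform in `{θ_1, …, θ_T}`. -/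
def expGradNorm (M : UtilityMDP S A d) (θ₀ : Param d) (α₀ : ℝ) (T : ℕ) [NeZero T] : ℝ :=
  expect (M.outputLaw θ₀ α₀ T) fun x =>
    ‖gradient M.objective (M.thetaAt θ₀ (stepSize α₀ T) momentum x.1 (x.2 + 1) x.2.isLt)‖

/-- `Δ = F^⋆ - 𝔼[F(λ(θ_1))]`. -/
def initialGap (M : UtilityMDP S A d) (θ₀ : Param d) (α₀ : ℝ) (T : ℕ) [NeZero T] : ℝ :=
  M.optValue - expect (M.sampleLaw θ₀ α₀ T) fun ω =>
    M.objective (M.thetaAt θ₀ (stepSize α₀ T) momentum ω 1 (NeZero.one_le))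

/-- Almost surely, all the estimates `λ_0, …, λ_{T-1}` of the run lie in `D`. -/
def RunStaysIn (M : UtilityMDP S A d) (θ₀ : Param d) (α₀ : ℝ) (T : ℕ) (D : Set (SAVec S A)) :
    Prop :=
  ∀ ω ∈ (M.sampleLaw θ₀ α₀ T).support, ∀ t : Fin T,
    M.lamAt θ₀ (stepSize α₀ T) momentum ω t ∈ D

end Algorithm

end UtilityMDP

end

/-!
The gradient of `θ ↦ F(λ(θ))` is the policy gradient for the fixed reward `∇F(λ(θ))`. Both the
policy gradient of a given reward and the reward `∇F(λ(θ))` are Lipschitz in `θ`, so the objective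
is smooth, and a step of length `a` along `d / ‖d‖` increases it by at least
`a (‖∇‖ - 2 ‖d - ∇‖) - O(a²)`. It remains to control the mean deviation of the search directions
`d_t` from the gradient.

The importance weights make the recursive estimates unbiased: given the past, the errors
`λ_t - 𝔼 λ(τ)` and `d_t - 𝔼 g(τ, θ_t, r_{t-1})` have mean `1 - η_t` times the previous error. The
remaining fluctuation has a part of order `η_t` from sampling and a part controlled by
`𝔼 (1 - w_t)²`. As consecutive iterates are only `a` apart, this variance is `O(H a²)`, as long as
`H a²` is bounded. The change `r_t - r_{t-1}` of the reward is of the same order. The squared errors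
therefore satisfy a recursion `e_{t+1} ≤ (1 - η_t)² e_t + O(η_t²) + O(H a²)`, which keeps them of
order `η_t + H a² / η_t`.

Truncating the trajectories costs a bias of order `γ^H ≤ 1 / (T + 1)`. Summing the ascent
inequality over `t < T` with `a = α₀ T^{-2/3}` gives the rate. If `H a²` is not bounded, then `α₀`
is so large that the rate is weaker than the uniform bound on the gradient.
-/

/-! ### Means of vector-valued functions -/

/-- The expectation of a vector-valued function under a probability distribution on a finite type.
For real functions this is `expect`, see `expect_eq_mean`. -/
noncomputable def mean {α E : Type*} [Fintype α] [AddCommGroup E] [Module ℝ E] (p : PMF α)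
    (f : α → E) : E :=
  ∑ a, (p a).toReal • f a

section Mean

variable {α β : Type*} [Fintype α] [Fintype β]

theorem expect_eq_mean (p : PMF α) (f : α → ℝ) : expect p f = mean p f := rfl

theorem sum_toReal_eq_one (p : PMF α) : ∑ a, (p a).toReal = 1 := by
  rw [← ENNReal.toReal_sum fun a _ => p.apply_ne_top a, ← tsum_fintype (L := .unconditional _),
    p.tsum_coe, ENNReal.toReal_one]

section Module

variable {E E' : Type*} [AddCommGroup E] [Module ℝ E] [AddCommGroup E'] [Module ℝ E']

theorem mean_const (p : PMF α) (x : E) : mean p (fun _ => x) = x := by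
  rw [mean, ← Finset.sum_smul, sum_toReal_eq_one, one_smul]

theorem mean_add (p : PMF α) (f g : α → E) :
    mean p (fun a => f a + g a) = mean p f + mean p g := by
  simp only [mean, smul_add, Finset.sum_add_distrib]

theorem mean_sub (p : PMF α) (f g : α → E) :
    mean p (fun a => f a - g a) = mean p f - mean p g := by
  simp only [mean, smul_sub, Finset.sum_sub_distrib]

theorem mean_smul (p : PMF α) (c : ℝ) (f : α → E) : mean p (fun a => c • f a) = c • mean p f := by
  simp only [mean, Finset.smul_sum, smul_comm c]

theorem mean_const_mul (p : PMF α) (c : ℝ) (f : α → ℝ) :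
    mean p (fun a => c * f a) = c * mean p f :=
  mean_smul p c f

theorem mean_sum {ι : Type*} (s : Finset ι) (p : PMF α) (f : ι → α → E) :
    mean p (fun a => ∑ i ∈ s, f i a) = ∑ i ∈ s, mean p (f i) := by
  simp only [mean, Finset.smul_sum]
  exact Finset.sum_comm

theorem mean_linearMap (p : PMF α) (L : E →ₗ[ℝ] E') (f : α → E) :
    mean p (fun a => L (f a)) = L (mean p f) := by
  simp only [mean, map_sum, map_smul]

theorem mean_bind (p : PMF α) (q : α → PMF β) (f : β → E) :
    mean (p.bind q) f = mean p fun a => mean (q a) f := by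
  simp only [mean, PMF.bind_apply, tsum_fintype, Finset.smul_sum]
  rw [Finset.sum_comm]
  refine Finset.sum_congr rfl fun b _ => ?_
  rw [ENNReal.toReal_sum fun a _ => ENNReal.mul_ne_top (p.apply_ne_top a) ((q a).apply_ne_top b),
    Finset.sum_smul]
  simp only [ENNReal.toReal_mul, mul_smul]

theorem mean_pure (a : α) (f : α → E) : mean (PMF.pure a) f = f a := by
  classical
  rw [mean, Finset.sum_eq_single a]
  · simp
  · intro b _ hb
    simp [PMF.pure_apply, hb]
  · simp

theorem mean_map (p : PMF α) (g : α → β) (f : β → E) :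
    mean (p.map g) f = mean p fun a => f (g a) := by
  rw [← PMF.bind_pure_comp, mean_bind]
  simp only [Function.comp, mean_pure]

end Module

section Order

variable {p : PMF α} {f g : α → ℝ} {c : ℝ}

theorem mean_mono (h : ∀ a ∈ p.support, f a ≤ g a) : mean p f ≤ mean p g := by
  refine Finset.sum_le_sum fun a _ => ?_
  by_cases ha : a ∈ p.support
  · exact mul_le_mul_of_nonneg_left (h a ha) ENNReal.toReal_nonneg
  · rw [PMF.mem_support_iff, not_not] at ha
    simp [ha]

theorem mean_le_of_forall_le (h : ∀ a ∈ p.support, f a ≤ c) : mean p f ≤ c :=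
  (mean_mono h).trans_eq (mean_const p c)

theorem le_mean_of_forall_le (h : ∀ a ∈ p.support, c ≤ f a) : c ≤ mean p f :=
  (mean_const p c).symm.trans_le (mean_mono h)

theorem sq_mean_le_mean_sq (p : PMF α) (f : α → ℝ) : mean p f ^ 2 ≤ mean p fun a => f a ^ 2 := by
  have variance_nonneg : 0 ≤ mean p fun a => (f a - mean p f) ^ 2 :=
    le_mean_of_forall_le fun a _ => sq_nonneg _
  have expand : ∀ a, (f a - mean p f) ^ 2 = f a ^ 2 + ((-2 * mean p f) * f a + mean p f ^ 2) :=
    fun a => by ring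
  simp only [expand, mean_add, mean_const, mean_const_mul] at variance_nonneg
  linarith [sq (mean p f)]

theorem mean_sq_le_of_mean_eq_one (hf : mean p f = 1) (h : ∀ a ∈ p.support, |f a - 1| ≤ c) :
    mean p (fun a => f a ^ 2) ≤ 1 + c ^ 2 := by
  have expand : ∀ a, f a ^ 2 = (f a - 1) ^ 2 + (2 * f a + -1) := fun a => by ring
  have variance_le : mean p (fun a => (f a - 1) ^ 2) ≤ c ^ 2 :=
    mean_le_of_forall_le fun a ha => sq_le_sq.2 ((h a ha).trans (le_abs_self c))
  simp only [expand, mean_add, mean_const_mul, mean_const, hf]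
  linarith

end Order

section Normed

variable {E : Type*} [NormedAddCommGroup E] [NormedSpace ℝ E]

theorem norm_mean_le (p : PMF α) (f : α → E) : ‖mean p f‖ ≤ mean p fun a => ‖f a‖ := by
  refine (norm_sum_le _ _).trans_eq (Finset.sum_congr rfl fun a _ => ?_)
  rw [norm_smul, Real.norm_of_nonneg ENNReal.toReal_nonneg, smul_eq_mul]

theorem norm_mean_le_of_forall_le {p : PMF α} {f : α → E} {c : ℝ}
    (h : ∀ a ∈ p.support, ‖f a‖ ≤ c) : ‖mean p f‖ ≤ c :=
  (norm_mean_le p f).trans (mean_le_of_forall_le h)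

end Normed

section Inner

variable {E : Type*} [NormedAddCommGroup E] [InnerProductSpace ℝ E]

theorem mean_inner (p : PMF α) (x : E) (f : α → E) :
    mean p (fun a => inner ℝ x (f a)) = inner ℝ x (mean p f) :=
  mean_linearMap p (innerₗ E x) f

theorem mean_norm_sq_add_sub_mean_le (p : PMF α) (x : E) (f : α → E) :
    mean p (fun a => ‖x + (f a - mean p f)‖ ^ 2) ≤ ‖x‖ ^ 2 + mean p fun a => ‖f a‖ ^ 2 := by
  have expand : ∀ a, ‖x + (f a - mean p f)‖ ^ 2 =
      (‖x‖ ^ 2 - 2 * inner ℝ x (mean p f) + ‖mean p f‖ ^ 2)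
        + 2 * inner ℝ (x - mean p f) (f a) + ‖f a‖ ^ 2 := by
    intro a
    rw [add_sub_left_comm, add_comm, norm_add_sq_real, norm_sub_sq_real]
  simp only [expand, mean_add, mean_const, mean_const_mul, mean_inner]
  rw [inner_sub_left, real_inner_self_eq_norm_sq]
  linarith [sq_nonneg ‖mean p f‖]

end Inner

end Mean

section ChainLaw

variable {α β γ : Type*}

theorem bind_map_apply_of_injective2 {g : α → β → γ} (hg : Function.Injective2 g) (p : PMF α)
    (q : α → PMF β) (a : α) (b : β) :
    (p.bind fun a => (q a).map (g a)) (g a b) = p a * q a b := by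
  classical
  have map_apply : ∀ a', (q a').map (g a') (g a b) = if a' = a then q a b else 0 := by
    intro a'
    rw [PMF.map_apply]
    split_ifs with h
    · subst h
      simp only [(hg.right a').eq_iff, eq_comm (a := b), tsum_ite_eq]
    · have : ∀ b', g a b ≠ g a' b' := fun b' e => h (hg e).1.symm
      simp [this]
  rw [PMF.bind_apply, tsum_eq_single a fun a' ha' => by rw [map_apply, if_neg ha', mul_zero],
    map_apply, if_pos rfl]

theorem map_castLE_of_snoc (p : (n : ℕ) → PMF (Fin n → α)) (q : (n : ℕ) → (Fin n → α) → PMF α)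
    (h : ∀ n, p (n + 1) = (p n).bind fun ω => (q n ω).map (Fin.snoc (α := fun _ => α) ω))
    {m n : ℕ} (hmn : m ≤ n) :
    (p n).map (fun ω (i : Fin m) => ω (Fin.castLE hmn i)) = p m := by
  induction n, hmn using Nat.le_induction with
  | base => exact PMF.map_id _
  | succ n hmn ih =>
    have forget_last : ∀ ω : Fin n → α, ((q n ω).map (Fin.snoc (α := fun _ => α) ω)).map
        (fun ω (i : Fin m) => ω (Fin.castLE (hmn.trans n.le_succ) i)) =
        PMF.pure (fun i => ω (Fin.castLE hmn i)) := by
      intro ω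
      rw [PMF.map_comp]
      convert PMF.map_const (q n ω) _ using 2
      funext x i
      exact Fin.snoc_castSucc (α := fun _ => α) x ω (Fin.castLE hmn i)
    rw [h, PMF.map_bind]
    simp only [forget_last]
    rw [← ih]
    exact PMF.bind_pure_comp _ _

end ChainLaw

/-! ### Score functions -/

section Score

variable {V : Type*} [NormedAddCommGroup V] [InnerProductSpace ℝ V] [CompleteSpace V]

/-- `σ` is the score function at `θ` of the family `p` of laws: `σ a` is the gradient at `θ` of
`θ ↦ log (p θ a)`, in the form `∇ p = p σ` that also makes sense where `p θ a = 0`. -/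
def HasScoreAt {α : Type*} (p : V → PMF α) (σ : α → V) (θ : V) : Prop :=
  ∀ a, HasGradientAt (fun θ => (p θ a).toReal) ((p θ a).toReal • σ a) θ

theorem hasScoreAt_const {α : Type*} (p : PMF α) (θ : V) :
    HasScoreAt (fun _ => p) (0 : α → V) θ := by
  intro a
  simpa using hasGradientAt_const θ (p a).toReal

theorem HasScoreAt.bind_map {α β γ : Type*} {g : α → β → γ} (hg : Function.Injective2 g)
    (hsurj : ∀ c, ∃ a b, g a b = c) {p : V → PMF α} {q : V → α → PMF β} {σ : α → V}
    {ς : α → β → V} {υ : γ → V} {θ : V} (hp : HasScoreAt p σ θ)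
    (hq : ∀ a, HasScoreAt (fun θ => q θ a) (ς a) θ) (hυ : ∀ a b, υ (g a b) = σ a + ς a b) :
    HasScoreAt (fun θ => (p θ).bind fun a => (q θ a).map (g a)) υ θ := by
  intro c
  obtain ⟨a, b, rfl⟩ := hsurj c
  simp only [bind_map_apply_of_injective2 hg, ENNReal.toReal_mul, hυ]
  rw [hasGradientAt_iff_hasFDerivAt]
  refine ((hp a).hasFDerivAt.mul (hq a b).hasFDerivAt).congr_fderiv ?_
  simp only [map_smul, map_add]
  module

variable {α : Type*} [Fintype α] {E : Type*} [NormedAddCommGroup E] [NormedSpace ℝ E]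

theorem HasScoreAt.hasFDerivAt_mean {p : V → PMF α} {σ : α → V} {θ : V} (h : HasScoreAt p σ θ)
    (c : α → E) :
    HasFDerivAt (fun θ => mean (p θ) c)
      (mean (p θ) fun a => (InnerProductSpace.toDual ℝ V (σ a)).smulRight (c a)) θ := by
  refine HasFDerivAt.fun_sum fun a _ => ((h a).hasFDerivAt.smul_const (c a)).congr_fderiv ?_
  ext v
  simp [mul_smul]

theorem HasScoreAt.hasGradientAt_mean {p : V → PMF α} {σ : α → V} {θ : V} (h : HasScoreAt p σ θ)
    (c : α → ℝ) :
    HasGradientAt (fun θ => mean (p θ) c) (mean (p θ) fun a => c a • σ a) θ := by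
  rw [hasGradientAt_iff_hasFDerivAt]
  refine (h.hasFDerivAt_mean c).congr_fderiv ?_
  ext v
  simp [mean, mul_comm]

theorem abs_sub_le_of_hasGradientAt {f : V → ℝ} {f' : V → V} {B : ℝ}
    (h : ∀ x, HasGradientAt f (f' x) x) (hB : ∀ x, ‖f' x‖ ≤ B) (x y : V) :
    |f x - f y| ≤ B * ‖x - y‖ := by
  refine Convex.norm_image_sub_le_of_norm_hasFDerivWithin_le (s := Set.univ)
    (fun x _ => (h x).hasFDerivAt.hasFDerivWithinAt) (fun x _ => ?_) convex_univ
    (Set.mem_univ _) (Set.mem_univ _)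
  rw [LinearIsometryEquiv.norm_map]
  exact hB x

variable {p : V → PMF α} {σ : V → α → V} {B C K : ℝ}

theorem norm_mean_sub_mean_le (h : ∀ θ, HasScoreAt p (σ θ) θ) (hσ : ∀ θ a, ‖σ θ a‖ ≤ B)
    {c : α → E} (hc : ∀ a, ‖c a‖ ≤ C) (θ θ' : V) :
    ‖mean (p θ) c - mean (p θ') c‖ ≤ B * C * ‖θ - θ'‖ := by
  refine Convex.norm_image_sub_le_of_norm_hasFDerivWithin_le (s := Set.univ)
    (fun x _ => ((h x).hasFDerivAt_mean c).hasFDerivWithinAt) (fun x _ => ?_) convex_univ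
    (Set.mem_univ _) (Set.mem_univ _)
  refine norm_mean_le_of_forall_le fun a _ => ?_
  rw [ContinuousLinearMap.norm_smulRight_apply, LinearIsometryEquiv.norm_map]
  exact mul_le_mul (hσ x a) (hc a) (norm_nonneg _) ((norm_nonneg _).trans (hσ x a))

theorem norm_mean_sub_mean_le_of_lipschitz (h : ∀ θ, HasScoreAt p (σ θ) θ)
    (hσ : ∀ θ a, ‖σ θ a‖ ≤ B) {f : V → α → E} (hf : ∀ θ a, ‖f θ a‖ ≤ C)
    (hlip : ∀ θ θ' a, ‖f θ a - f θ' a‖ ≤ K * ‖θ - θ'‖) (θ θ' : V) :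
    ‖mean (p θ) (f θ) - mean (p θ') (f θ')‖ ≤ (K + B * C) * ‖θ - θ'‖ := by
  have change_fun : ‖mean (p θ) (f θ) - mean (p θ) (f θ')‖ ≤ K * ‖θ - θ'‖ := by
    rw [← mean_sub]
    exact norm_mean_le_of_forall_le fun a _ => hlip θ θ' a
  have change_law := norm_mean_sub_mean_le h hσ (hf θ') θ θ'
  rw [add_mul]
  exact (norm_sub_le_norm_sub_add_norm_sub _ _ _).trans (add_le_add change_fun change_law)

end Score

theorem abs_exp_sub_one_le_mul_exp (x : ℝ) : |Real.exp x - 1| ≤ |x| * Real.exp |x| := by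
  have h := Complex.norm_exp_sub_sum_le_norm_mul_exp x 1
  simp only [Finset.sum_range_one, pow_zero, Nat.factorial_zero, Nat.cast_one, div_one, pow_one,
    Complex.norm_real, Real.norm_eq_abs] at h
  exact_mod_cast h

namespace UtilityMDP

variable {S A : Type*} {d : ℕ} {M : UtilityMDP S A d} {l L : ℝ}

/-! ### Softmax policies -/

namespace PolicyRegular

theorem hasGradientAt (hM : M.PolicyRegular l L) (s : S) (a : A) (θ : Param d) :
    HasGradientAt (M.ψ s a) (gradient (M.ψ s a) θ) θ :=
  ((hM.contDiff s a).differentiable two_ne_zero θ).hasGradientAt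

theorem norm_gradient_sub_le (hM : M.PolicyRegular l L) (s : S) (a : A) (θ θ' : Param d) :
    ‖gradient (M.ψ s a) θ - gradient (M.ψ s a) θ'‖ ≤ L * ‖θ - θ'‖ := by
  have differentiable_fderiv : Differentiable ℝ (fderiv ℝ (M.ψ s a)) :=
    ((hM.contDiff s a).fderiv_right (m := 1) (by norm_num)).differentiable one_ne_zero
  have differentiable_gradient : Differentiable ℝ (gradient (M.ψ s a)) :=
    (InnerProductSpace.toDual ℝ (Param d)).symm.toContinuousLinearEquiv.differentiable.comp
      differentiable_fderiv
  exact Convex.norm_image_sub_le_of_norm_fderiv_le (s := Set.univ)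
    (fun x _ => differentiable_gradient x) (fun x _ => hM.hessian_le s a x) convex_univ
    (Set.mem_univ _) (Set.mem_univ _)

theorem nonneg_left [Nonempty A] (hM : M.PolicyRegular l L) : 0 ≤ l := by
  obtain ⟨s, -⟩ := M.ρ.support_nonempty
  exact (norm_nonneg _).trans (hM.gradient_le s (Classical.arbitrary A) 0)

theorem nonneg_right [Nonempty A] (hM : M.PolicyRegular l L) : 0 ≤ L := by
  obtain ⟨s, -⟩ := M.ρ.support_nonempty
  exact (norm_nonneg _).trans (hM.hessian_le s (Classical.arbitrary A) 0)

end PolicyRegular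

variable [Fintype A] [Nonempty A]

theorem sum_exp_pos (M : UtilityMDP S A d) (θ : Param d) (s : S) :
    0 < ∑ a, Real.exp (M.ψ s a θ) :=
  Finset.sum_pos (fun _ _ => Real.exp_pos _) Finset.univ_nonempty

theorem softmaxProb_pos (M : UtilityMDP S A d) (θ : Param d) (s : S) (a : A) :
    0 < M.softmaxProb θ s a :=
  div_pos (Real.exp_pos _) (M.sum_exp_pos θ s)

theorem toReal_softmaxPolicy (M : UtilityMDP S A d) (θ : Param d) (s : S) (a : A) :
    (M.softmaxPolicy θ s a).toReal = M.softmaxProb θ s a := by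
  rw [softmaxPolicy, PMF.ofFintype_apply, ENNReal.toReal_ofReal (M.softmaxProb_pos θ s a).le]

theorem mean_softmaxPolicy_ratio_smul {E : Type*} [AddCommGroup E] [Module ℝ E]
    (M : UtilityMDP S A d) (θ θ' : Param d) (s : S) (f : A → E) :
    mean (M.softmaxPolicy θ s) (fun a => (M.softmaxProb θ' s a / M.softmaxProb θ s a) • f a) =
      mean (M.softmaxPolicy θ' s) f := by
  refine Finset.sum_congr rfl fun a _ => ?_
  rw [smul_smul, toReal_softmaxPolicy, toReal_softmaxPolicy,
    mul_div_cancel₀ _ (M.softmaxProb_pos θ s a).ne']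

namespace PolicyRegular

theorem hasGradientAt_log_softmaxProb_sub_mean (hM : M.PolicyRegular l L) (s : S) (a : A)
    (θ : Param d) :
    HasGradientAt (fun θ' => Real.log (M.softmaxProb θ' s a))
      (gradient (M.ψ s a) θ - mean (M.softmaxPolicy θ s) fun a' => gradient (M.ψ s a') θ) θ := by
  have log_eq : (fun θ' => Real.log (M.softmaxProb θ' s a)) =
      fun θ' => M.ψ s a θ' - Real.log (∑ a', Real.exp (M.ψ s a' θ')) := by
    funext θ'
    rw [softmaxProb, Real.log_div (Real.exp_pos _).ne' (M.sum_exp_pos θ' s).ne', Real.log_exp]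
  have hasFDerivAt_sum_exp := HasFDerivAt.fun_sum (u := Finset.univ) fun a' _ =>
    (hM.hasGradientAt s a' θ).hasFDerivAt.exp
  rw [log_eq, hasGradientAt_iff_hasFDerivAt]
  refine ((hM.hasGradientAt s a θ).hasFDerivAt.fun_sub
    (hasFDerivAt_sum_exp.log (M.sum_exp_pos θ s).ne')).congr_fderiv ?_
  simp only [map_sub, mean, map_sum, Finset.smul_sum, map_smul, toReal_softmaxPolicy, softmaxProb,
    smul_smul, inv_mul_eq_div]

theorem score_eq (hM : M.PolicyRegular l L) (θ : Param d) (s : S) (a : A) :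
    M.score θ s a =
      gradient (M.ψ s a) θ - mean (M.softmaxPolicy θ s) fun a' => gradient (M.ψ s a') θ :=
  (hM.hasGradientAt_log_softmaxProb_sub_mean s a θ).gradient

theorem hasGradientAt_log_softmaxProb (hM : M.PolicyRegular l L) (s : S) (a : A) (θ : Param d) :
    HasGradientAt (fun θ' => Real.log (M.softmaxProb θ' s a)) (M.score θ s a) θ :=
  (hM.hasGradientAt_log_softmaxProb_sub_mean s a θ).differentiableAt.hasGradientAt

theorem hasScoreAt_softmaxPolicy (hM : M.PolicyRegular l L) (s : S) (θ : Param d) :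
    HasScoreAt (fun θ => M.softmaxPolicy θ s) (M.score θ s) θ := by
  intro a
  have h := (hM.hasGradientAt_log_softmaxProb s a θ).hasFDerivAt.exp
  simp only [Real.exp_log (M.softmaxProb_pos _ s a)] at h
  simp only [toReal_softmaxPolicy]
  rwa [hasGradientAt_iff_hasFDerivAt, map_smul]

theorem norm_score_le (hM : M.PolicyRegular l L) (θ : Param d) (s : S) (a : A) :
    ‖M.score θ s a‖ ≤ 2 * l := by
  rw [hM.score_eq, two_mul]
  exact (norm_sub_le _ _).trans (add_le_add (hM.gradient_le s a θ)
    (norm_mean_le_of_forall_le fun a' _ => hM.gradient_le s a' θ))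

theorem norm_score_sub_le (hM : M.PolicyRegular l L) (s : S) (a : A) (θ θ' : Param d) :
    ‖M.score θ s a - M.score θ' s a‖ ≤ (2 * L + 2 * l ^ 2) * ‖θ - θ'‖ := by
  have mean_gradient_lipschitz := norm_mean_sub_mean_le_of_lipschitz
    (fun θ => hM.hasScoreAt_softmaxPolicy s θ) (fun θ => hM.norm_score_le θ s)
    (fun θ a' => hM.gradient_le s a' θ) (fun θ θ' a' => hM.norm_gradient_sub_le s a' θ θ') θ θ'
  rw [hM.score_eq, hM.score_eq, sub_sub_sub_comm]
  refine (norm_sub_le _ _).trans ((add_le_add (hM.norm_gradient_sub_le s a θ θ')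
    mean_gradient_lipschitz).trans_eq ?_)
  ring

theorem abs_softmaxProb_ratio_sub_one_le (hM : M.PolicyRegular l L) (s : S) (a : A)
    {θ θ' : Param d} (h : ‖θ' - θ‖ ≤ 1) :
    |M.softmaxProb θ' s a / M.softmaxProb θ s a - 1| ≤
      2 * l * Real.exp (2 * l) * ‖θ' - θ‖ := by
  have hl := hM.nonneg_left
  have log_ratio_le := abs_sub_le_of_hasGradientAt
    (fun θ => hM.hasGradientAt_log_softmaxProb s a θ) (fun θ => hM.norm_score_le θ s a) θ' θ
  set x := Real.log (M.softmaxProb θ' s a) - Real.log (M.softmaxProb θ s a) with hx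
  have ratio_eq_exp : M.softmaxProb θ' s a / M.softmaxProb θ s a = Real.exp x := by
    rw [hx, Real.exp_sub, Real.exp_log (M.softmaxProb_pos _ s a),
      Real.exp_log (M.softmaxProb_pos _ s a)]
  have abs_x_le : |x| ≤ 2 * l := log_ratio_le.trans (mul_le_of_le_one_right (by linarith) h)
  calc |M.softmaxProb θ' s a / M.softmaxProb θ s a - 1|
      = |Real.exp x - 1| := by rw [ratio_eq_exp]
    _ ≤ |x| * Real.exp |x| := abs_exp_sub_one_le_mul_exp x
    _ ≤ (2 * l * ‖θ' - θ‖) * Real.exp (2 * l) := by gcongr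
    _ = 2 * l * Real.exp (2 * l) * ‖θ' - θ‖ := by ring

theorem mean_softmaxProb_ratio_sq_le (hM : M.PolicyRegular l L) (s : S) {θ θ' : Param d}
    (h : ‖θ' - θ‖ ≤ 1) :
    mean (M.softmaxPolicy θ s) (fun a => (M.softmaxProb θ' s a / M.softmaxProb θ s a) ^ 2) ≤
      1 + (2 * l * Real.exp (2 * l) * ‖θ' - θ‖) ^ 2 := by
  refine mean_sq_le_of_mean_eq_one ?_ fun a _ => hM.abs_softmaxProb_ratio_sub_one_le s a h
  simpa only [smul_eq_mul, mul_one, mean_const] using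
    M.mean_softmaxPolicy_ratio_smul θ θ' s fun _ => (1 : ℝ)

end PolicyRegular

end UtilityMDP

/-! ### Trajectories -/

namespace UtilityMDP

variable {S A : Type*} {d : ℕ} {M : UtilityMDP S A d} {l L : ℝ}

theorem trajLaw_succ (M : UtilityMDP S A d) (π : S → PMF A) (n : ℕ) :
    M.trajLaw π (n + 1) = (M.trajLaw π n).bind fun τ =>
      ((M.nextState n τ).bind fun s => (π s).map (Prod.mk s)).map
        (Fin.snoc (α := fun _ => S × A) τ) := by
  simp only [trajLaw, PMF.map_bind, PMF.map_comp]
  rfl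

section Mean

variable [Fintype S] [Fintype A] {E : Type*} [AddCommGroup E] [Module ℝ E]

theorem mean_trajLaw_succ (M : UtilityMDP S A d) (π : S → PMF A) (n : ℕ)
    (f : Traj S A (n + 1) → E) :
    mean (M.trajLaw π (n + 1)) f = mean (M.trajLaw π n) fun τ =>
      mean (M.nextState n τ) fun s => mean (π s) fun a =>
        f (Fin.snoc (α := fun _ => S × A) τ (s, a)) := by
  simp only [trajLaw_succ, mean_bind, mean_map]

theorem mean_trajLaw_castLE (M : UtilityMDP S A d) (π : S → PMF A) {m n : ℕ} (h : m ≤ n)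
    (f : Traj S A m → E) :
    mean (M.trajLaw π n) (fun τ => f fun i => τ (Fin.castLE h i)) = mean (M.trajLaw π m) f := by
  rw [← map_castLE_of_snoc (M.trajLaw π) _ (M.trajLaw_succ π) h, mean_map]

end Mean

/-- The score of a trajectory: the states do not contribute, since the transition kernel does not
depend on the parameter. -/
noncomputable def trajScore [Fintype A] (M : UtilityMDP S A d) {n : ℕ} (θ : Param d)
    (τ : Traj S A n) : Param d :=
  ∑ i, M.score θ (τ i).1 (τ i).2

theorem nonneg_of_forall_abs_le [Nonempty A] (M : UtilityMDP S A d) {f : S × A → ℝ} {R : ℝ}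
    (hf : ∀ p, |f p| ≤ R) : 0 ≤ R := by
  obtain ⟨s, -⟩ := M.ρ.support_nonempty
  exact (abs_nonneg _).trans (hf (s, Classical.arbitrary A))

variable [Fintype A] [Nonempty A]

/-- The law of a trajectory of length `n` of the policy `π_θ`. -/
noncomputable abbrev law (M : UtilityMDP S A d) (n : ℕ) (θ : Param d) : PMF (Traj S A n) :=
  M.trajLaw (M.softmaxPolicy θ) n

namespace PolicyRegular

theorem norm_trajScore_le (hM : M.PolicyRegular l L) {n : ℕ} (θ : Param d) (τ : Traj S A n) :
    ‖M.trajScore θ τ‖ ≤ 2 * l * n := by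
  refine (norm_sum_le_of_le _ fun i _ => hM.norm_score_le θ (τ i).1 (τ i).2).trans_eq ?_
  simp [mul_comm]

theorem norm_trajScore_sub_le (hM : M.PolicyRegular l L) {n : ℕ} (θ θ' : Param d)
    (τ : Traj S A n) :
    ‖M.trajScore θ τ - M.trajScore θ' τ‖ ≤ (2 * L + 2 * l ^ 2) * n * ‖θ - θ'‖ := by
  rw [trajScore, trajScore, ← Finset.sum_sub_distrib]
  refine (norm_sum_le_of_le _ fun i _ =>
    hM.norm_score_sub_le (τ i).1 (τ i).2 θ θ').trans_eq ?_
  simp only [Finset.sum_const, Finset.card_univ, Fintype.card_fin, nsmul_eq_mul]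
  ring

theorem norm_smul_trajScore_le (hM : M.PolicyRegular l L) {r : SAVec S A} {R : ℝ}
    (hr : ∀ p, |r p| ≤ R) {n : ℕ} (p : S × A) (θ : Param d) (τ : Traj S A n) :
    ‖r p • M.trajScore θ τ‖ ≤ R * (2 * l * n) := by
  rw [norm_smul]
  exact mul_le_mul (hr p) (hM.norm_trajScore_le θ τ) (norm_nonneg _) ((abs_nonneg _).trans (hr p))

theorem hasScoreAt_law (hM : M.PolicyRegular l L) (n : ℕ) (θ : Param d) :
    HasScoreAt (M.law n) (M.trajScore θ) θ := by
  induction n with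
  | zero =>
    have trajScore_eq_zero : M.trajScore θ = (0 : Traj S A 0 → Param d) :=
      funext fun τ => Fin.sum_univ_zero _
    rw [trajScore_eq_zero]
    exact hasScoreAt_const _ θ
  | succ n ih =>
    have pair_score (τ : Traj S A n) : HasScoreAt
        (fun θ => (M.nextState n τ).bind fun s => (M.softmaxPolicy θ s).map (Prod.mk s))
        (fun x => M.score θ x.1 x.2) θ :=
      HasScoreAt.bind_map (fun _ _ _ _ h => Prod.mk.inj h) (fun x => ⟨x.1, x.2, rfl⟩)
        (hasScoreAt_const (M.nextState n τ) θ) (fun s => hM.hasScoreAt_softmaxPolicy s θ)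
        (fun s a => (zero_add _).symm)
    have law_succ : M.law (n + 1) = fun θ => _ := funext fun θ => M.trajLaw_succ _ n
    rw [law_succ]
    refine HasScoreAt.bind_map Fin.snoc_injective2
      (fun τ => ⟨Fin.init τ, τ (Fin.last n), Fin.snoc_init_self τ⟩) ih pair_score fun τ x => ?_
    simp only [trajScore, Fin.sum_univ_castSucc, Fin.snoc_castSucc, Fin.snoc_last]

end PolicyRegular

variable [Fintype S]

/-- The expectation of `r(s_h,a_h)` under `π_θ`. -/
noncomputable def pairMean (M : UtilityMDP S A d) (r : SAVec S A) (h : ℕ) (θ : Param d) : ℝ :=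
  mean (M.law (h + 1) θ) fun τ => r (τ (Fin.last h))

/-- The gradient of `pairMean`, in likelihood ratio form. -/
noncomputable def pairGrad (M : UtilityMDP S A d) (r : SAVec S A) (h : ℕ) (θ : Param d) :
    Param d :=
  mean (M.law (h + 1) θ) fun τ => r (τ (Fin.last h)) • M.trajScore θ τ

theorem pairGrad_sub (M : UtilityMDP S A d) (r r' : SAVec S A) (h : ℕ) (θ : Param d) :
    M.pairGrad (r - r') h θ = M.pairGrad r h θ - M.pairGrad r' h θ := by
  simp only [pairGrad, PiLp.sub_apply, sub_smul, mean_sub]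

theorem abs_pairMean_le (M : UtilityMDP S A d) {r : SAVec S A} {R : ℝ} (hr : ∀ p, |r p| ≤ R)
    (h : ℕ) (θ : Param d) : |M.pairMean r h θ| ≤ R :=
  (Real.norm_eq_abs _).symm.trans_le (norm_mean_le_of_forall_le fun _ _ => hr _)

namespace PolicyRegular

variable {r : SAVec S A} {R : ℝ}

theorem hasGradientAt_pairMean (hM : M.PolicyRegular l L) (r : SAVec S A) (h : ℕ) (θ : Param d) :
    HasGradientAt (M.pairMean r h) (M.pairGrad r h θ) θ :=
  (hM.hasScoreAt_law (h + 1) θ).hasGradientAt_mean fun τ => r (τ (Fin.last h))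

theorem norm_pairGrad_le (hM : M.PolicyRegular l L) (hr : ∀ p, |r p| ≤ R) (h : ℕ)
    (θ : Param d) : ‖M.pairGrad r h θ‖ ≤ 2 * l * R * (h + 1) := by
  refine (norm_mean_le_of_forall_le fun τ _ => hM.norm_smul_trajScore_le hr _ θ τ).trans_eq ?_
  push_cast
  ring

theorem norm_pairGrad_sub_le (hM : M.PolicyRegular l L) (hr : ∀ p, |r p| ≤ R) (h : ℕ)
    (θ θ' : Param d) :
    ‖M.pairGrad r h θ - M.pairGrad r h θ'‖ ≤
      R * (2 * L + 6 * l ^ 2) * ((h + 1) * (h + 2)) * ‖θ - θ'‖ := by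
  have hL := hM.nonneg_right
  have hR := M.nonneg_of_forall_abs_le hr
  have lipschitz := norm_mean_sub_mean_le_of_lipschitz (hM.hasScoreAt_law (h + 1))
    (fun θ => hM.norm_trajScore_le θ)
    (fun θ τ => hM.norm_smul_trajScore_le hr (τ (Fin.last h)) θ τ)
    (K := R * ((2 * L + 2 * l ^ 2) * (h + 1 : ℕ))) (fun θ θ' τ => by
      rw [← smul_sub, norm_smul, mul_assoc]
      exact mul_le_mul (hr _) (hM.norm_trajScore_sub_le θ θ' τ) (norm_nonneg _) hR) θ θ'
  refine lipschitz.trans (mul_le_mul_of_nonneg_right ?_ (norm_nonneg _))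
  push_cast
  calc R * ((2 * L + 2 * l ^ 2) * ((h : ℝ) + 1)) + 2 * l * (h + 1) * (R * (2 * l * (h + 1)))
      = R * (h + 1) * (2 * L + 2 * l ^ 2 + 4 * l ^ 2 * (h + 1)) := by ring
    _ ≤ R * (h + 1) * ((2 * L + 6 * l ^ 2) * (h + 2)) := by
        refine mul_le_mul_of_nonneg_left ?_ (by positivity)
        nlinarith [mul_nonneg hL (Nat.cast_nonneg (α := ℝ) h),
          mul_nonneg (sq_nonneg l) (Nat.cast_nonneg (α := ℝ) h), sq_nonneg l]
    _ = R * (2 * L + 6 * l ^ 2) * ((h + 1) * (h + 2)) := by ring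

end PolicyRegular

end UtilityMDP

/-! ### Occupancy measures -/

theorem abs_apply_le_linfNorm {S A : Type*} [Fintype S] [Fintype A] (x : SAVec S A) (p : S × A) :
    |x p| ≤ linfNorm x :=
  norm_le_pi_norm (fun p => x p : S × A → ℝ) p

theorem linfNorm_nonneg {S A : Type*} [Fintype S] [Fintype A] (x : SAVec S A) : 0 ≤ linfNorm x :=
  norm_nonneg _

namespace UtilityMDP

section Discount

variable {S A : Type*} {d : ℕ}

/-- The effective horizon `1/(1-γ)`, written `κ` in proofs. -/
noncomputable def effHorizon (M : UtilityMDP S A d) : ℝ := (1 - M.γ)⁻¹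

theorem one_le_effHorizon (M : UtilityMDP S A d) : 1 ≤ M.effHorizon :=
  (one_le_inv₀ (by linarith [M.γ_lt_one])).2 (by linarith [M.γ_pos])

theorem discount_pow_nonneg (M : UtilityMDP S A d) (h : ℕ) : 0 ≤ M.γ ^ h :=
  pow_nonneg M.γ_pos.le h

theorem norm_discount_lt_one (M : UtilityMDP S A d) : ‖M.γ‖ < 1 := by
  rw [Real.norm_of_nonneg M.γ_pos.le]
  exact M.γ_lt_one

theorem norm_discount_pow_smul {E : Type*} [NormedAddCommGroup E] [NormedSpace ℝ E]
    (M : UtilityMDP S A d) (h : ℕ) (x : E) : ‖M.γ ^ h • x‖ = M.γ ^ h * ‖x‖ := by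
  rw [norm_smul, Real.norm_of_nonneg (M.discount_pow_nonneg h)]

theorem hasSum_discount_pow (M : UtilityMDP S A d) :
    HasSum (fun h : ℕ => M.γ ^ h) M.effHorizon :=
  hasSum_geometric_of_norm_lt_one M.norm_discount_lt_one

theorem hasSum_discount_pow_mul_add_one (M : UtilityMDP S A d) :
    HasSum (fun h : ℕ => M.γ ^ h * ((h : ℝ) + 1)) (M.effHorizon ^ 2) := by
  have := hasSum_choose_mul_geometric_of_norm_lt_one 1 M.norm_discount_lt_one
  simpa [effHorizon, mul_comm] using this

theorem hasSum_discount_pow_mul_add_one_mul_add_two (M : UtilityMDP S A d) :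
    HasSum (fun h : ℕ => M.γ ^ h * (((h : ℝ) + 1) * ((h : ℝ) + 2))) (2 * M.effHorizon ^ 3) := by
  have hasSum_choose :=
    (hasSum_choose_mul_geometric_of_norm_lt_one 2 M.norm_discount_lt_one).mul_left 2
  rw [one_div, ← inv_pow] at hasSum_choose
  refine hasSum_choose.congr_fun fun h => ?_
  rw [Nat.cast_choose_two]
  push_cast
  ring

theorem sum_discount_pow_le (M : UtilityMDP S A d) (H : ℕ) :
    ∑ h : Fin H, M.γ ^ (h : ℕ) ≤ M.effHorizon := by
  rw [Fin.sum_univ_eq_sum_range (fun h => M.γ ^ h)]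
  exact sum_le_hasSum _ (fun h _ => M.discount_pow_nonneg h) M.hasSum_discount_pow

theorem sum_discount_pow_mul_add_one_le (M : UtilityMDP S A d) (H : ℕ) :
    ∑ h : Fin H, M.γ ^ (h : ℕ) * (((h : ℕ) : ℝ) + 1) ≤ M.effHorizon ^ 2 := by
  rw [Fin.sum_univ_eq_sum_range (fun h => M.γ ^ h * ((h : ℝ) + 1))]
  exact sum_le_hasSum _ (fun h _ => mul_nonneg (M.discount_pow_nonneg h) (by positivity))
    M.hasSum_discount_pow_mul_add_one

end Discount

section PairVec

variable {S A : Type*} {d : ℕ}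

/-- The law of `(s_h, a_h)` under the policy `π`, as a vector. -/
noncomputable def pairVec (M : UtilityMDP S A d) (π : S → PMF A) (h : ℕ) : SAVec S A :=
  WithLp.toLp 2 fun p => (M.pairLaw π h p).toReal

section Mean

variable [Fintype S] [Fintype A]

theorem pairVec_eq_mean [DecidableEq S] [DecidableEq A] (M : UtilityMDP S A d) (π : S → PMF A)
    (h : ℕ) :
    M.pairVec π h = mean (M.trajLaw π (h + 1)) fun τ =>
      EuclideanSpace.single (τ (Fin.last h)) (1 : ℝ) := by
  have mean_pairLaw : mean (M.pairLaw π h) (fun p => EuclideanSpace.single p (1 : ℝ)) = _ :=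
    mean_map _ _ _
  rw [← mean_pairLaw]
  ext p
  simp [pairVec, mean, WithLp.ofLp_sum, Pi.single_apply]

theorem norm_pairVec_le (M : UtilityMDP S A d) (π : S → PMF A) (h : ℕ) : ‖M.pairVec π h‖ ≤ 1 := by
  classical
  rw [pairVec_eq_mean]
  exact norm_mean_le_of_forall_le fun τ _ => by simp

theorem norm_smul_pairVec_le (M : UtilityMDP S A d) (π : S → PMF A) (h : ℕ) :
    ‖M.γ ^ h • M.pairVec π h‖ ≤ M.γ ^ h := by
  rw [norm_discount_pow_smul]
  exact mul_le_of_le_one_right (M.discount_pow_nonneg h) (M.norm_pairVec_le π h)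

end Mean

theorem summable_smul_pairVec [Finite S] [Finite A] (M : UtilityMDP S A d) (π : S → PMF A) :
    Summable fun h : ℕ => M.γ ^ h • M.pairVec π h := by
  cases nonempty_fintype S
  cases nonempty_fintype A
  exact .of_norm_bounded M.hasSum_discount_pow.summable fun h => M.norm_smul_pairVec_le π h

theorem occupancy_eq_tsum [Finite S] [Finite A] (M : UtilityMDP S A d) (π : S → PMF A) :
    M.occupancy π = ∑' h : ℕ, M.γ ^ h • M.pairVec π h := by
  ext p
  exact ((M.summable_smul_pairVec π).hasSum.mapL
    (EuclideanSpace.proj p : SAVec S A →L[ℝ] ℝ)).tsum_eq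

theorem norm_occupancy_sub_sum_le [Fintype S] [Fintype A] (M : UtilityMDP S A d)
    (π : S → PMF A) (n : ℕ) :
    ‖M.occupancy π - ∑ h ∈ Finset.range n, M.γ ^ h • M.pairVec π h‖ ≤
      M.γ ^ n * M.effHorizon := by
  rw [occupancy_eq_tsum, ← (M.summable_smul_pairVec π).sum_add_tsum_nat_add n,
    add_sub_cancel_left]
  refine tsum_of_norm_bounded (M.hasSum_discount_pow.mul_left (M.γ ^ n)) fun h => ?_
  refine (M.norm_smul_pairVec_le π (h + n)).trans_eq ?_
  rw [pow_add, mul_comm]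

end PairVec

variable {S A : Type*} {d : ℕ} [Fintype A] [Nonempty A] {M : UtilityMDP S A d} {l L : ℝ}

theorem occupancy_mem {D : Set (SAVec S A)} (hD : M.occupancySet ⊆ D) (θ : Param d) :
    M.occupancy (M.softmaxPolicy θ) ∈ D :=
  hD ⟨_, rfl⟩

variable [Fintype S]

theorem inner_pairVec (M : UtilityMDP S A d) (r : SAVec S A) (h : ℕ) (θ : Param d) :
    inner ℝ r (M.pairVec (M.softmaxPolicy θ) h) = M.pairMean r h θ := by
  classical
  rw [pairVec_eq_mean, ← mean_inner, pairMean]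
  simp [EuclideanSpace.inner_single_right]

/-- The discounted value `⟨λ(θ), r⟩` of the reward `r`. -/
noncomputable def value (M : UtilityMDP S A d) (r : SAVec S A) (θ : Param d) : ℝ :=
  ∑' h : ℕ, M.γ ^ h * M.pairMean r h θ

/-- The policy gradient `∇_θ ⟨λ(θ), r⟩` for a fixed reward `r`. -/
noncomputable def valueGrad (M : UtilityMDP S A d) (r : SAVec S A) (θ : Param d) : Param d :=
  ∑' h : ℕ, M.γ ^ h • M.pairGrad r h θ

theorem inner_occupancy (M : UtilityMDP S A d) (r : SAVec S A) (θ : Param d) :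
    inner ℝ r (M.occupancy (M.softmaxPolicy θ)) = M.value r θ := by
  have inner_tsum :=
    ((M.summable_smul_pairVec (M.softmaxPolicy θ)).hasSum.mapL (innerSL ℝ r)).tsum_eq
  simp only [innerSL_apply_apply, inner_smul_right, inner_pairVec] at inner_tsum
  rw [occupancy_eq_tsum, ← inner_tsum, value]

theorem occupancy_apply [DecidableEq S] [DecidableEq A] (M : UtilityMDP S A d) (θ : Param d)
    (p : S × A) :
    M.occupancy (M.softmaxPolicy θ) p = M.value (EuclideanSpace.single p 1) θ := by
  rw [← inner_occupancy]
  simp [EuclideanSpace.inner_single_left]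

namespace PolicyRegular

variable {r : SAVec S A} {R : ℝ}

theorem norm_smul_pairGrad_le (hM : M.PolicyRegular l L) (hr : ∀ p, |r p| ≤ R) (h : ℕ)
    (θ : Param d) :
    ‖M.γ ^ h • M.pairGrad r h θ‖ ≤ 2 * l * R * (M.γ ^ h * ((h : ℝ) + 1)) := by
  rw [norm_discount_pow_smul]
  calc M.γ ^ h * ‖M.pairGrad r h θ‖ ≤ M.γ ^ h * (2 * l * R * (h + 1)) :=
        mul_le_mul_of_nonneg_left (hM.norm_pairGrad_le hr h θ) (M.discount_pow_nonneg h)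
    _ = 2 * l * R * (M.γ ^ h * (h + 1)) := by ring

theorem summable_smul_pairGrad (hM : M.PolicyRegular l L) (r : SAVec S A) (θ : Param d) :
    Summable fun h : ℕ => M.γ ^ h • M.pairGrad r h θ :=
  .of_norm_bounded
    (M.hasSum_discount_pow_mul_add_one.mul_left (2 * l * linfNorm r)).summable fun h =>
      hM.norm_smul_pairGrad_le (abs_apply_le_linfNorm r) h θ

theorem norm_valueGrad_le (hM : M.PolicyRegular l L) (hr : ∀ p, |r p| ≤ R) (θ : Param d) :
    ‖M.valueGrad r θ‖ ≤ 2 * l * R * M.effHorizon ^ 2 :=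
  tsum_of_norm_bounded (M.hasSum_discount_pow_mul_add_one.mul_left (2 * l * R)) fun h =>
    hM.norm_smul_pairGrad_le hr h θ

theorem hasGradientAt_value (hM : M.PolicyRegular l L) (r : SAVec S A) (θ : Param d) :
    HasGradientAt (M.value r) (M.valueGrad r θ) θ := by
  rw [hasGradientAt_iff_hasFDerivAt]
  have hasFDerivAt_value := hasFDerivAt_tsum (𝕜 := ℝ)
    (f := fun (h : ℕ) θ => M.γ ^ h * M.pairMean r h θ)
    (f' := fun (h : ℕ) θ => InnerProductSpace.toDual ℝ (Param d) (M.γ ^ h • M.pairGrad r h θ))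
    (x₀ := θ) (M.hasSum_discount_pow_mul_add_one.mul_left (2 * l * linfNorm r)).summable
    (fun h θ => ?_) (fun h θ => ?_) ?_ θ
  · refine hasFDerivAt_value.congr_fderiv ?_
    exact ((InnerProductSpace.toDual ℝ (Param d)).toContinuousLinearEquiv.map_tsum).symm
  · rw [map_smul]
    exact (hM.hasGradientAt_pairMean r h θ).hasFDerivAt.const_mul (M.γ ^ h)
  · rw [LinearIsometryEquiv.norm_map]
    exact hM.norm_smul_pairGrad_le (abs_apply_le_linfNorm r) h θ
  · refine .of_norm_bounded (M.hasSum_discount_pow.mul_right (linfNorm r)).summable fun h => ?_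
    rw [← smul_eq_mul, norm_discount_pow_smul]
    exact mul_le_mul_of_nonneg_left (M.abs_pairMean_le (abs_apply_le_linfNorm r) h θ)
      (M.discount_pow_nonneg h)

theorem valueGrad_sub (hM : M.PolicyRegular l L) (r r' : SAVec S A) (θ : Param d) :
    M.valueGrad (r - r') θ = M.valueGrad r θ - M.valueGrad r' θ := by
  rw [valueGrad, valueGrad, valueGrad,
    ← (hM.summable_smul_pairGrad r θ).tsum_sub (hM.summable_smul_pairGrad r' θ)]
  simp only [pairGrad_sub, smul_sub]

theorem norm_valueGrad_sub_le (hM : M.PolicyRegular l L) (hr : ∀ p, |r p| ≤ R) (θ θ' : Param d) :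
    ‖M.valueGrad r θ - M.valueGrad r θ'‖ ≤
      R * (2 * L + 6 * l ^ 2) * (2 * M.effHorizon ^ 3) * ‖θ - θ'‖ := by
  rw [valueGrad, valueGrad,
    ← (hM.summable_smul_pairGrad r θ).tsum_sub (hM.summable_smul_pairGrad r θ')]
  refine tsum_of_norm_bounded ((M.hasSum_discount_pow_mul_add_one_mul_add_two.mul_left
    (R * (2 * L + 6 * l ^ 2))).mul_right ‖θ - θ'‖) fun h => ?_
  rw [← smul_sub, norm_discount_pow_smul]
  calc M.γ ^ h * ‖M.pairGrad r h θ - M.pairGrad r h θ'‖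
      ≤ M.γ ^ h * (R * (2 * L + 6 * l ^ 2) * ((h + 1) * (h + 2)) * ‖θ - θ'‖) :=
        mul_le_mul_of_nonneg_left (hM.norm_pairGrad_sub_le hr h θ θ') (M.discount_pow_nonneg h)
    _ = R * (2 * L + 6 * l ^ 2) * (M.γ ^ h * ((h + 1) * (h + 2))) * ‖θ - θ'‖ := by ring

theorem norm_valueGrad_sub_sum_le (hM : M.PolicyRegular l L) (hr : ∀ p, |r p| ≤ R) (θ : Param d)
    (n : ℕ) :
    ‖M.valueGrad r θ - ∑ h ∈ Finset.range n, M.γ ^ h • M.pairGrad r h θ‖ ≤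
      2 * l * R * (M.γ ^ n * (M.effHorizon ^ 2 + n * M.effHorizon)) := by
  rw [valueGrad, ← (hM.summable_smul_pairGrad r θ).sum_add_tsum_nat_add n, add_sub_cancel_left]
  refine tsum_of_norm_bounded (((M.hasSum_discount_pow_mul_add_one.add
    (M.hasSum_discount_pow.mul_left (n : ℝ))).mul_left (M.γ ^ n)).mul_left (2 * l * R)) fun h => ?_
  refine (hM.norm_smul_pairGrad_le hr (h + n) θ).trans_eq ?_
  rw [pow_add]
  push_cast
  ring

omit [Fintype S] in
theorem differentiable_occupancy [Finite S] (hM : M.PolicyRegular l L) :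
    Differentiable ℝ fun θ => M.occupancy (M.softmaxPolicy θ) := by
  classical
  cases nonempty_fintype S
  intro θ
  rw [differentiableAt_euclidean]
  intro p
  simp only [occupancy_apply]
  exact (hM.hasGradientAt_value _ θ).hasFDerivAt.differentiableAt

theorem loneNorm_occupancy_sub_le (hM : M.PolicyRegular l L) (θ θ' : Param d) :
    loneNorm (M.occupancy (M.softmaxPolicy θ) - M.occupancy (M.softmaxPolicy θ')) ≤
      2 * l * M.effHorizon ^ 2 * ‖θ - θ'‖ := by
  set x := M.occupancy (M.softmaxPolicy θ) - M.occupancy (M.softmaxPolicy θ') with hx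
  let sgn : SAVec S A := WithLp.toLp 2 fun p => SignType.sign (x p)
  have abs_sgn_le : ∀ p, |sgn p| ≤ 1 := by
    intro p
    change |((SignType.sign (x p) : SignType) : ℝ)| ≤ 1
    rcases lt_trichotomy (x p) 0 with h | h | h <;> simp [h]
  have loneNorm_eq : loneNorm x = M.value sgn θ - M.value sgn θ' := by
    rw [← inner_occupancy, ← inner_occupancy, ← inner_sub_right, ← hx, PiLp.inner_apply, loneNorm]
    refine Finset.sum_congr rfl fun p _ => ?_
    rw [← sign_mul_self, mul_comm]
    rfl
  have lipschitz := abs_sub_le_of_hasGradientAt (hM.hasGradientAt_value sgn)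
    (hM.norm_valueGrad_le abs_sgn_le) θ θ'
  rw [mul_one] at lipschitz
  exact loneNorm_eq.trans_le ((le_abs_self _).trans lipschitz)

/-- The chain rule through `λ(θ)`, with `∂λ(θ)` read off the linear utilities `⟨r, ·⟩`. -/
theorem hasGradientAt_objective (hM : M.PolicyRegular l L) {θ : Param d}
    (hF : DifferentiableAt ℝ M.F (M.occupancy (M.softmaxPolicy θ))) :
    HasGradientAt M.objective
      (M.valueGrad (gradient M.F (M.occupancy (M.softmaxPolicy θ))) θ) θ := by
  rw [hasGradientAt_iff_hasFDerivAt]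
  set r := gradient M.F (M.occupancy (M.softmaxPolicy θ))
  have hasFDerivAt_occupancy := (hM.differentiable_occupancy θ).hasFDerivAt
  have hasFDerivAt_value : HasFDerivAt (M.value r) ((InnerProductSpace.toDual ℝ (SAVec S A) r).comp
      (fderiv ℝ (fun θ => M.occupancy (M.softmaxPolicy θ)) θ)) θ := by
    refine ((InnerProductSpace.toDual ℝ (SAVec S A) r).hasFDerivAt.comp θ
      hasFDerivAt_occupancy).congr_of_eventuallyEq (.of_forall fun θ' => ?_)
    simp [← inner_occupancy]
  exact (hF.hasGradientAt.hasFDerivAt.comp θ hasFDerivAt_occupancy).congr_fderiv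
    (hasFDerivAt_value.unique (hM.hasGradientAt_value r θ).hasFDerivAt)

end PolicyRegular

end UtilityMDP

/-! ### Smoothness of the objective -/

theorem add_inner_sub_le_of_lipschitz_gradient {V : Type*} [NormedAddCommGroup V]
    [InnerProductSpace ℝ V] [CompleteSpace V] {f : V → ℝ} {f' : V → V} {B : ℝ}
    (h : ∀ x, HasGradientAt f (f' x) x) (hB : ∀ x y, ‖f' x - f' y‖ ≤ B * ‖x - y‖) (x v : V) :
    f x + inner ℝ (f' x) v - B / 2 * ‖v‖ ^ 2 ≤ f (x + v) := by
  let excess : ℝ → ℝ := fun t => f (x + t • v) - t * inner ℝ (f' x) v + B / 2 * ‖v‖ ^ 2 * t ^ 2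
  have hasDerivAt_excess (t : ℝ) : HasDerivAt excess
      (inner ℝ (f' (x + t • v) - f' x) v + B * ‖v‖ ^ 2 * t) t := by
    have line : HasDerivAt (fun t : ℝ => x + t • v) v t := by
      simpa using ((hasDerivAt_id t).smul_const v).const_add x
    refine ((((h _).hasFDerivAt.comp_hasDerivAt t line).sub
      ((hasDerivAt_id t).mul_const (inner ℝ (f' x) v))).add
      ((hasDerivAt_pow 2 t).const_mul (B / 2 * ‖v‖ ^ 2))).congr_deriv ?_
    rw [InnerProductSpace.toDual_apply_apply, inner_sub_left]
    ring
  have deriv_nonneg : ∀ t ∈ interior (Set.Ici (0 : ℝ)), 0 ≤ deriv excess t := by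
    intro t ht
    rw [interior_Ici] at ht
    have gradient_close := hB (x + t • v) x
    rw [add_sub_cancel_left, norm_smul, Real.norm_of_nonneg ht.le] at gradient_close
    have inner_ge := neg_le_of_abs_le (abs_real_inner_le_norm (f' (x + t • v) - f' x) v)
    rw [(hasDerivAt_excess t).deriv]
    nlinarith [mul_le_mul_of_nonneg_right gradient_close (norm_nonneg v)]
  have excess_mono := monotoneOn_of_deriv_nonneg (convex_Ici 0)
    (fun t _ => (hasDerivAt_excess t).continuousAt.continuousWithinAt)
    (fun t _ => (hasDerivAt_excess t).differentiableAt.differentiableWithinAt) deriv_nonneg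
    (Set.mem_Ici.2 le_rfl) (Set.mem_Ici.2 zero_le_one) zero_le_one
  simp only [excess, zero_smul, one_smul, add_zero] at excess_mono
  linarith

namespace UtilityMDP

/-- The smoothness constant of the objective is `smoothConst l L R L₁ / (1-γ)^4`. -/
noncomputable def smoothConst (l L R L₁ : ℝ) : ℝ := 4 * l ^ 2 * L₁ + R * (4 * L + 12 * l ^ 2)

variable {S A : Type*} {d : ℕ} [Fintype S] [Fintype A] [Nonempty A] {M : UtilityMDP S A d}
  {l L : ℝ} {D : Set (SAVec S A)} {R L₂ L₁ : ℝ}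

/-- The gradient of the utility at `λ(θ)`, the reward of a policy gradient step at `θ`. -/
noncomputable def reward (M : UtilityMDP S A d) (θ : Param d) : SAVec S A :=
  gradient M.F (M.occupancy (M.softmaxPolicy θ))

namespace UtilityRegular

theorem nonneg (hF : M.UtilityRegular D R L₂ L₁) (hD : M.occupancySet ⊆ D) : 0 ≤ R :=
  (linfNorm_nonneg _).trans
    (hF.gradient_le _ (hD ⟨fun _ => PMF.pure (Classical.arbitrary A), rfl⟩))

theorem abs_reward_le (hF : M.UtilityRegular D R L₂ L₁) (hD : M.occupancySet ⊆ D)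
    (θ : Param d) (p : S × A) : |M.reward θ p| ≤ R :=
  (abs_apply_le_linfNorm _ p).trans (hF.gradient_le _ (occupancy_mem hD θ))

theorem linfNorm_reward_sub_le (hF : M.UtilityRegular D R L₂ L₁) (hM : M.PolicyRegular l L)
    (hD : M.occupancySet ⊆ D) (hL₁ : 0 ≤ L₁) (θ θ' : Param d) :
    linfNorm (M.reward θ - M.reward θ') ≤ L₁ * (2 * l * M.effHorizon ^ 2 * ‖θ - θ'‖) :=
  (hF.lipschitz_one _ (occupancy_mem hD θ) _ (occupancy_mem hD θ')).trans
    (mul_le_mul_of_nonneg_left (hM.loneNorm_occupancy_sub_le θ θ') hL₁)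

theorem hasGradientAt_objective (hF : M.UtilityRegular D R L₂ L₁) (hM : M.PolicyRegular l L)
    (hD : M.occupancySet ⊆ D) (θ : Param d) :
    HasGradientAt M.objective (M.valueGrad (M.reward θ) θ) θ :=
  hM.hasGradientAt_objective (hF.differentiableAt _ (occupancy_mem hD θ))

theorem gradient_objective (hF : M.UtilityRegular D R L₂ L₁) (hM : M.PolicyRegular l L)
    (hD : M.occupancySet ⊆ D) (θ : Param d) :
    gradient M.objective θ = M.valueGrad (M.reward θ) θ :=
  (hF.hasGradientAt_objective hM hD θ).gradient

theorem norm_gradient_objective_le (hF : M.UtilityRegular D R L₂ L₁) (hM : M.PolicyRegular l L)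
    (hD : M.occupancySet ⊆ D) (θ : Param d) :
    ‖gradient M.objective θ‖ ≤ 2 * l * R * M.effHorizon ^ 2 := by
  rw [hF.gradient_objective hM hD]
  exact hM.norm_valueGrad_le (hF.abs_reward_le hD θ) θ

theorem norm_gradient_objective_sub_le (hF : M.UtilityRegular D R L₂ L₁)
    (hM : M.PolicyRegular l L) (hD : M.occupancySet ⊆ D) (hL₁ : 0 ≤ L₁) (θ θ' : Param d) :
    ‖gradient M.objective θ - gradient M.objective θ'‖ ≤
      smoothConst l L R L₁ * M.effHorizon ^ 4 * ‖θ - θ'‖ := by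
  have hL := hM.nonneg_right
  have hR := hF.nonneg hD
  rw [hF.gradient_objective hM hD, hF.gradient_objective hM hD]
  have change_policy := hM.norm_valueGrad_sub_le (hF.abs_reward_le hD θ') θ θ'
  have change_reward : ‖M.valueGrad (M.reward θ - M.reward θ') θ‖ ≤ _ :=
    hM.norm_valueGrad_le (fun p => (abs_apply_le_linfNorm _ p).trans
      (hF.linfNorm_reward_sub_le hM hD hL₁ θ θ')) θ
  rw [hM.valueGrad_sub] at change_reward
  calc ‖M.valueGrad (M.reward θ) θ - M.valueGrad (M.reward θ') θ'‖
      ≤ 2 * l * (L₁ * (2 * l * M.effHorizon ^ 2 * ‖θ - θ'‖)) * M.effHorizon ^ 2 +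
        R * (2 * L + 6 * l ^ 2) * (2 * M.effHorizon ^ 3) * ‖θ - θ'‖ :=
        (norm_sub_le_norm_sub_add_norm_sub _ _ _).trans (add_le_add change_reward change_policy)
    _ ≤ 2 * l * (L₁ * (2 * l * M.effHorizon ^ 2 * ‖θ - θ'‖)) * M.effHorizon ^ 2 +
        R * (2 * L + 6 * l ^ 2) * (2 * M.effHorizon ^ 4) * ‖θ - θ'‖ := by
        gcongr
        · exact M.one_le_effHorizon
        · norm_num
    _ = smoothConst l L R L₁ * M.effHorizon ^ 4 * ‖θ - θ'‖ := by
        rw [smoothConst]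
        ring

theorem objective_add_ge (hF : M.UtilityRegular D R L₂ L₁) (hM : M.PolicyRegular l L)
    (hD : M.occupancySet ⊆ D) (hL₁ : 0 ≤ L₁) (θ v : Param d) :
    M.objective θ + inner ℝ (gradient M.objective θ) v -
      smoothConst l L R L₁ * M.effHorizon ^ 4 / 2 * ‖v‖ ^ 2 ≤ M.objective (θ + v) :=
  add_inner_sub_le_of_lipschitz_gradient
    (fun θ => (hF.hasGradientAt_objective hM hD θ).differentiableAt.hasGradientAt)
    (hF.norm_gradient_objective_sub_le hM hD hL₁) θ v

end UtilityRegular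

end UtilityMDP

/-! ### Estimators -/

theorem sum_Iic_eq_sum_castLE {E : Type*} [AddCommMonoid E] {H : ℕ} (h : Fin H) (f : Fin H → E) :
    ∑ t ∈ Finset.Iic h, f t = ∑ i : Fin ((h : ℕ) + 1), f (Fin.castLE h.isLt i) := by
  have Iic_eq_map : Finset.Iic h = Finset.univ.map (Fin.castLEEmb h.isLt) := by
    ext t
    simp only [Finset.mem_Iic, Finset.mem_map, Finset.mem_univ, true_and]
    exact ⟨fun ht => ⟨⟨t, Nat.lt_succ_of_le ht⟩, rfl⟩,
      fun ⟨i, hi⟩ => hi ▸ Nat.le_of_lt_succ i.isLt⟩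
  rw [Iic_eq_map, Finset.sum_map]
  rfl

namespace UtilityMDP

variable {S A : Type*} {d : ℕ} [Fintype A] {H : ℕ} {M : UtilityMDP S A d} {l L : ℝ}

theorem pgEst_eq_sum_trajScore (M : UtilityMDP S A d) (τ : Traj S A H) (θ : Param d)
    (r : SAVec S A) :
    M.pgEst τ θ r = ∑ h : Fin H, M.γ ^ (h : ℕ) • (r (τ h) •
      M.trajScore θ fun i : Fin ((h : ℕ) + 1) => τ (Fin.castLE h.isLt i)) := by
  have trajScore_eq (h : Fin H) :
      (M.trajScore θ fun i : Fin ((h : ℕ) + 1) => τ (Fin.castLE h.isLt i)) =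
        ∑ t ∈ Finset.Iic h, M.score θ (τ t).1 (τ t).2 :=
    (sum_Iic_eq_sum_castLE h fun t => M.score θ (τ t).1 (τ t).2).symm
  simp only [pgEst, Finset.sum_smul, trajScore_eq, Finset.smul_sum, smul_smul]
  exact Finset.sum_comm' fun t h => by simp

theorem pgEst_sub (M : UtilityMDP S A d) (τ : Traj S A H) (θ : Param d) (r r' : SAVec S A) :
    M.pgEst τ θ (r - r') = M.pgEst τ θ r - M.pgEst τ θ r' := by
  simp only [pgEst, PiLp.sub_apply, mul_sub, Finset.sum_sub_distrib, sub_smul]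

theorem norm_occEst_le [Fintype S] [DecidableEq S] [DecidableEq A] (M : UtilityMDP S A d)
    (τ : Traj S A H) : ‖M.occEst τ‖ ≤ M.effHorizon := by
  refine (norm_sum_le_of_le _ fun h _ => ?_).trans (M.sum_discount_pow_le H)
  simp [norm_discount_pow_smul]

variable [Nonempty A]

namespace PolicyRegular

variable {r r' : SAVec S A} {R : ℝ}

theorem norm_pgEst_le (hM : M.PolicyRegular l L) (hr : ∀ p, |r p| ≤ R) (τ : Traj S A H)
    (θ : Param d) : ‖M.pgEst τ θ r‖ ≤ 2 * l * R * M.effHorizon ^ 2 := by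
  have hl := hM.nonneg_left
  have hR := M.nonneg_of_forall_abs_le hr
  rw [pgEst_eq_sum_trajScore]
  calc _ ≤ ∑ h : Fin H, 2 * l * R * (M.γ ^ (h : ℕ) * (((h : ℕ) : ℝ) + 1)) := by
        refine norm_sum_le_of_le _ fun h _ => ?_
        rw [norm_discount_pow_smul, mul_left_comm]
        refine mul_le_mul_of_nonneg_left ((hM.norm_smul_trajScore_le hr _ θ _).trans_eq ?_)
          (M.discount_pow_nonneg h)
        push_cast
        ring
    _ ≤ 2 * l * R * M.effHorizon ^ 2 := by
        rw [← Finset.mul_sum]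
        exact mul_le_mul_of_nonneg_left (M.sum_discount_pow_mul_add_one_le H) (by positivity)

theorem norm_pgEst_sub_left_le (hM : M.PolicyRegular l L) (hr : ∀ p, |r p| ≤ R)
    (τ : Traj S A H) (θ θ' : Param d) :
    ‖M.pgEst τ θ r - M.pgEst τ θ' r‖ ≤
      R * (2 * L + 2 * l ^ 2) * ‖θ - θ'‖ * M.effHorizon ^ 2 := by
  have hL := hM.nonneg_right
  have hR := M.nonneg_of_forall_abs_le hr
  rw [pgEst_eq_sum_trajScore, pgEst_eq_sum_trajScore, ← Finset.sum_sub_distrib]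
  calc _ ≤ ∑ h : Fin H, R * (2 * L + 2 * l ^ 2) * ‖θ - θ'‖ *
          (M.γ ^ (h : ℕ) * (((h : ℕ) : ℝ) + 1)) := by
        refine norm_sum_le_of_le _ fun h _ => ?_
        rw [← smul_sub, ← smul_sub, norm_discount_pow_smul, norm_smul,
          mul_left_comm (R * (2 * L + 2 * l ^ 2) * ‖θ - θ'‖)]
        refine mul_le_mul_of_nonneg_left ((mul_le_mul (hr _) (hM.norm_trajScore_sub_le θ θ' _)
          (norm_nonneg _) hR).trans_eq ?_) (M.discount_pow_nonneg h)
        push_cast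
        ring
    _ ≤ _ := by
        rw [← Finset.mul_sum]
        exact mul_le_mul_of_nonneg_left (M.sum_discount_pow_mul_add_one_le H) (by positivity)

theorem norm_pgEst_sub_le [Fintype S] (hM : M.PolicyRegular l L) (hr : ∀ p, |r' p| ≤ R)
    (τ : Traj S A H) (θ θ' : Param d) :
    ‖M.pgEst τ θ r - M.pgEst τ θ' r'‖ ≤ (2 * l * linfNorm (r - r') +
      R * (2 * L + 2 * l ^ 2) * ‖θ - θ'‖) * M.effHorizon ^ 2 := by
  have reward_change := hM.norm_pgEst_le (abs_apply_le_linfNorm (r - r')) τ θ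
  rw [pgEst_sub] at reward_change
  exact (norm_sub_le_norm_sub_add_norm_sub _ (M.pgEst τ θ r') _).trans
    ((add_le_add reward_change (hM.norm_pgEst_sub_left_le hr τ θ θ')).trans_eq (by ring))

end PolicyRegular

variable [Fintype S]

/-- The mean `𝔼 g(τ,θ,r)` of the policy gradient estimate under `π_θ`. -/
noncomputable def pgMean (M : UtilityMDP S A d) (H : ℕ) (θ : Param d) (r : SAVec S A) : Param d :=
  mean (M.law H θ) fun τ => M.pgEst τ θ r

theorem pgMean_eq (M : UtilityMDP S A d) (H : ℕ) (θ : Param d) (r : SAVec S A) :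
    M.pgMean H θ r = ∑ h ∈ Finset.range H, M.γ ^ h • M.pairGrad r h θ := by
  rw [pgMean, ← Fin.sum_univ_eq_sum_range (fun h => M.γ ^ h • M.pairGrad r h θ)]
  simp only [pgEst_eq_sum_trajScore, mean_sum, mean_smul]
  refine Finset.sum_congr rfl fun h _ => ?_
  rw [pairGrad, ← M.mean_trajLaw_castLE _ (Nat.succ_le_of_lt h.isLt)]
  rfl

theorem pgMean_sub (M : UtilityMDP S A d) (H : ℕ) (θ : Param d) (r r' : SAVec S A) :
    M.pgMean H θ (r - r') = M.pgMean H θ r - M.pgMean H θ r' := by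
  simp only [pgMean, pgEst_sub, mean_sub]

theorem PolicyRegular.norm_pgMean_le (hM : M.PolicyRegular l L) {r : SAVec S A} {R : ℝ}
    (hr : ∀ p, |r p| ≤ R) (θ : Param d) :
    ‖M.pgMean H θ r‖ ≤ 2 * l * R * M.effHorizon ^ 2 :=
  norm_mean_le_of_forall_le fun τ _ => hM.norm_pgEst_le hr τ θ

section OccMean

variable [DecidableEq S] [DecidableEq A]

/-- The mean `𝔼 λ(τ)` of the estimate of the occupancy measure under `π_θ`. -/
noncomputable def occMean (M : UtilityMDP S A d) (H : ℕ) (θ : Param d) : SAVec S A :=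
  mean (M.law H θ) fun τ => M.occEst τ

theorem occMean_eq (M : UtilityMDP S A d) (H : ℕ) (θ : Param d) :
    M.occMean H θ = ∑ h ∈ Finset.range H, M.γ ^ h • M.pairVec (M.softmaxPolicy θ) h := by
  rw [occMean, ← Fin.sum_univ_eq_sum_range
    (fun h => M.γ ^ h • M.pairVec (M.softmaxPolicy θ) h)]
  simp only [occEst, mean_sum, mean_smul]
  refine Finset.sum_congr rfl fun h _ => ?_
  rw [pairVec_eq_mean, ← M.mean_trajLaw_castLE _ (Nat.succ_le_of_lt h.isLt)]
  rfl

theorem norm_occMean_le (M : UtilityMDP S A d) (H : ℕ) (θ : Param d) :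
    ‖M.occMean H θ‖ ≤ M.effHorizon :=
  norm_mean_le_of_forall_le fun τ _ => M.norm_occEst_le τ

end OccMean

/-! ### Importance weights -/

omit [Fintype S] [Nonempty A] in
theorem isWeight_snoc (M : UtilityMDP S A d) (τ : Traj S A H) (s : S) (a : A) (θ' θ : Param d) :
    M.isWeight (Fin.snoc (α := fun _ => S × A) τ (s, a)) θ' θ =
      M.isWeight τ θ' θ * (M.softmaxProb θ' s a / M.softmaxProb θ s a) := by
  simp [isWeight, Fin.prod_univ_castSucc, mul_div_mul_comm]

theorem mean_isWeight_smul {E : Type*} [AddCommGroup E] [Module ℝ E] (M : UtilityMDP S A d)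
    (θ θ' : Param d) (f : Traj S A H → E) :
    mean (M.law H θ) (fun τ => M.isWeight τ θ' θ • f τ) = mean (M.law H θ') f := by
  induction H with
  | zero => simp [law, trajLaw, mean_pure, isWeight]
  | succ n ih =>
    rw [mean_trajLaw_succ, mean_trajLaw_succ]
    simp only [isWeight_snoc, mul_smul, mean_smul, mean_softmaxPolicy_ratio_smul]
    exact ih _

theorem mean_isWeight (M : UtilityMDP S A d) (θ θ' : Param d) :
    mean (M.law H θ) (fun τ => M.isWeight τ θ' θ) = 1 := by
  simpa [mean_const] using M.mean_isWeight_smul (H := H) θ θ' fun _ => (1 : ℝ)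

theorem PolicyRegular.mean_isWeight_sq_le (hM : M.PolicyRegular l L) {θ θ' : Param d}
    (h : ‖θ' - θ‖ ≤ 1) (n : ℕ) :
    mean (M.law n θ) (fun τ => M.isWeight τ θ' θ ^ 2) ≤
      (1 + (2 * l * Real.exp (2 * l) * ‖θ' - θ‖) ^ 2) ^ n := by
  induction n with
  | zero => simp [law, trajLaw, mean_pure, isWeight]
  | succ n ih =>
    set B := 1 + (2 * l * Real.exp (2 * l) * ‖θ' - θ‖) ^ 2
    calc mean (M.law (n + 1) θ) (fun τ => M.isWeight τ θ' θ ^ 2)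
        ≤ mean (M.law n θ) fun τ => B * M.isWeight τ θ' θ ^ 2 := by
          rw [mean_trajLaw_succ]
          refine mean_mono fun τ _ => mean_le_of_forall_le fun s _ => ?_
          simp only [isWeight_snoc, mul_pow, mean_const_mul]
          rw [mul_comm]
          exact mul_le_mul_of_nonneg_right (hM.mean_softmaxProb_ratio_sq_le s h) (sq_nonneg _)
      _ = B * mean (M.law n θ) fun τ => M.isWeight τ θ' θ ^ 2 := mean_const_mul _ _ _
      _ ≤ B ^ (n + 1) := by
          rw [pow_succ']
          exact mul_le_mul_of_nonneg_left ih (by positivity)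

/-- The constant in the bound for the variance of the importance weights. -/
noncomputable def weightConst (l : ℝ) : ℝ :=
  (2 * l * Real.exp (2 * l)) ^ 2 * Real.exp ((2 * l * Real.exp (2 * l)) ^ 2)

theorem weightConst_nonneg (l : ℝ) : 0 ≤ weightConst l := by
  unfold weightConst
  positivity

theorem PolicyRegular.mean_one_sub_isWeight_sq_le (hM : M.PolicyRegular l L) {θ θ' : Param d}
    {a : ℝ} (h : ‖θ' - θ‖ ≤ a) (ha : a ≤ 1) (hH : H * a ^ 2 ≤ 1) :
    mean (M.law H θ) (fun τ => (1 - M.isWeight τ θ' θ) ^ 2) ≤ weightConst l * (H * a ^ 2) := by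
  set c := (2 * l * Real.exp (2 * l)) ^ 2 with hc
  have hx : 0 ≤ c * (H * a ^ 2) := by positivity
  have sq_expand (τ : Traj S A H) : (1 - M.isWeight τ θ' θ) ^ 2 =
      M.isWeight τ θ' θ ^ 2 + ((-2) * M.isWeight τ θ' θ + 1) := by ring
  have second_moment : mean (M.law H θ) (fun τ => M.isWeight τ θ' θ ^ 2) ≤
      Real.exp (c * (H * a ^ 2)) := by
    refine (hM.mean_isWeight_sq_le (h.trans ha) H).trans ?_
    rw [mul_pow, ← hc]
    calc (1 + c * ‖θ' - θ‖ ^ 2) ^ H ≤ (1 + c * a ^ 2) ^ H := by gcongr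
      _ ≤ Real.exp (c * a ^ 2) ^ H := by
          gcongr
          linarith [Real.add_one_le_exp (c * a ^ 2)]
      _ = Real.exp (c * (H * a ^ 2)) := by rw [← Real.exp_nat_mul]; ring_nf
  simp only [sq_expand, mean_add, mean_const_mul, mean_const, mean_isWeight]
  calc _ ≤ |Real.exp (c * (H * a ^ 2)) - 1| := by
        linarith [le_abs_self (Real.exp (c * (H * a ^ 2)) - 1)]
    _ ≤ c * (H * a ^ 2) * Real.exp (c * (H * a ^ 2)) := by
        exact (abs_exp_sub_one_le_mul_exp _).trans_eq (by rw [abs_of_nonneg hx])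
    _ ≤ c * (H * a ^ 2) * Real.exp c := by
        gcongr
        exact mul_le_of_le_one_right (sq_nonneg _) hH
    _ = weightConst l * (H * a ^ 2) := by rw [weightConst, ← hc]; ring

end UtilityMDP

/-! ### One step of the algorithm -/

theorem norm_add_sq_le_two_mul {E : Type*} [SeminormedAddCommGroup E] (x y : E) :
    ‖x + y‖ ^ 2 ≤ 2 * ‖x‖ ^ 2 + 2 * ‖y‖ ^ 2 := by
  have h := pow_le_pow_left₀ (norm_nonneg _) (norm_add_le x y) 2
  nlinarith [sq_nonneg (‖x‖ - ‖y‖)]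

theorem norm_smul_sq_le_sq_mul {E : Type*} [SeminormedAddCommGroup E] [NormedSpace ℝ E] (c : ℝ)
    {x : E} {C : ℝ} (hx : ‖x‖ ≤ C) : ‖c • x‖ ^ 2 ≤ c ^ 2 * C ^ 2 := by
  rw [norm_smul, mul_pow, Real.norm_eq_abs, sq_abs]
  gcongr

theorem mean_norm_recursive_momentum_sub_sq_le {α : Type*} [Fintype α] {E : Type*}
    [NormedAddCommGroup E] [InnerProductSpace ℝ E] (p : PMF α) {η : ℝ} (hη₀ : 0 ≤ η)
    (hη₁ : η ≤ 1) (x : E) (u v : α → E) :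
    mean p (fun a => ‖η • u a + (1 - η) • (x + (u a - v a)) - mean p u‖ ^ 2) ≤
      (1 - η) * ‖x - mean p v‖ ^ 2 +
        (2 * η ^ 2 * mean p (fun a => ‖u a‖ ^ 2) + 2 * mean p fun a => ‖u a - v a‖ ^ 2) := by
  let noise : α → E := fun a => η • u a + (1 - η) • (u a - v a)
  have mean_noise : mean p noise = mean p u - (1 - η) • mean p v := by
    simp only [noise, mean_add, mean_smul, mean_sub]
    module
  have contraction : (1 - η) ^ 2 ≤ 1 - η := by nlinarith
  have noise_sq_le (a : α) :
      ‖noise a‖ ^ 2 ≤ 2 * η ^ 2 * ‖u a‖ ^ 2 + 2 * ‖u a - v a‖ ^ 2 := by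
    have := norm_smul_sq_le_sq_mul (1 - η) (le_refl ‖u a - v a‖)
    nlinarith [norm_add_sq_le_two_mul (η • u a) ((1 - η) • (u a - v a)),
      norm_smul_sq_le_sq_mul η (le_refl ‖u a‖), sq_nonneg ‖u a - v a‖]
  calc mean p (fun a => ‖η • u a + (1 - η) • (x + (u a - v a)) - mean p u‖ ^ 2)
      = mean p (fun a => ‖(1 - η) • (x - mean p v) + (noise a - mean p noise)‖ ^ 2) := by
        congr with a
        rw [mean_noise]
        congr 2
        module
    _ ≤ ‖(1 - η) • (x - mean p v)‖ ^ 2 + mean p fun a => ‖noise a‖ ^ 2 :=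
        mean_norm_sq_add_sub_mean_le p _ noise
    _ ≤ _ := by
        refine add_le_add ((norm_smul_sq_le_sq_mul _ le_rfl).trans
          (mul_le_mul_of_nonneg_right contraction (sq_nonneg _))) ?_
        rw [← mean_const_mul, ← mean_const_mul, ← mean_add]
        exact mean_mono fun a _ => noise_sq_le a

theorem sub_le_inner_div_norm_smul {V : Type*} [NormedAddCommGroup V] [InnerProductSpace ℝ V]
    (g v : V) {a : ℝ} (ha : 0 ≤ a) :
    a * ‖g‖ - 2 * a * ‖v - g‖ ≤ inner ℝ g ((a / ‖v‖) • v) := by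
  rcases eq_or_ne v 0 with rfl | hv
  · simp only [smul_zero, inner_zero_right, zero_sub, norm_neg]
    nlinarith [mul_nonneg ha (norm_nonneg g)]
  · have hv' : 0 < ‖v‖ := norm_pos_iff.2 hv
    have inner_sub_ge := neg_le_of_abs_le (abs_real_inner_le_norm (g - v) v)
    rw [inner_sub_left, real_inner_self_eq_norm_sq, norm_sub_rev] at inner_sub_ge
    have inner_ge : (‖g‖ - 2 * ‖v - g‖) * ‖v‖ ≤ inner ℝ g v := by
      nlinarith [norm_le_norm_add_norm_sub v g]
    rw [inner_smul_right, div_mul_eq_mul_div, le_div_iff₀ hv']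
    nlinarith

theorem norm_div_norm_smul_le {V : Type*} [NormedAddCommGroup V] [NormedSpace ℝ V] (a : ℝ)
    (v : V) : ‖(a / ‖v‖) • v‖ ≤ |a| := by
  rw [norm_smul, norm_div, norm_norm, Real.norm_eq_abs, div_mul_comm]
  exact mul_le_of_le_one_left (abs_nonneg a) (div_self_le_one _)

namespace UtilityMDP

variable {S A : Type*} {d : ℕ} [Fintype S] [Fintype A] [Nonempty A] {H : ℕ}
  {M : UtilityMDP S A d} {l L : ℝ}

theorem UtilityRegular.objective_normStep_ge {D : Set (SAVec S A)} {R L₂ L₁ : ℝ}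
    (hF : M.UtilityRegular D R L₂ L₁) (hM : M.PolicyRegular l L) (hD : M.occupancySet ⊆ D)
    (hL₁ : 0 ≤ L₁) (θ v : Param d) {a : ℝ} (ha : 0 ≤ a) :
    M.objective θ + a * ‖gradient M.objective θ‖ - 2 * a * ‖v - gradient M.objective θ‖ -
      smoothConst l L R L₁ * M.effHorizon ^ 4 / 2 * a ^ 2 ≤ M.objective (normStep θ a v) := by
  have hL := hM.nonneg_right
  have hR := hF.nonneg hD
  have hκ := M.one_le_effHorizon
  have quadratic_le : smoothConst l L R L₁ * M.effHorizon ^ 4 / 2 * ‖(a / ‖v‖) • v‖ ^ 2 ≤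
      smoothConst l L R L₁ * M.effHorizon ^ 4 / 2 * a ^ 2 := by
    have step_le := (norm_div_norm_smul_le a v).trans_eq (abs_of_nonneg ha)
    unfold smoothConst
    gcongr
  have ascent := hF.objective_add_ge hM hD hL₁ θ ((a / ‖v‖) • v)
  have alignment := sub_le_inner_div_norm_smul (gradient M.objective θ) v ha
  rw [normStep]
  linarith

theorem PolicyRegular.mean_norm_one_sub_isWeight_smul_sq_le {E : Type*} [NormedAddCommGroup E]
    [NormedSpace ℝ E] (hM : M.PolicyRegular l L) {θ θ' : Param d} {a : ℝ} (h : ‖θ' - θ‖ ≤ a)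
    (ha : a ≤ 1) (hH : H * a ^ 2 ≤ 1) {f : Traj S A H → E} {C : ℝ} (hf : ∀ τ, ‖f τ‖ ≤ C) :
    mean (M.law H θ) (fun τ => ‖(1 - M.isWeight τ θ' θ) • f τ‖ ^ 2) ≤
      C ^ 2 * (weightConst l * (H * a ^ 2)) := by
  refine (mean_mono (g := fun τ => C ^ 2 * (1 - M.isWeight τ θ' θ) ^ 2) fun τ _ =>
    (norm_smul_sq_le_sq_mul _ (hf τ)).trans_eq (mul_comm _ _)).trans ?_
  rw [mean_const_mul]
  exact mul_le_mul_of_nonneg_left (hM.mean_one_sub_isWeight_sq_le h ha hH) (sq_nonneg C)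

variable [DecidableEq S] [DecidableEq A]

/-- The error `λ_t - 𝔼 λ(τ)` of the occupancy estimate. -/
noncomputable def lamErr (M : UtilityMDP S A d) (H : ℕ) (st : AlgState S A d) : SAVec S A :=
  st.lam - M.occMean H st.θprev

omit [DecidableEq S] [DecidableEq A] in
/-- The error `d_t - 𝔼 g(τ, θ_t, r_{t-1})` of the search direction. -/
noncomputable def dirErr (M : UtilityMDP S A d) (H : ℕ) (st : AlgState S A d) : Param d :=
  st.dir - M.pgMean H st.θprev st.rprev

namespace PolicyRegular

variable (hM : M.PolicyRegular l L) (α η : ℕ → ℝ) (t : ℕ) (st : AlgState S A d) {a : ℝ}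
  (hη₀ : 0 ≤ η t) (hη₁ : η t ≤ 1) (hst : ‖st.θprev - st.θ‖ ≤ a) (ha : a ≤ 1)
  (hH : H * a ^ 2 ≤ 1)
include hM hη₀ hη₁ hst ha hH

theorem mean_norm_lamErr_algStep_sq_le :
    mean (M.law H st.θ) (fun τ => ‖M.lamErr H (M.algStep α η t st τ)‖ ^ 2) ≤
      (1 - η t) * ‖M.lamErr H st‖ ^ 2 +
        M.effHorizon ^ 2 * (2 * η t ^ 2 + 2 * weightConst l * (H * a ^ 2)) := by
  have recursion := mean_norm_recursive_momentum_sub_sq_le (M.law H st.θ) hη₀ hη₁ st.lam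
    (fun τ => M.occEst τ) fun τ => M.isWeight τ st.θprev st.θ • M.occEst τ
  rw [mean_isWeight_smul] at recursion
  have estimate_sq_le : mean (M.law H st.θ) (fun τ => ‖M.occEst τ‖ ^ 2) ≤ M.effHorizon ^ 2 :=
    mean_le_of_forall_le fun τ _ => pow_le_pow_left₀ (norm_nonneg _) (M.norm_occEst_le τ) 2
  have correction_sq_le :=
    hM.mean_norm_one_sub_isWeight_smul_sq_le hst ha hH fun τ => M.norm_occEst_le τ
  simp only [lamErr, algStep, occMean, sub_smul, one_smul] at recursion correction_sq_le ⊢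
  nlinarith [mul_le_mul_of_nonneg_left estimate_sq_le (sq_nonneg (η t))]

theorem mean_norm_lam_algStep_sub_sq_le :
    mean (M.law H st.θ) (fun τ => ‖(M.algStep α η t st τ).lam - st.lam‖ ^ 2) ≤
      4 * η t ^ 2 * ‖M.lamErr H st‖ ^ 2 +
        M.effHorizon ^ 2 * (16 * η t ^ 2 + 2 * weightConst l * (H * a ^ 2)) := by
  have correction_sq_le :=
    hM.mean_norm_one_sub_isWeight_smul_sq_le hst ha hH fun τ => M.norm_occEst_le τ
  have pointwise (τ : Traj S A H) : ‖(M.algStep α η t st τ).lam - st.lam‖ ^ 2 ≤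
      4 * η t ^ 2 * ‖M.lamErr H st‖ ^ 2 + 16 * η t ^ 2 * M.effHorizon ^ 2 +
        2 * ‖(1 - M.isWeight τ st.θprev st.θ) • M.occEst τ‖ ^ 2 := by
    have increment_eq : (M.algStep α η t st τ).lam - st.lam =
        η t • (M.occEst τ - M.occMean H st.θprev + -M.lamErr H st) +
          (1 - η t) • ((1 - M.isWeight τ st.θprev st.θ) • M.occEst τ) := by
      simp only [algStep, lamErr]
      module
    have deviation_sq_le : ‖M.occEst τ - M.occMean H st.θprev‖ ^ 2 ≤ (2 * M.effHorizon) ^ 2 := by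
      refine pow_le_pow_left₀ (norm_nonneg _) ((norm_sub_le _ _).trans ?_) 2
      linarith [M.norm_occEst_le τ, M.norm_occMean_le H st.θprev]
    have innovation_sq_le := norm_add_sq_le_two_mul
      (M.occEst τ - M.occMean H st.θprev) (-M.lamErr H st)
    rw [norm_neg] at innovation_sq_le
    have contraction_le := mul_le_of_le_one_left
      (sq_nonneg ‖(1 - M.isWeight τ st.θprev st.θ) • M.occEst τ‖)
      (pow_le_one₀ (n := 2) (sub_nonneg.2 hη₁) (sub_le_self 1 hη₀))
    have smul_sq_le := (norm_smul_sq_le_sq_mul (1 - η t) le_rfl).trans contraction_le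
    rw [increment_eq]
    refine (norm_add_sq_le_two_mul _ _).trans ?_
    rw [norm_smul (η t), mul_pow, Real.norm_of_nonneg hη₀]
    nlinarith [mul_le_mul_of_nonneg_left innovation_sq_le (sq_nonneg (η t)),
      mul_le_mul_of_nonneg_left deviation_sq_le (sq_nonneg (η t))]
  refine (mean_mono fun τ _ => pointwise τ).trans ?_
  rw [mean_add, mean_const, mean_const_mul]
  linarith

end PolicyRegular

namespace PolicyRegular

variable (hM : M.PolicyRegular l L) {θ θ' : Param d} {a : ℝ} (hθ : ‖θ' - θ‖ ≤ a) (ha : a ≤ 1)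
  (hH : H * a ^ 2 ≤ 1) {r r' : SAVec S A} {R : ℝ}
include hM hθ ha hH

omit [DecidableEq S] [DecidableEq A] in
theorem mean_norm_pgEst_sub_isWeight_smul_sq_le (hr' : ∀ p, |r' p| ≤ R) :
    mean (M.law H θ) (fun τ => ‖M.pgEst τ θ r - M.isWeight τ θ' θ • M.pgEst τ θ' r'‖ ^ 2) ≤
      M.effHorizon ^ 4 * (8 * l ^ 2 * R ^ 2 * weightConst l * (H * a ^ 2) +
        16 * l ^ 2 * linfNorm (r - r') ^ 2 + 4 * R ^ 2 * (2 * L + 2 * l ^ 2) ^ 2 * a ^ 2) := by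
  have hL := hM.nonneg_right
  have hR := M.nonneg_of_forall_abs_le hr'
  set κ := M.effHorizon
  set C := R * (2 * L + 2 * l ^ 2)
  have split (τ : Traj S A H) : M.pgEst τ θ r - M.isWeight τ θ' θ • M.pgEst τ θ' r' =
      M.pgEst τ θ r - M.pgEst τ θ' r' + (1 - M.isWeight τ θ' θ) • M.pgEst τ θ' r' := by module
  have change_sq_le (τ : Traj S A H) : ‖M.pgEst τ θ r - M.pgEst τ θ' r'‖ ^ 2 ≤
      κ ^ 4 * (8 * l ^ 2 * linfNorm (r - r') ^ 2 + 2 * C ^ 2 * a ^ 2) := by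
    have change_le : ‖M.pgEst τ θ r - M.pgEst τ θ' r'‖ ≤
        (2 * l * linfNorm (r - r') + C * a) * κ ^ 2 :=
      (hM.norm_pgEst_sub_le hr' τ θ θ').trans (by rw [norm_sub_rev]; gcongr)
    calc ‖M.pgEst τ θ r - M.pgEst τ θ' r'‖ ^ 2
        ≤ κ ^ 4 * (2 * l * linfNorm (r - r') + C * a) ^ 2 :=
          (pow_le_pow_left₀ (norm_nonneg _) change_le 2).trans_eq (by ring)
      _ ≤ κ ^ 4 * (8 * l ^ 2 * linfNorm (r - r') ^ 2 + 2 * C ^ 2 * a ^ 2) :=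
          mul_le_mul_of_nonneg_left
            (by nlinarith [sq_nonneg (2 * l * linfNorm (r - r') - C * a)]) (by positivity)
  have reweighting_sq_le :=
    hM.mean_norm_one_sub_isWeight_smul_sq_le hθ ha hH fun τ => hM.norm_pgEst_le hr' τ θ'
  refine (mean_mono fun τ _ => (congrArg (‖·‖ ^ 2) (split τ)).trans_le
    ((norm_add_sq_le_two_mul _ _).trans
      (add_le_add_left (mul_le_mul_of_nonneg_left (change_sq_le τ) zero_le_two) _))).trans ?_
  rw [mean_add, mean_const, mean_const_mul]
  linear_combination 2 * reweighting_sq_le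

end PolicyRegular

omit [DecidableEq S] [DecidableEq A] in
theorem PolicyRegular.mean_norm_pgEst_sq_le (hM : M.PolicyRegular l L) (θ : Param d)
    {r : SAVec S A} {R : ℝ} (hr : ∀ p, |r p| ≤ R) :
    mean (M.law H θ) (fun τ => ‖M.pgEst τ θ r‖ ^ 2) ≤
      M.effHorizon ^ 4 * (4 * l ^ 2 * R ^ 2) :=
  mean_le_of_forall_le fun τ _ => (pow_le_pow_left₀ (norm_nonneg _)
    (hM.norm_pgEst_le hr τ θ) 2).trans_eq (by ring)

theorem PolicyRegular.mean_norm_dirErr_algStep_sq_le (hM : M.PolicyRegular l L) (α η : ℕ → ℝ)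
    (t : ℕ) (st : AlgState S A d) {a : ℝ} (hη₀ : 0 ≤ η t) (hη₁ : η t ≤ 1)
    (hst : ‖st.θprev - st.θ‖ ≤ a) (ha : a ≤ 1) (hH : H * a ^ 2 ≤ 1) {R : ℝ}
    (hr : ∀ p, |st.r p| ≤ R) (hr' : ∀ p, |st.rprev p| ≤ R) :
    mean (M.law H st.θ) (fun τ => ‖M.dirErr H (M.algStep α η t st τ)‖ ^ 2) ≤
      (1 - η t) * ‖M.dirErr H st‖ ^ 2 + M.effHorizon ^ 4 * (8 * l ^ 2 * R ^ 2 * η t ^ 2 +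
        16 * l ^ 2 * R ^ 2 * weightConst l * (H * a ^ 2) +
        32 * l ^ 2 * linfNorm (st.r - st.rprev) ^ 2 +
        8 * R ^ 2 * (2 * L + 2 * l ^ 2) ^ 2 * a ^ 2) := by
  have recursion := mean_norm_recursive_momentum_sub_sq_le (M.law H st.θ) hη₀ hη₁ st.dir
    (fun τ => M.pgEst τ st.θ st.r) fun τ =>
      M.isWeight τ st.θprev st.θ • M.pgEst τ st.θprev st.rprev
  rw [mean_isWeight_smul] at recursion
  have estimate_sq_le := mul_le_mul_of_nonneg_left
    (hM.mean_norm_pgEst_sq_le (H := H) st.θ hr) (sq_nonneg (η t))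
  have correction_sq_le :=
    hM.mean_norm_pgEst_sub_isWeight_smul_sq_le hst ha hH hr' (r := st.r)
  refine recursion.trans ?_
  simp only [dirErr, pgMean]
  linear_combination 2 * estimate_sq_le + 2 * correction_sq_le

end UtilityMDP

/-! ### The momentum parameters -/

namespace UtilityMDP

theorem momentum_pos (n : ℕ) : 0 < momentum n :=
  Real.rpow_pos_of_pos (by positivity) _

theorem one_le_momentum_zero : 1 ≤ momentum 0 :=
  Real.one_le_rpow (by norm_num) (by norm_num)

theorem momentum_succ_le_one (n : ℕ) : momentum (n + 1) ≤ 1 := by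
  refine Real.rpow_le_one (by positivity) ?_ (by norm_num)
  rw [div_le_one (by positivity)]
  push_cast
  linarith [(Nat.cast_nonneg n : (0 : ℝ) ≤ n)]

theorem momentum_succ_le (n : ℕ) : momentum (n + 1) ≤ momentum n := by
  refine Real.rpow_le_rpow (by positivity) ?_ (by norm_num)
  push_cast
  gcongr
  linarith

theorem one_div_momentum_le_succ (n : ℕ) : 1 / momentum n ≤ 1 / momentum (n + 1) :=
  one_div_le_one_div_of_le (momentum_pos _) (momentum_succ_le n)

theorem momentum_eq_succ_mul (n : ℕ) :
    momentum n = momentum (n + 1) * (1 + 1 / ((n : ℝ) + 1)) ^ (2 / 3 : ℝ) := by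
  rw [momentum, momentum, ← Real.mul_rpow (by positivity) (by positivity)]
  congr 1
  push_cast
  field_simp

theorem inv_succ_le_momentum_succ (n : ℕ) : 1 / ((n : ℝ) + 1) ≤ momentum (n + 1) := by
  have base_le_one : 2 / (((n + 1 : ℕ) : ℝ) + 1) ≤ 1 := by
    rw [div_le_one (by positivity)]
    push_cast
    linarith [(Nat.cast_nonneg n : (0 : ℝ) ≤ n)]
  calc 1 / ((n : ℝ) + 1) ≤ 2 / (((n + 1 : ℕ) : ℝ) + 1) := by
        rw [div_le_div_iff₀ (by positivity) (by positivity)]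
        push_cast
        linarith [(Nat.cast_nonneg n : (0 : ℝ) ≤ n)]
    _ = (2 / (((n + 1 : ℕ) : ℝ) + 1)) ^ (1 : ℝ) := (Real.rpow_one _).symm
    _ ≤ momentum (n + 1) :=
        Real.rpow_le_rpow_of_exponent_ge (by positivity) base_le_one (by norm_num)

theorem momentum_le_succ_add (n : ℕ) :
    momentum n ≤ momentum (n + 1) + 2 / 3 * momentum (n + 1) ^ 2 := by
  have inv_nonneg : 0 ≤ 1 / ((n : ℝ) + 1) := by positivity
  have η_pos := momentum_pos (n + 1)
  have bernoulli := rpow_one_add_le_one_add_mul_self (s := 1 / ((n : ℝ) + 1)) (p := 2 / 3)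
    (by linarith) (by norm_num) (by norm_num)
  calc momentum n = momentum (n + 1) * (1 + 1 / ((n : ℝ) + 1)) ^ (2 / 3 : ℝ) :=
        momentum_eq_succ_mul n
    _ ≤ momentum (n + 1) * (1 + 2 / 3 * momentum (n + 1)) := by
        gcongr
        linarith [inv_succ_le_momentum_succ n]
    _ = _ := by ring

theorem momentum_le_two_mul_succ (n : ℕ) : momentum n ≤ 2 * momentum (n + 1) := by
  nlinarith [momentum_le_succ_add n, momentum_succ_le_one n, momentum_pos (n + 1)]

theorem momentum_le_two (n : ℕ) : momentum n ≤ 2 := by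
  linarith [momentum_le_two_mul_succ n, momentum_succ_le_one n]

theorem momentum_sq_le_four_mul_succ_sq (n : ℕ) : momentum n ^ 2 ≤ 4 * momentum (n + 1) ^ 2 :=
  (pow_le_pow_left₀ (momentum_pos n).le (momentum_le_two_mul_succ n) 2).trans_eq (by ring)

theorem le_of_momentum_recursion {x : ℕ → ℝ} {a b : ℝ} {T : ℕ} (ha : 0 ≤ a) (hb : 0 ≤ b)
    (h0 : x 0 ≤ 3 * a)
    (hx : ∀ n, n + 1 < T → x (n + 1) ≤
      (1 - momentum (n + 1)) * x n + (a * momentum (n + 1) ^ 2 + b)) :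
    ∀ n < T, x n ≤ 3 * a * momentum n + b * (1 / momentum n) := by
  intro n
  induction n with
  | zero =>
    intro _
    have drift_nonneg : 0 ≤ b * (1 / momentum 0) :=
      mul_nonneg hb (one_div_nonneg.2 (momentum_pos 0).le)
    nlinarith [one_le_momentum_zero]
  | succ n ih =>
    intro hn
    have η_pos := momentum_pos (n + 1)
    have growth_le := momentum_le_succ_add n
    have inv_le := one_div_momentum_le_succ n
    have cube_nonneg := mul_nonneg ha (pow_nonneg η_pos.le 3)
    have weighted_ih := mul_le_mul_of_nonneg_left (ih (Nat.lt_of_succ_lt hn))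
      (sub_nonneg.2 (momentum_succ_le_one n))
    set η := momentum (n + 1)
    calc x (n + 1) ≤ (1 - η) * (3 * a * momentum n + b * (1 / momentum n)) + (a * η ^ 2 + b) :=
          (hx n hn).trans (add_le_add_left weighted_ih _)
      _ ≤ (1 - η) * (3 * a * (η + 2 / 3 * η ^ 2) + b * (1 / η)) + (a * η ^ 2 + b) := by
          have := momentum_succ_le_one n
          gcongr
      _ = 3 * a * η - 2 * (a * η ^ 3) + b * (1 / η) := by
          field_simp
          ring
      _ ≤ 3 * a * η + b * (1 / η) := by linarith

end UtilityMDP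

/-! ### The states of the run -/

namespace UtilityMDP

variable {S A : Type*} {d : ℕ} [Fintype S] [DecidableEq S] [Fintype A] [DecidableEq A] [Nonempty A]
  {H : ℕ} {M : UtilityMDP S A d} {θ₀ : Param d} {α η : ℕ → ℝ} {n : ℕ} {st : AlgState S A d}

/-- The states that the run takes with positive probability after the samples `τ_0, …, τ_n`. -/
def Reachable (M : UtilityMDP S A d) (θ₀ : Param d) (α η : ℕ → ℝ) (H n : ℕ)
    (st : AlgState S A d) : Prop :=
  ∃ ω ∈ (M.runLaw θ₀ α η H (n + 1)).support, M.algRun θ₀ α η n ω = st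

/-- The mean of a function of the state after the samples `τ_0, …, τ_n`. -/
noncomputable def runMean (M : UtilityMDP S A d) (θ₀ : Param d) (α η : ℕ → ℝ) (H n : ℕ)
    (f : AlgState S A d → ℝ) : ℝ :=
  mean (M.runLaw θ₀ α η H (n + 1)) fun ω => f (M.algRun θ₀ α η n ω)

theorem map_castLE_runLaw (M : UtilityMDP S A d) (θ₀ : Param d) (α η : ℕ → ℝ) {m n : ℕ}
    (h : m ≤ n) :
    (M.runLaw θ₀ α η H n).map (fun ω (i : Fin m) => ω (Fin.castLE h i)) =
      M.runLaw θ₀ α η H m :=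
  map_castLE_of_snoc (M.runLaw θ₀ α η H) _ (fun _ => rfl) h

theorem mean_runLaw_castLE (M : UtilityMDP S A d) (θ₀ : Param d) (α η : ℕ → ℝ) {n T : ℕ}
    (h : n + 1 ≤ T) (f : AlgState S A d → ℝ) :
    mean (M.runLaw θ₀ α η H T) (fun ω => f (M.algRun θ₀ α η n fun i => ω (Fin.castLE h i))) =
      M.runMean θ₀ α η H n f := by
  rw [runMean, ← M.map_castLE_runLaw θ₀ α η h, mean_map]

section Reachable

theorem Reachable.algStep (h : M.Reachable θ₀ α η H n st) {τ : Traj S A H}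
    (hτ : τ ∈ (M.law H st.θ).support) :
    M.Reachable θ₀ α η H (n + 1) (M.algStep α η (n + 1) st τ) := by
  obtain ⟨ω, hω, rfl⟩ := h
  refine ⟨Fin.snoc (α := fun _ => Traj S A H) ω τ, ?_, ?_⟩
  · rw [runLaw, PMF.mem_support_bind_iff]
    exact ⟨ω, hω, (PMF.mem_support_map_iff _ _ _).2 ⟨τ, hτ, rfl⟩⟩
  · simp only [algRun, Fin.init_snoc, Fin.snoc_last]

theorem Reachable.eq_algStep {st' : AlgState S A d} (h : M.Reachable θ₀ α η H (n + 1) st') :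
    ∃ st τ, M.Reachable θ₀ α η H n st ∧ st' = M.algStep α η (n + 1) st (τ : Traj S A H) := by
  obtain ⟨ω, hω, rfl⟩ := h
  refine ⟨_, ω (Fin.last (n + 1)), ⟨Fin.init (α := fun _ => Traj S A H) ω, ?_, rfl⟩, rfl⟩
  rw [← M.map_castLE_runLaw θ₀ α η (n + 1).le_succ, PMF.mem_support_map_iff]
  exact ⟨ω, hω, rfl⟩

theorem Reachable.r_eq (h : M.Reachable θ₀ α η H n st) : st.r = gradient M.F st.lam := by
  obtain ⟨ω, -, rfl⟩ := h
  cases n <;> rfl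

theorem Reachable.θ_eq (h : M.Reachable θ₀ α η H n st) :
    st.θ = normStep st.θprev (α n) st.dir := by
  obtain ⟨ω, -, rfl⟩ := h
  cases n <;> rfl

theorem Reachable.θprev_zero (h : M.Reachable θ₀ α η H 0 st) : st.θprev = θ₀ := by
  obtain ⟨ω, -, rfl⟩ := h
  rfl

theorem Reachable.norm_θprev_sub_le (h : M.Reachable θ₀ α η H n st) :
    ‖st.θprev - st.θ‖ ≤ |α n| := by
  rw [h.θ_eq, normStep, norm_sub_rev, add_sub_cancel_left]
  exact norm_div_norm_smul_le _ _

end Reachable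

section RunMean

variable {f g : AlgState S A d → ℝ}

theorem runMean_zero_eq (M : UtilityMDP S A d) (θ₀ : Param d) (α η : ℕ → ℝ)
    (f : AlgState S A d → ℝ) :
    M.runMean θ₀ α η H 0 f = mean (M.law H θ₀) fun τ => f (M.algInit θ₀ α τ) := by
  simp only [runMean, runLaw, mean_bind, mean_map, mean_pure, iterate, algRun]
  rfl

theorem runMean_succ (M : UtilityMDP S A d) (θ₀ : Param d) (α η : ℕ → ℝ) (n : ℕ)
    (f : AlgState S A d → ℝ) :
    M.runMean θ₀ α η H (n + 1) f = M.runMean θ₀ α η H n fun st =>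
      mean (M.law H st.θ) fun τ => f (M.algStep α η (n + 1) st τ) := by
  simp only [runMean]
  rw [runLaw, mean_bind]
  simp only [mean_map, iterate, algRun, Fin.init_snoc, Fin.snoc_last]

theorem runMean_mono (h : ∀ st, M.Reachable θ₀ α η H n st → f st ≤ g st) :
    M.runMean θ₀ α η H n f ≤ M.runMean θ₀ α η H n g :=
  mean_mono fun ω hω => h _ ⟨ω, hω, rfl⟩

theorem runMean_le_of_forall_le {C : ℝ} (h : ∀ st, M.Reachable θ₀ α η H n st → f st ≤ C) :
    M.runMean θ₀ α η H n f ≤ C :=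
  mean_le_of_forall_le fun ω hω => h _ ⟨ω, hω, rfl⟩

theorem runMean_add : M.runMean θ₀ α η H n (fun st => f st + g st) =
    M.runMean θ₀ α η H n f + M.runMean θ₀ α η H n g :=
  mean_add _ _ _

theorem runMean_const_mul (c : ℝ) :
    M.runMean θ₀ α η H n (fun st => c * f st) = c * M.runMean θ₀ α η H n f :=
  mean_const_mul _ _ _

theorem runMean_const (c : ℝ) : M.runMean θ₀ α η H n (fun _ => c) = c :=
  mean_const _ _

theorem runMean_le_mul_sqrt_add_sqrt {k x y : ℝ} (hk : 0 ≤ k) (hx : 0 ≤ x) (hy : 0 ≤ y)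
    (h : M.runMean θ₀ α η H n (fun st => f st ^ 2) ≤ k ^ 2 * (x + y)) :
    M.runMean θ₀ α η H n f ≤ k * (√x + √y) := by
  refine le_of_abs_le (abs_le_of_sq_le_sq (((sq_mean_le_mean_sq _ _).trans h).trans ?_)
    (by positivity))
  rw [mul_pow]
  refine mul_le_mul_of_nonneg_left ?_ (sq_nonneg k)
  nlinarith [Real.sq_sqrt hx, Real.sq_sqrt hy, mul_nonneg (Real.sqrt_nonneg x) (Real.sqrt_nonneg y)]

end RunMean

end UtilityMDP

/-! ### Second moments of the errors along the run -/

namespace UtilityMDP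

theorem momentum_succ_sq_mul_le {x : ℝ} (hx : 0 ≤ x) (n : ℕ) :
    momentum (n + 1) ^ 2 * (6 * momentum n + x * (1 / momentum n)) ≤
      12 * momentum (n + 1) ^ 2 + x := by
  have η_pos := momentum_pos (n + 1)
  have η_le_one := momentum_succ_le_one n
  have le_two := momentum_le_two n
  have inv_le := one_div_momentum_le_succ n
  set η := momentum (n + 1)
  calc η ^ 2 * (6 * momentum n + x * (1 / momentum n))
      ≤ η ^ 2 * (6 * 2 + x * (1 / η)) := by gcongr
    _ = 12 * η ^ 2 + x * η := by
        field_simp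
        ring
    _ ≤ 12 * η ^ 2 + x := by
        gcongr
        exact mul_le_of_le_one_right hx η_le_one

variable {S A : Type*} {d : ℕ} [Fintype S] [DecidableEq S] [Fintype A] [DecidableEq A] [Nonempty A]
  {H T n : ℕ} {M : UtilityMDP S A d} {θ₀ : Param d} {α η : ℕ → ℝ} {st : AlgState S A d}
  {D : Set (SAVec S A)} {l L R L₂ L₁ a : ℝ}

/-- The estimates `λ_0, …, λ_{T-1}` of the run lie in `D` almost surely. -/
def EstimatesIn (M : UtilityMDP S A d) (θ₀ : Param d) (α η : ℕ → ℝ) (H T : ℕ)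
    (D : Set (SAVec S A)) : Prop :=
  ∀ n < T, ∀ st, M.Reachable θ₀ α η H n st → st.lam ∈ D

theorem RunStaysIn.estimatesIn {α₀ : ℝ} (h : M.RunStaysIn θ₀ α₀ T D) :
    M.EstimatesIn θ₀ (stepSize α₀ T) momentum (horizon M.γ T) T D := by
  rintro n hn _ ⟨ω, hω, rfl⟩
  rw [← M.map_castLE_runLaw θ₀ _ _ (Nat.succ_le_of_lt hn), PMF.mem_support_map_iff] at hω
  obtain ⟨ω', hω', rfl⟩ := hω
  exact h ω' hω' ⟨n, hn⟩

namespace UtilityRegular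

variable (hF : M.UtilityRegular D R L₂ L₁) (hE : M.EstimatesIn θ₀ α η H T D)
include hF hE

theorem abs_r_le (hn : n < T) (hst : M.Reachable θ₀ α η H n st) (p : S × A) : |st.r p| ≤ R := by
  rw [hst.r_eq]
  exact (abs_apply_le_linfNorm _ p).trans (hF.gradient_le _ (hE n hn st hst))

theorem abs_rprev_le (hn : n < T) (hst : M.Reachable θ₀ α η H n st) (p : S × A) :
    |st.rprev p| ≤ R := by
  cases n with
  | zero =>
    obtain ⟨ω, hω, rfl⟩ := hst
    exact hF.abs_r_le hE hn ⟨ω, hω, rfl⟩ p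
  | succ n =>
    obtain ⟨st', τ, hst', rfl⟩ := hst.eq_algStep
    exact hF.abs_r_le hE (Nat.lt_of_succ_lt hn) hst' p

theorem linfNorm_r_sub_rprev_algStep_le (hn : n + 1 < T) (hst : M.Reachable θ₀ α η H n st)
    {τ : Traj S A H} (hτ : τ ∈ (M.law H st.θ).support) :
    linfNorm ((M.algStep α η (n + 1) st τ).r - (M.algStep α η (n + 1) st τ).rprev) ≤
      L₂ * ‖(M.algStep α η (n + 1) st τ).lam - st.lam‖ := by
  have next := hst.algStep hτ
  rw [next.r_eq, show (M.algStep α η (n + 1) st τ).rprev = st.r from rfl, hst.r_eq]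
  exact hF.lipschitz_two _ (hE _ hn _ next) _ (hE _ (Nat.lt_of_succ_lt hn) _ hst)

end UtilityRegular

section SecondMoments

variable (hM : M.PolicyRegular l L) (hα : ∀ n, |α n| ≤ a) (ha : a ≤ 1) (hH : H * a ^ 2 ≤ 1)
include hM hα ha hH

theorem PolicyRegular.runMean_norm_lamErr_sq_le (n : ℕ) :
    M.runMean θ₀ α momentum H n (fun st => ‖M.lamErr H st‖ ^ 2) ≤
      M.effHorizon ^ 2 *
        (6 * momentum n + 2 * weightConst l * (H * a ^ 2) * (1 / momentum n)) := by
  have hκ := M.one_le_effHorizon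
  have hW := weightConst_nonneg l
  refine (le_of_momentum_recursion (T := n + 1) (a := M.effHorizon ^ 2 * 2)
    (b := M.effHorizon ^ 2 * (2 * weightConst l * (H * a ^ 2)))
    (x := fun n => M.runMean θ₀ α momentum H n fun st => ‖M.lamErr H st‖ ^ 2)
    (by positivity) (by positivity) ?_ (fun n _ => ?_) n n.lt_succ_self).trans_eq (by ring)
  · rw [runMean_zero_eq]
    refine mean_le_of_forall_le fun τ _ => ?_
    have initial_le : ‖M.lamErr H (M.algInit θ₀ α τ)‖ ≤ 2 * M.effHorizon :=
      (norm_sub_le _ _).trans ((add_le_add (M.norm_occEst_le τ)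
        (M.norm_occMean_le H θ₀)).trans_eq (two_mul _).symm)
    nlinarith [pow_le_pow_left₀ (norm_nonneg _) initial_le 2]
  · rw [runMean_succ, ← runMean_const_mul,
      ← runMean_const (M := M) (θ₀ := θ₀) (α := α) (η := momentum) (H := H) (n := n)
        (M.effHorizon ^ 2 * 2 * momentum (n + 1) ^ 2 + _), ← runMean_add]
    exact runMean_mono fun st hst =>
      (hM.mean_norm_lamErr_algStep_sq_le α momentum (n + 1) st (momentum_pos _).le
        (momentum_succ_le_one n) (hst.norm_θprev_sub_le.trans (hα n)) ha hH).trans_eq (by ring)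

theorem PolicyRegular.runMean_norm_lam_algStep_sub_sq_le (n : ℕ) :
    M.runMean θ₀ α momentum H n (fun st => mean (M.law H st.θ) fun τ =>
        ‖(M.algStep α momentum (n + 1) st τ).lam - st.lam‖ ^ 2) ≤
      M.effHorizon ^ 2 *
        (64 * momentum (n + 1) ^ 2 + 10 * weightConst l * (H * a ^ 2)) := by
  have hW := weightConst_nonneg l
  have lamErr_le := hM.runMean_norm_lamErr_sq_le (θ₀ := θ₀) hα ha hH n
  have scalar_le := momentum_succ_sq_mul_le
    (by positivity : 0 ≤ 2 * weightConst l * (H * a ^ 2)) n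
  refine (runMean_mono fun st hst =>
    hM.mean_norm_lam_algStep_sub_sq_le α momentum (n + 1) st (momentum_pos _).le
      (momentum_succ_le_one n) (hst.norm_θprev_sub_le.trans (hα n)) ha hH).trans ?_
  rw [runMean_add, runMean_const_mul, runMean_const]
  linear_combination 4 * momentum (n + 1) ^ 2 * lamErr_le + 4 * M.effHorizon ^ 2 * scalar_le

theorem UtilityRegular.runMean_linfNorm_r_sub_rprev_sq_le (hF : M.UtilityRegular D R L₂ L₁)
    (hE : M.EstimatesIn θ₀ α momentum H T D) (hn : n < T) :
    M.runMean θ₀ α momentum H n (fun st => linfNorm (st.r - st.rprev) ^ 2) ≤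
      L₂ ^ 2 * M.effHorizon ^ 2 *
        (64 * momentum n ^ 2 + 10 * weightConst l * (H * a ^ 2)) := by
  have hW := weightConst_nonneg l
  cases n with
  | zero =>
    rw [runMean_zero_eq]
    refine mean_le_of_forall_le fun τ _ => ?_
    have no_change : (M.algInit θ₀ α τ).r - (M.algInit θ₀ α τ).rprev = 0 := sub_self _
    have linfNorm_zero : linfNorm (0 : SAVec S A) = 0 := norm_zero (E := S × A → ℝ)
    rw [no_change, linfNorm_zero, zero_pow two_ne_zero]
    positivity
  | succ n =>
    rw [runMean_succ, mul_assoc]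
    refine le_trans ?_ (mul_le_mul_of_nonneg_left
      (hM.runMean_norm_lam_algStep_sub_sq_le (θ₀ := θ₀) hα ha hH n) (sq_nonneg L₂))
    rw [← runMean_const_mul]
    refine runMean_mono fun st hst => ?_
    rw [← mean_const_mul]
    exact mean_mono fun τ hτ => (pow_le_pow_left₀ (linfNorm_nonneg _)
      (hF.linfNorm_r_sub_rprev_algStep_le hE hn hst hτ) 2).trans_eq (mul_pow _ _ _)

end SecondMoments

/-- The coefficient of the sampling noise `η_n` in the second moment of the direction error. -/
def noiseConst (l R L₂ : ℝ) : ℝ := 16 * l ^ 2 * R ^ 2 + 8192 * l ^ 2 * L₂ ^ 2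

/-- The coefficient of the drift `H a²` of the iterates in the second moment of the direction
error. -/
noncomputable def driftConst (l L R L₂ : ℝ) : ℝ :=
  16 * l ^ 2 * R ^ 2 * weightConst l + 320 * l ^ 2 * L₂ ^ 2 * weightConst l +
    8 * R ^ 2 * (2 * L + 2 * l ^ 2) ^ 2

theorem noiseConst_nonneg (l R L₂ : ℝ) : 0 ≤ noiseConst l R L₂ := by
  unfold noiseConst
  positivity

theorem driftConst_nonneg (l L R L₂ : ℝ) : 0 ≤ driftConst l L R L₂ := by
  have := weightConst_nonneg l
  unfold driftConst
  positivity

theorem UtilityRegular.norm_dirErr_algInit_sq_le (hF : M.UtilityRegular D R L₂ L₁)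
    (hM : M.PolicyRegular l L) (hE : M.EstimatesIn θ₀ α η H T D) (hT : 0 < T) {τ : Traj S A H}
    (h : M.Reachable θ₀ α η H 0 (M.algInit θ₀ α τ)) :
    ‖M.dirErr H (M.algInit θ₀ α τ)‖ ^ 2 ≤ M.effHorizon ^ 4 * (16 * l ^ 2 * R ^ 2) := by
  have r_le := hF.abs_r_le hE hT h
  have initial_le : ‖M.dirErr H (M.algInit θ₀ α τ)‖ ≤ 4 * l * R * M.effHorizon ^ 2 := by
    refine (norm_sub_le _ _).trans ((add_le_add (hM.norm_pgEst_le r_le τ θ₀)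
      (hM.norm_pgMean_le r_le θ₀)).trans_eq (by ring))
  exact (pow_le_pow_left₀ (norm_nonneg _) initial_le 2).trans_eq (by ring)

theorem dirErr_recursion_scalar_le {κ q e e' : ℝ} (hκ : 1 ≤ κ) (ha : a ^ 2 ≤ q)
    (he : e' ^ 2 ≤ 4 * e ^ 2) :
    κ ^ 4 * (8 * l ^ 2 * R ^ 2 * e ^ 2 + 16 * l ^ 2 * R ^ 2 * weightConst l * q +
        8 * R ^ 2 * (2 * L + 2 * l ^ 2) ^ 2 * a ^ 2) +
      κ ^ 4 * (32 * l ^ 2) *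
        (L₂ ^ 2 * κ ^ 2 * (64 * e' ^ 2 + 10 * weightConst l * q)) ≤
      κ ^ 6 * noiseConst l R L₂ * e ^ 2 + κ ^ 6 * (driftConst l L R L₂ * q) := by
  have hW := weightConst_nonneg l
  have hq : 0 ≤ q := (sq_nonneg a).trans ha
  calc _ ≤ κ ^ 6 * (16 * l ^ 2 * R ^ 2 * e ^ 2 + 16 * l ^ 2 * R ^ 2 * weightConst l * q +
          8 * R ^ 2 * (2 * L + 2 * l ^ 2) ^ 2 * q) +
        κ ^ 4 * (32 * l ^ 2) *
          (L₂ ^ 2 * κ ^ 2 * (64 * (4 * e ^ 2) + 10 * weightConst l * q)) := by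
        gcongr <;> norm_num
    _ = _ := by
        unfold noiseConst driftConst
        ring

section SecondMoments

variable (hF : M.UtilityRegular D R L₂ L₁) (hM : M.PolicyRegular l L)
  (hE : M.EstimatesIn θ₀ α momentum H T D) (hα : ∀ n, |α n| ≤ a) (ha : a ≤ 1)
  (hH₁ : 1 ≤ H) (hH : H * a ^ 2 ≤ 1)
include hF hM hE hα ha hH₁ hH

theorem UtilityRegular.runMean_norm_dirErr_sq_succ_le (hn : n + 1 < T) :
    M.runMean θ₀ α momentum H (n + 1) (fun st => ‖M.dirErr H st‖ ^ 2) ≤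
      (1 - momentum (n + 1)) * M.runMean θ₀ α momentum H n (fun st => ‖M.dirErr H st‖ ^ 2) +
        (M.effHorizon ^ 6 * noiseConst l R L₂ * momentum (n + 1) ^ 2 +
          M.effHorizon ^ 6 * (driftConst l L R L₂ * (H * a ^ 2))) := by
  have hn' := Nat.lt_of_succ_lt hn
  have change_le := mul_le_mul_of_nonneg_left
    (hF.runMean_linfNorm_r_sub_rprev_sq_le hM hα ha hH hE hn')
    (by positivity : 0 ≤ M.effHorizon ^ 4 * (32 * l ^ 2))
  have sq_le : a ^ 2 ≤ H * a ^ 2 :=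
    le_mul_of_one_le_left (sq_nonneg a) (by exact_mod_cast hH₁)
  have scalar_le := dirErr_recursion_scalar_le (l := l) (L := L) (R := R) (L₂ := L₂)
    M.one_le_effHorizon sq_le (momentum_sq_le_four_mul_succ_sq n)
  rw [runMean_succ]
  refine (runMean_mono fun st hst =>
    hM.mean_norm_dirErr_algStep_sq_le α momentum (n + 1) st (momentum_pos _).le
      (momentum_succ_le_one n) (hst.norm_θprev_sub_le.trans (hα n)) ha hH
      (hF.abs_r_le hE hn' hst) (hF.abs_rprev_le hE hn' hst)).trans ?_
  simp only [runMean_add, runMean_const_mul, runMean_const]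
  linear_combination change_le + scalar_le

theorem UtilityRegular.runMean_norm_dirErr_sq_le (hn : n < T) :
    M.runMean θ₀ α momentum H n (fun st => ‖M.dirErr H st‖ ^ 2) ≤
      M.effHorizon ^ 6 * (3 * noiseConst l R L₂ * momentum n +
        driftConst l L R L₂ * (H * a ^ 2) * (1 / momentum n)) := by
  have hκ := M.one_le_effHorizon
  have hN := noiseConst_nonneg l R L₂
  have hB := driftConst_nonneg l L R L₂
  refine (le_of_momentum_recursion (a := M.effHorizon ^ 6 * noiseConst l R L₂)
    (b := M.effHorizon ^ 6 * (driftConst l L R L₂ * (H * a ^ 2)))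
    (x := fun n => M.runMean θ₀ α momentum H n fun st => ‖M.dirErr H st‖ ^ 2)
    (by positivity) (by positivity) (runMean_le_of_forall_le ?_) (fun n hn =>
      hF.runMean_norm_dirErr_sq_succ_le hM hE hα ha hH₁ hH hn) n hn).trans_eq (by ring)
  rintro _ ⟨ω, hω, rfl⟩
  calc _ ≤ M.effHorizon ^ 4 * (16 * l ^ 2 * R ^ 2) :=
        hF.norm_dirErr_algInit_sq_le hM hE (Nat.zero_lt_of_lt hn) ⟨ω, hω, rfl⟩
    _ ≤ M.effHorizon ^ 6 * noiseConst l R L₂ := by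
        unfold noiseConst
        gcongr
        · norm_num
        · exact le_add_of_nonneg_right (by positivity)
    _ ≤ 3 * (M.effHorizon ^ 6 * noiseConst l R L₂) :=
        le_mul_of_one_le_left (by positivity) (by norm_num)

end SecondMoments

end UtilityMDP

/-! ### The deviation of the search directions from the gradient -/

namespace UtilityMDP

variable {S A : Type*} {d : ℕ} [Fintype S] [DecidableEq S] [Fintype A] [DecidableEq A] [Nonempty A]
  {H T n : ℕ} {M : UtilityMDP S A d} {θ₀ : Param d} {α η : ℕ → ℝ} {st : AlgState S A d}
  {D : Set (SAVec S A)} {l L R L₂ L₁ a : ℝ}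

section

variable (hF : M.UtilityRegular D R L₂ L₁) (hM : M.PolicyRegular l L) (hD : M.occupancySet ⊆ D)
include hF hD

include hM in
omit [DecidableEq S] [DecidableEq A] in
theorem UtilityRegular.norm_pgMean_sub_gradient_le {r : SAVec S A} {θ : Param d} {ρ : ℝ}
    (hr : ∀ p, |(r - M.reward θ) p| ≤ ρ) (H : ℕ) :
    ‖M.pgMean H θ r - gradient M.objective θ‖ ≤ 2 * l * ρ * M.effHorizon ^ 2 +
      2 * l * R * (M.γ ^ H * (M.effHorizon ^ 2 + H * M.effHorizon)) := by
  have reward_error := hM.norm_pgMean_le (H := H) hr θ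
  have truncation_error := hM.norm_valueGrad_sub_sum_le (hF.abs_reward_le hD θ) θ H
  rw [pgMean_sub] at reward_error
  rw [← pgMean_eq, norm_sub_rev] at truncation_error
  rw [hF.gradient_objective hM hD]
  exact (norm_sub_le_norm_sub_add_norm_sub _ _ _).trans (add_le_add reward_error truncation_error)

theorem UtilityRegular.linfNorm_r_sub_reward_le (hL₂ : 0 ≤ L₂)
    (hE : M.EstimatesIn θ₀ α η H T D) (hn : n < T) (hst : M.Reachable θ₀ α η H n st) :
    linfNorm (st.r - M.reward st.θprev) ≤
      L₂ * (‖M.lamErr H st‖ + M.γ ^ H * M.effHorizon) := by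
  have truncation_error := M.norm_occupancy_sub_sum_le (M.softmaxPolicy st.θprev) H
  rw [← occMean_eq, norm_sub_rev] at truncation_error
  rw [hst.r_eq]
  refine (hF.lipschitz_two _ (hE n hn st hst) _ (occupancy_mem hD _)).trans
    (mul_le_mul_of_nonneg_left ?_ hL₂)
  exact (norm_sub_le_norm_sub_add_norm_sub _ (M.occMean H st.θprev) _).trans
    (add_le_add_right truncation_error _)

/-- The part of the deviation of the search direction from the gradient that does not come from
sampling: the reward lags one iterate behind, and the trajectories are truncated at `H`. -/
noncomputable def biasBound (M : UtilityMDP S A d) (l R L₂ L₁ : ℝ) (H : ℕ) (a : ℝ) : ℝ :=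
  4 * l ^ 2 * L₁ * M.effHorizon ^ 4 * a +
    (2 * l * L₂ * M.effHorizon ^ 3 + 2 * l * R * (M.effHorizon ^ 2 + H * M.effHorizon)) * M.γ ^ H

include hM in
theorem UtilityRegular.norm_pgMean_r_sub_gradient_le (hL₂ : 0 ≤ L₂) (hL₁ : 0 ≤ L₁)
    (hE : M.EstimatesIn θ₀ α η H T D) (hα : ∀ n, |α n| ≤ a) (hn : n < T)
    (hst : M.Reachable θ₀ α η H n st) :
    ‖M.pgMean H st.θ st.r - gradient M.objective st.θ‖ ≤
      2 * l * L₂ * M.effHorizon ^ 2 * ‖M.lamErr H st‖ + M.biasBound l R L₂ L₁ H a := by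
  have hl := hM.nonneg_left
  have reward_change := hF.linfNorm_reward_sub_le hM hD hL₁ st.θprev st.θ
  have lag := hst.norm_θprev_sub_le.trans (hα n)
  have estimate_error := hF.linfNorm_r_sub_reward_le hD hL₂ hE hn hst
  have reward_error (p : S × A) : |(st.r - M.reward st.θ) p| ≤
      L₂ * (‖M.lamErr H st‖ + M.γ ^ H * M.effHorizon) +
        L₁ * (2 * l * M.effHorizon ^ 2 * a) :=
    calc |(st.r - M.reward st.θ) p|
        ≤ |(st.r - M.reward st.θprev) p| + |(M.reward st.θprev - M.reward st.θ) p| :=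
          abs_sub_le _ _ _
      _ ≤ L₂ * (‖M.lamErr H st‖ + M.γ ^ H * M.effHorizon) +
          L₁ * (2 * l * M.effHorizon ^ 2 * ‖st.θprev - st.θ‖) :=
          add_le_add ((abs_apply_le_linfNorm _ p).trans estimate_error)
            ((abs_apply_le_linfNorm _ p).trans reward_change)
      _ ≤ _ := by gcongr
  refine (hF.norm_pgMean_sub_gradient_le hM hD reward_error H).trans_eq ?_
  rw [biasBound]
  ring

include hM in
theorem UtilityRegular.runMean_norm_dir_sub_gradient_le_add (hL₂ : 0 ≤ L₂) (hL₁ : 0 ≤ L₁)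
    (hE : M.EstimatesIn θ₀ α η H T D) (hα : ∀ n, |α n| ≤ a) (hn : n < T) :
    M.runMean θ₀ α η H (n + 1) (fun st => ‖st.dir - gradient M.objective st.θprev‖) ≤
      M.runMean θ₀ α η H (n + 1) (fun st => ‖M.dirErr H st‖) +
        (2 * l * L₂ * M.effHorizon ^ 2 * M.runMean θ₀ α η H n (fun st => ‖M.lamErr H st‖) +
          M.biasBound l R L₂ L₁ H a) := by
  rw [← runMean_const_mul,
    ← runMean_const (M := M) (θ₀ := θ₀) (α := α) (η := η) (H := H) (n := n) (M.biasBound ..),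
    ← runMean_add, runMean_succ, runMean_succ, ← runMean_add]
  refine runMean_mono fun st hst => ?_
  rw [← mean_const (M.law H st.θ) (_ + M.biasBound ..), ← mean_add]
  exact mean_mono fun τ _ => (norm_sub_le_norm_sub_add_norm_sub _ (M.pgMean H st.θ st.r) _).trans
    (add_le_add_right (hF.norm_pgMean_r_sub_gradient_le hM hD hL₂ hL₁ hE hα hn hst) _)

end

/-- The coefficient of `√η_t` in the mean deviation of the search direction. -/
noncomputable def noiseRate (l R L₂ : ℝ) : ℝ := √(3 * noiseConst l R L₂) + 2 * l * L₂ * √12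

/-- The coefficient of `√(H a²) / √η_t` in the mean deviation of the search direction. -/
noncomputable def driftRate (l L R L₂ : ℝ) : ℝ :=
  √(driftConst l L R L₂) + 2 * l * L₂ * √(2 * weightConst l)

section MeanErrors

variable (hM : M.PolicyRegular l L) (hα : ∀ n, |α n| ≤ a) (ha : a ≤ 1) (hH : H * a ^ 2 ≤ 1)
include hM hα ha hH

theorem PolicyRegular.runMean_norm_lamErr_le (n : ℕ) :
    M.runMean θ₀ α momentum H n (fun st => ‖M.lamErr H st‖) ≤
      M.effHorizon * (√12 * √(momentum (n + 1)) +
        √(2 * weightConst l) * √(H * a ^ 2) * √(1 / momentum (n + 1))) := by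
  have hκ := M.one_le_effHorizon
  have hW := weightConst_nonneg l
  have η_pos := momentum_pos (n + 1)
  rw [← Real.sqrt_mul (by norm_num), ← Real.sqrt_mul (by positivity),
    ← Real.sqrt_mul (by positivity)]
  refine runMean_le_mul_sqrt_add_sqrt (by positivity) (by positivity) (by positivity)
    ((hM.runMean_norm_lamErr_sq_le hα ha hH n).trans ?_)
  gcongr M.effHorizon ^ 2 * (?_ + _ * ?_)
  · linarith [momentum_le_two_mul_succ n]
  · exact one_div_momentum_le_succ n

theorem UtilityRegular.runMean_norm_dirErr_le (hF : M.UtilityRegular D R L₂ L₁)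
    (hE : M.EstimatesIn θ₀ α momentum H T D) (hH₁ : 1 ≤ H) (hn : n < T) :
    M.runMean θ₀ α momentum H n (fun st => ‖M.dirErr H st‖) ≤
      M.effHorizon ^ 3 * (√(3 * noiseConst l R L₂) * √(momentum n) +
        √(driftConst l L R L₂) * √(H * a ^ 2) * √(1 / momentum n)) := by
  have hκ := M.one_le_effHorizon
  have hN := noiseConst_nonneg l R L₂
  have hB := driftConst_nonneg l L R L₂
  have η_pos := momentum_pos n
  rw [← Real.sqrt_mul (by positivity), ← Real.sqrt_mul (by positivity),
    ← Real.sqrt_mul (by positivity)]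
  exact runMean_le_mul_sqrt_add_sqrt (by positivity) (by positivity) (by positivity)
    ((hF.runMean_norm_dirErr_sq_le hM hE hα ha hH₁ hH hn).trans_eq (by ring))

theorem UtilityRegular.runMean_norm_dir_sub_gradient_le (hF : M.UtilityRegular D R L₂ L₁)
    (hD : M.occupancySet ⊆ D) (hL₂ : 0 ≤ L₂) (hL₁ : 0 ≤ L₁)
    (hE : M.EstimatesIn θ₀ α momentum H T D) (hH₁ : 1 ≤ H) (hn : n + 1 < T) :
    M.runMean θ₀ α momentum H (n + 1) (fun st => ‖st.dir - gradient M.objective st.θprev‖) ≤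
      M.effHorizon ^ 3 * (noiseRate l R L₂ * √(momentum (n + 1)) +
        driftRate l L R L₂ * √(H * a ^ 2) * √(1 / momentum (n + 1))) +
      M.biasBound l R L₂ L₁ H a := by
  have hl := hM.nonneg_left
  have hκ := M.one_le_effHorizon
  refine (hF.runMean_norm_dir_sub_gradient_le_add hM hD hL₂ hL₁ hE hα
    (Nat.lt_of_succ_lt hn)).trans ?_
  have dirErr_le := hF.runMean_norm_dirErr_le (θ₀ := θ₀) hM hα ha hH hE hH₁ hn
  have lamErr_le := mul_le_mul_of_nonneg_left (hM.runMean_norm_lamErr_le (θ₀ := θ₀) hα ha hH n)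
    (by positivity : 0 ≤ 2 * l * L₂ * M.effHorizon ^ 2)
  unfold noiseRate driftRate
  linear_combination dirErr_le + lamErr_le

end MeanErrors

/-! ### Ascent along the run -/

section Ascent

variable (hF : M.UtilityRegular D R L₂ L₁) (hM : M.PolicyRegular l L) (hD : M.occupancySet ⊆ D)
  (hL₁ : 0 ≤ L₁)

theorem runMean_succ_θprev (M : UtilityMDP S A d) (θ₀ : Param d) (α η : ℕ → ℝ) (H n : ℕ)
    (f : Param d → ℝ) :
    M.runMean θ₀ α η H (n + 1) (fun st => f st.θprev) =
      M.runMean θ₀ α η H n fun st => f st.θ := by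
  rw [runMean_succ]
  exact congrArg _ (funext fun st => mean_const (M.law H st.θ) (f st.θ))

/-- The mean `𝔼 F(λ(θ_{n+1}))`. -/
noncomputable def meanObjective (M : UtilityMDP S A d) (θ₀ : Param d) (α η : ℕ → ℝ) (H n : ℕ) : ℝ :=
  M.runMean θ₀ α η H n fun st => M.objective st.θ

/-- The mean `𝔼 ‖∇ F(λ(θ_{n+1}))‖`. -/
noncomputable def meanGradNorm (M : UtilityMDP S A d) (θ₀ : Param d) (α η : ℕ → ℝ) (H n : ℕ) : ℝ :=
  M.runMean θ₀ α η H n fun st => ‖gradient M.objective st.θ‖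

include hF hM hD

theorem UtilityRegular.meanGradNorm_le (n : ℕ) :
    M.meanGradNorm θ₀ α η H n ≤ 2 * l * R * M.effHorizon ^ 2 :=
  runMean_le_of_forall_le fun _ _ => hF.norm_gradient_objective_le hM hD _

include hL₁

theorem UtilityRegular.meanObjective_succ_ge (hα : 0 ≤ α (n + 1)) :
    M.meanObjective θ₀ α η H n + α (n + 1) * M.meanGradNorm θ₀ α η H n -
      2 * α (n + 1) * M.runMean θ₀ α η H (n + 1)
        (fun st => ‖st.dir - gradient M.objective st.θprev‖) -
      smoothConst l L R L₁ * M.effHorizon ^ 4 / 2 * α (n + 1) ^ 2 ≤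
      M.meanObjective θ₀ α η H (n + 1) := by
  have step : M.runMean θ₀ α η H (n + 1)
        (fun st => M.objective st.θprev + α (n + 1) * ‖gradient M.objective st.θprev‖) ≤
      M.runMean θ₀ α η H (n + 1) fun st => M.objective st.θ +
        (2 * α (n + 1) * ‖st.dir - gradient M.objective st.θprev‖ +
          smoothConst l L R L₁ * M.effHorizon ^ 4 / 2 * α (n + 1) ^ 2) := by
    refine runMean_mono fun st hst => ?_
    rw [hst.θ_eq]
    linarith [hF.objective_normStep_ge hM hD hL₁ st.θprev st.dir hα]
  have start_eq := M.runMean_succ_θprev θ₀ α η H n M.objective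
  have grad_eq := M.runMean_succ_θprev θ₀ α η H n fun θ => ‖gradient M.objective θ‖
  simp only [runMean_add, runMean_const_mul, runMean_const, start_eq, grad_eq] at step
  unfold meanObjective meanGradNorm
  linarith

theorem UtilityRegular.mul_sum_meanGradNorm_le (ha : 0 ≤ a) {err : ℕ → ℝ} {N : ℕ}
    (hα : ∀ n, α n = a) (herr : ∀ n < N, M.runMean θ₀ α η H (n + 1)
      (fun st => ‖st.dir - gradient M.objective st.θprev‖) ≤ err n) :
    a * ∑ n ∈ Finset.range N, M.meanGradNorm θ₀ α η H n ≤
      M.meanObjective θ₀ α η H N - M.meanObjective θ₀ α η H 0 +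
        2 * a * ∑ n ∈ Finset.range N, err n +
        N * (smoothConst l L R L₁ * M.effHorizon ^ 4 / 2 * a ^ 2) := by
  have ascent (n : ℕ) (hn : n ∈ Finset.range N) : a * M.meanGradNorm θ₀ α η H n ≤
      M.meanObjective θ₀ α η H (n + 1) - M.meanObjective θ₀ α η H n + 2 * a * err n +
        smoothConst l L R L₁ * M.effHorizon ^ 4 / 2 * a ^ 2 := by
    have step := hF.meanObjective_succ_ge (θ₀ := θ₀) (α := α) (η := η) (H := H) (n := n)
      hM hD hL₁ (ha.trans_eq (hα _).symm)
    rw [hα] at step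
    linarith [mul_le_mul_of_nonneg_left (herr n (Finset.mem_range.1 hn))
      (mul_nonneg zero_le_two ha)]
  have total := Finset.sum_le_sum ascent
  simp only [Finset.sum_add_distrib, Finset.sum_range_sub, Finset.sum_const, Finset.card_range,
    nsmul_eq_mul, ← Finset.mul_sum] at total
  exact total

end Ascent

theorem meanObjective_le_optValue (hB : BddAbove (Set.range M.objective)) (n : ℕ) :
    M.meanObjective θ₀ α η H n ≤ M.optValue :=
  runMean_le_of_forall_le fun _ _ => le_ciSup hB _

end UtilityMDP

/-! ### The choice of the horizon and of the step size -/

theorem rpow_two_thirds {x : ℝ} (hx : 0 ≤ x) : x ^ (2 / 3 : ℝ) = (x ^ (1 / 3 : ℝ)) ^ 2 := by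
  rw [← Real.rpow_natCast, ← Real.rpow_mul hx]
  norm_num

theorem rpow_one_third_cubed {x : ℝ} (hx : 0 ≤ x) : (x ^ (1 / 3 : ℝ)) ^ 3 = x := by
  rw [← Real.rpow_natCast, ← Real.rpow_mul hx]
  norm_num

theorem two_rpow_one_third_le : (2 : ℝ) ^ (1 / 3 : ℝ) ≤ 4 / 3 := by
  refine le_of_pow_le_pow_left₀ three_ne_zero (by norm_num) ?_
  rw [rpow_one_third_cubed zero_le_two]
  norm_num

theorem one_le_rpow_one_third {T : ℕ} (hT : 1 ≤ T) : 1 ≤ (T : ℝ) ^ (1 / 3 : ℝ) :=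
  Real.one_le_rpow (by exact_mod_cast hT) (by norm_num)

theorem half_le_log_succ {T : ℕ} (hT : 1 ≤ T) : 1 / 2 ≤ Real.log ((T : ℝ) + 1) := by
  have one_le : (1 : ℝ) ≤ T := by exact_mod_cast hT
  linarith [Real.log_two_gt_d9,
    Real.log_le_log (zero_lt_two' ℝ) (by linarith : 2 ≤ (T : ℝ) + 1)]

theorem half_le_sqrt_log_succ {T : ℕ} (hT : 1 ≤ T) : 1 / 2 ≤ √(Real.log ((T : ℝ) + 1)) :=
  Real.le_sqrt_of_sq_le (by linarith [half_le_log_succ hT])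

theorem log_div_self_le {x : ℝ} (hx : 0 < x) : Real.log x / x ≤ 3 / 2 / x ^ (1 / 3 : ℝ) := by
  have log_le := Real.log_le_rpow_div hx.le (by norm_num : (0 : ℝ) < 2 / 3)
  rw [rpow_two_thirds hx.le] at log_le
  have : 0 < x ^ (1 / 3 : ℝ) := Real.rpow_pos_of_pos hx _
  calc Real.log x / x ≤ (x ^ (1 / 3 : ℝ)) ^ 2 / (2 / 3) / x := by gcongr
    _ = (x ^ (1 / 3 : ℝ)) ^ 2 / (2 / 3) / (x ^ (1 / 3 : ℝ)) ^ 3 := by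
        rw [rpow_one_third_cubed hx.le]
    _ = 3 / 2 / x ^ (1 / 3 : ℝ) := by field_simp

namespace UtilityMDP

section Momentum

theorem sqrt_momentum (n : ℕ) : √(momentum n) = (2 / ((n : ℝ) + 1)) ^ (1 / 3 : ℝ) := by
  rw [momentum, rpow_two_thirds (by positivity), Real.sqrt_sq (by positivity)]

theorem sqrt_momentum_succ_le (n : ℕ) : √(momentum (n + 1)) ≤
    2 * (((n + 1 : ℕ) + 1 : ℝ) ^ (1 / 3 : ℝ)) ^ 2 - 2 * ((n + 1 : ℝ) ^ (1 / 3 : ℝ)) ^ 2 := by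
  have root_le : (n + 1 : ℝ) ^ (1 / 3 : ℝ) ≤ ((n + 1 : ℕ) + 1 : ℝ) ^ (1 / 3 : ℝ) :=
    Real.rpow_le_rpow (by positivity) (by push_cast; linarith) (by norm_num)
  have cubes_sub : (((n + 1 : ℕ) + 1 : ℝ) ^ (1 / 3 : ℝ)) ^ 3 -
      ((n + 1 : ℝ) ^ (1 / 3 : ℝ)) ^ 3 = 1 := by
    rw [rpow_one_third_cubed (by positivity), rpow_one_third_cubed (by positivity)]
    push_cast
    ring
  have y_pos : 0 < (n + 1 : ℝ) ^ (1 / 3 : ℝ) := by positivity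
  rw [sqrt_momentum, Real.div_rpow zero_le_two (by positivity)]
  set x := ((n + 1 : ℕ) + 1 : ℝ) ^ (1 / 3 : ℝ)
  set y := (n + 1 : ℝ) ^ (1 / 3 : ℝ)
  have x_pos : 0 < x := y_pos.trans_le root_le
  refine (div_le_iff₀ x_pos).2 (two_rpow_one_third_le.trans ?_)
  have : 0 ≤ (x - y) ^ 2 * (x + 2 * y) := by positivity
  linear_combination 2 / 3 * this - 4 / 3 * cubes_sub

theorem sum_sqrt_momentum_le (N : ℕ) :
    ∑ n ∈ Finset.range N, √(momentum (n + 1)) ≤ 2 * ((N + 1 : ℝ) ^ (1 / 3 : ℝ)) ^ 2 := by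
  refine (Finset.sum_le_sum fun n _ => sqrt_momentum_succ_le n).trans ?_
  rw [Finset.sum_range_sub fun n : ℕ => 2 * ((n + 1 : ℝ) ^ (1 / 3 : ℝ)) ^ 2]
  exact sub_le_self _ (by positivity)

theorem sqrt_one_div_momentum_le {n N : ℕ} (h : n < N) :
    √(1 / momentum (n + 1)) ≤ (N + 1 : ℝ) ^ (1 / 3 : ℝ) := by
  have succ_le : (n : ℝ) + 1 ≤ N := by exact_mod_cast h
  rw [Real.sqrt_div zero_le_one, Real.sqrt_one, sqrt_momentum, one_div,
    ← Real.inv_rpow (by positivity), inv_div]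
  refine Real.rpow_le_rpow (by positivity) ?_ (by norm_num)
  push_cast
  linarith [(Nat.cast_nonneg n : (0 : ℝ) ≤ n)]

theorem sum_sqrt_one_div_momentum_le (N : ℕ) :
    ∑ n ∈ Finset.range N, √(1 / momentum (n + 1)) ≤ ((N + 1 : ℝ) ^ (1 / 3 : ℝ)) ^ 4 := by
  refine (Finset.sum_le_card_nsmul _ _ _ fun n hn =>
    sqrt_one_div_momentum_le (Finset.mem_range.1 hn)).trans ?_
  rw [Finset.card_range, nsmul_eq_mul, pow_succ _ 3, rpow_one_third_cubed (by positivity)]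
  gcongr
  exact le_add_of_nonneg_right zero_le_one

end Momentum

section Horizon

variable {S A : Type*} {d : ℕ} (M : UtilityMDP S A d) {T : ℕ}

theorem effHorizon_mul_log_le_horizon :
    M.effHorizon * Real.log ((T : ℝ) + 1) ≤ horizon M.γ T := by
  rw [effHorizon, inv_mul_eq_div]
  exact Nat.le_ceil _

theorem one_le_horizon (hT : 1 ≤ T) : 1 ≤ horizon M.γ T := by
  have log_ge := half_le_log_succ hT
  have horizon_pos : (0 : ℝ) < horizon M.γ T :=
    (mul_pos (zero_lt_one.trans_le M.one_le_effHorizon) (by linarith)).trans_le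
      M.effHorizon_mul_log_le_horizon
  exact_mod_cast horizon_pos

theorem horizon_le (hT : 1 ≤ T) :
    (horizon M.γ T : ℝ) ≤ 3 * M.effHorizon * Real.log ((T : ℝ) + 1) := by
  have log_ge := half_le_log_succ hT
  have hκ := M.one_le_effHorizon
  have ceil_lt : (horizon M.γ T : ℝ) < Real.log ((T : ℝ) + 1) / (1 - M.γ) + 1 :=
    Nat.ceil_lt_add_one (div_nonneg (by linarith) (by linarith [M.γ_lt_one]))
  rw [← inv_mul_eq_div, ← effHorizon] at ceil_lt
  nlinarith

theorem discount_pow_horizon_le : M.γ ^ horizon M.γ T ≤ 1 / ((T : ℝ) + 1) := by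
  have γ_le : M.γ ≤ Real.exp (M.γ - 1) := by linarith [Real.add_one_le_exp (M.γ - 1)]
  have log_le := M.effHorizon_mul_log_le_horizon (T := T)
  rw [effHorizon, inv_mul_le_iff₀ (sub_pos.2 M.γ_lt_one)] at log_le
  calc M.γ ^ horizon M.γ T ≤ Real.exp (M.γ - 1) ^ horizon M.γ T :=
        pow_le_pow_left₀ M.γ_pos.le γ_le _
    _ = Real.exp (horizon M.γ T * (M.γ - 1)) := (Real.exp_nat_mul _ _).symm
    _ ≤ Real.exp (-Real.log ((T : ℝ) + 1)) := Real.exp_le_exp.2 (by linarith)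
    _ = 1 / ((T : ℝ) + 1) := by
        rw [Real.exp_neg, Real.exp_log (by positivity), one_div]

theorem discount_pow_horizon_le_inv_root (hT : 1 ≤ T) :
    M.γ ^ horizon M.γ T ≤ 1 / (T : ℝ) ^ (1 / 3 : ℝ) := by
  have T_pos : (0 : ℝ) < T := by exact_mod_cast hT
  refine M.discount_pow_horizon_le.trans (one_div_le_one_div_of_le (by positivity) ?_)
  have root_le := pow_le_pow_right₀ (one_le_rpow_one_third hT) (by norm_num : 1 ≤ 3)
  rw [rpow_one_third_cubed T_pos.le, pow_one] at root_le
  linarith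

theorem horizon_mul_discount_pow_le (hT : 1 ≤ T) :
    horizon M.γ T * M.γ ^ horizon M.γ T ≤ 9 / 2 * M.effHorizon / (T : ℝ) ^ (1 / 3 : ℝ) := by
  have : (0 : ℝ) < T := by exact_mod_cast hT
  have hκ := M.one_le_effHorizon
  have log_ge := half_le_log_succ hT
  have discount_nonneg := M.discount_pow_nonneg (horizon M.γ T)
  calc horizon M.γ T * M.γ ^ horizon M.γ T
      ≤ 3 * M.effHorizon * Real.log ((T : ℝ) + 1) * (1 / ((T : ℝ) + 1)) := by
        gcongr
        · exact M.horizon_le hT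
        · exact M.discount_pow_horizon_le
    _ = 3 * M.effHorizon * (Real.log ((T : ℝ) + 1) / ((T : ℝ) + 1)) := by ring
    _ ≤ 3 * M.effHorizon * (3 / 2 / ((T : ℝ) + 1) ^ (1 / 3 : ℝ)) :=
        mul_le_mul_of_nonneg_left (log_div_self_le (by positivity)) (by positivity)
    _ ≤ 3 * M.effHorizon * (3 / 2 / (T : ℝ) ^ (1 / 3 : ℝ)) := by
        gcongr
        exact le_add_of_nonneg_right zero_le_one
    _ = 9 / 2 * M.effHorizon / (T : ℝ) ^ (1 / 3 : ℝ) := by ring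

theorem horizon_le_sq (hT : 1 ≤ T) :
    (horizon M.γ T : ℝ) ≤ (2 * M.effHorizon * √(Real.log ((T : ℝ) + 1))) ^ 2 := by
  have log_ge := half_le_log_succ hT
  have hκ := M.one_le_effHorizon
  rw [mul_pow, Real.sq_sqrt (by linarith)]
  refine (M.horizon_le hT).trans (mul_le_mul_of_nonneg_right ?_ (by linarith))
  nlinarith

end Horizon

theorem stepSize_eq {α₀ : ℝ} {T : ℕ} (n : ℕ) :
    stepSize α₀ T n = α₀ / ((T : ℝ) ^ (1 / 3 : ℝ)) ^ 2 := by
  rw [stepSize, rpow_two_thirds (Nat.cast_nonneg T)]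

theorem stepSize_le {α₀ : ℝ} {T : ℕ} (hα₀ : 0 ≤ α₀) (hT : 1 ≤ T) (n : ℕ) :
    stepSize α₀ T n ≤ α₀ / (T : ℝ) ^ (1 / 3 : ℝ) := by
  have root_ge := one_le_rpow_one_third hT
  rw [stepSize_eq]
  gcongr
  exact le_self_pow₀ root_ge two_ne_zero

section Bias

variable {S A : Type*} {d : ℕ} (M : UtilityMDP S A d) {T : ℕ} {l R L₂ L₁ α₀ : ℝ}

theorem biasBound_horizon_le (hl : 0 ≤ l) (hR : 0 ≤ R) (hL₂ : 0 ≤ L₂) (hL₁ : 0 ≤ L₁)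
    (hα₀ : 0 ≤ α₀) (hT : 1 ≤ T) (n : ℕ) :
    M.biasBound l R L₂ L₁ (horizon M.γ T) (stepSize α₀ T n) ≤
      (M.effHorizon ^ 3 * (2 * l * L₂ + 11 * l * R) +
        8 * l ^ 2 * L₁ * (√(Real.log ((T : ℝ) + 1)) * (M.effHorizon ^ 4 * α₀))) /
          (T : ℝ) ^ (1 / 3 : ℝ) := by
  have hκ := M.one_le_effHorizon
  have root_ge := one_le_rpow_one_third hT
  have sqrt_log_ge := half_le_sqrt_log_succ hT
  have step_le := stepSize_le hα₀ hT n
  have discount_le := M.discount_pow_horizon_le_inv_root hT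
  have horizon_mul_le := M.horizon_mul_discount_pow_le hT
  unfold biasBound
  set X := (T : ℝ) ^ (1 / 3 : ℝ)
  set Y := √(Real.log ((T : ℝ) + 1))
  set κ := M.effHorizon
  set g := M.γ ^ horizon M.γ T
  calc _ = 4 * l ^ 2 * L₁ * κ ^ 4 * stepSize α₀ T n +
          (2 * l * L₂ * κ ^ 3 * g + 2 * l * R * (κ ^ 2 * g + κ * (horizon M.γ T * g))) := by ring
    _ ≤ 4 * l ^ 2 * L₁ * κ ^ 4 * (α₀ / X) + (2 * l * L₂ * κ ^ 3 * (1 / X) +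
          2 * l * R * (κ ^ 2 * (1 / X) + κ * (9 / 2 * κ / X))) := by gcongr
    _ = (2 * l * L₂ * κ ^ 3 + 11 * l * R * κ ^ 2 +
          8 * l ^ 2 * L₁ * (1 / 2 * (κ ^ 4 * α₀))) / X := by ring
    _ ≤ (2 * l * L₂ * κ ^ 3 + 11 * l * R * κ ^ 3 + 8 * l ^ 2 * L₁ * (Y * (κ ^ 4 * α₀))) / X := by
        gcongr
        norm_num
    _ = _ := by ring

end Bias

end UtilityMDP

/-! ### The rate -/

theorem mean_uniformOfFintype_fin (T : ℕ) [NeZero T] (f : Fin T → ℝ) :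
    mean (PMF.uniformOfFintype (Fin T)) f = (T : ℝ)⁻¹ * ∑ i, f i := by
  simp [mean, Finset.mul_sum]

namespace UtilityMDP

theorem noiseRate_nonneg {l L₂ : ℝ} (R : ℝ) (hl : 0 ≤ l) (hL₂ : 0 ≤ L₂) :
    0 ≤ noiseRate l R L₂ := by
  unfold noiseRate
  positivity

theorem driftRate_nonneg {l L₂ : ℝ} (L R : ℝ) (hl : 0 ≤ l) (hL₂ : 0 ≤ L₂) :
    0 ≤ driftRate l L R L₂ := by
  unfold driftRate
  positivity

theorem smoothConst_nonneg {l L R L₁ : ℝ} (hL : 0 ≤ L) (hR : 0 ≤ R) (hL₁ : 0 ≤ L₁) :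
    0 ≤ smoothConst l L R L₁ := by
  unfold smoothConst
  positivity

/-- The constant in the convergence rate of N-VR-PG. -/
noncomputable def rateConst (l L R L₂ L₁ : ℝ) : ℝ :=
  1 + 4 * noiseRate l R L₂ + 4 * l * L₂ + 24 * l * R + 4 * driftRate l L R L₂ +
    16 * l ^ 2 * L₁ + smoothConst l L R L₁

section RateConst

variable {l L R L₂ L₁ : ℝ} (hl : 0 ≤ l) (hL : 0 ≤ L) (hR : 0 ≤ R) (hL₂ : 0 ≤ L₂) (hL₁ : 0 ≤ L₁)

include hl hL hR hL₂ hL₁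

theorem rateConst_pos : 0 < rateConst l L R L₂ L₁ := by
  have := noiseRate_nonneg R hl hL₂
  have := driftRate_nonneg L R hl hL₂
  have := smoothConst_nonneg (l := l) hL hR hL₁
  unfold rateConst
  positivity

theorem four_mul_le_rateConst : 4 * l * R ≤ rateConst l L R L₂ L₁ := by
  have := noiseRate_nonneg R hl hL₂
  have := driftRate_nonneg L R hl hL₂
  have := smoothConst_nonneg (l := l) hL hR hL₁
  have rest_nonneg : 0 ≤ 1 + 4 * noiseRate l R L₂ + 4 * l * L₂ + 20 * l * R +
      4 * driftRate l L R L₂ + 16 * l ^ 2 * L₁ + smoothConst l L R L₁ := by positivity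
  unfold rateConst
  linear_combination rest_nonneg

theorem add_le_rateConst_mul {x y z : ℝ} (hx : 0 ≤ x) (hy : 0 ≤ y) (hz : 0 ≤ z) :
    z + x * (4 * noiseRate l R L₂ + 4 * l * L₂ + 24 * l * R) +
        y * (4 * driftRate l L R L₂ + 16 * l ^ 2 * L₁ + smoothConst l L R L₁) ≤
      rateConst l L R L₂ L₁ * (x + z + y) := by
  have := noiseRate_nonneg R hl hL₂
  have := driftRate_nonneg L R hl hL₂
  have := smoothConst_nonneg (l := l) hL hR hL₁
  have cross_nonneg : 0 ≤ x + y + (4 * noiseRate l R L₂ + 4 * l * L₂ + 24 * l * R) * (z + y) +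
      (4 * driftRate l L R L₂ + 16 * l ^ 2 * L₁ + smoothConst l L R L₁) * (z + x) := by positivity
  unfold rateConst
  linear_combination cross_nonneg

end RateConst

section DeviationBound

variable {S A : Type*} {d : ℕ} (M : UtilityMDP S A d) {T N : ℕ} {l L R L₂ L₁ α₀ : ℝ}

theorem stepSize_nonneg (hα₀ : 0 ≤ α₀) (T n : ℕ) : 0 ≤ stepSize α₀ T n := by
  unfold stepSize
  positivity

theorem stepSize_mul_root_sq (hT : 1 ≤ T) (n : ℕ) :
    stepSize α₀ T n * ((T : ℝ) ^ (1 / 3 : ℝ)) ^ 2 = α₀ := by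
  have := one_le_rpow_one_third hT
  rw [stepSize_eq, div_mul_cancel₀ _ (by positivity)]

theorem natCast_mul_stepSize_le (hα₀ : 0 ≤ α₀) (hT : T = N + 1) :
    N * stepSize α₀ T 0 ≤
      2 * (((T : ℝ) ^ (1 / 3 : ℝ)) ^ 2 * (√(Real.log ((T : ℝ) + 1)) * α₀)) := by
  have hT₁ : 1 ≤ T := hT.symm ▸ N.succ_pos
  have N_le : (N : ℝ) ≤ T := by exact_mod_cast (Nat.lt_of_lt_of_eq N.lt_succ_self hT.symm).le
  have root_ge := one_le_rpow_one_third hT₁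
  have sqrt_log_ge := half_le_sqrt_log_succ hT₁
  have cube_eq := rpow_one_third_cubed (Nat.cast_nonneg T : (0 : ℝ) ≤ T)
  have step_mul := stepSize_mul_root_sq (α₀ := α₀) hT₁ 0
  have step_nonneg := stepSize_nonneg hα₀ T 0
  set X := (T : ℝ) ^ (1 / 3 : ℝ)
  calc N * stepSize α₀ T 0 ≤ X ^ 3 * stepSize α₀ T 0 := by
        rw [cube_eq]
        gcongr
    _ = X * α₀ := by linear_combination X * step_mul
    _ ≤ X ^ 2 * α₀ := by
        gcongr
        exact le_self_pow₀ root_ge two_ne_zero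
    _ = 2 * (X ^ 2 * (1 / 2 * α₀)) := by ring
    _ ≤ 2 * (X ^ 2 * (√(Real.log ((T : ℝ) + 1)) * α₀)) := by gcongr

theorem horizon_mul_stepSize_sq_le (α₀ : ℝ) (hT : 1 ≤ T) :
    horizon M.γ T * stepSize α₀ T 0 ^ 2 ≤
      (2 * M.effHorizon * √(Real.log ((T : ℝ) + 1)) * stepSize α₀ T 0) ^ 2 := by
  rw [mul_pow _ (stepSize α₀ T 0)]
  exact mul_le_mul_of_nonneg_right (M.horizon_le_sq hT) (sq_nonneg _)

theorem sqrt_horizon_mul_stepSize_sq_le (hα₀ : 0 ≤ α₀) (hT : 1 ≤ T) :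
    √(horizon M.γ T * stepSize α₀ T 0 ^ 2) ≤
      2 * M.effHorizon * √(Real.log ((T : ℝ) + 1)) * stepSize α₀ T 0 := by
  have hκ := M.one_le_effHorizon
  have step_nonneg := stepSize_nonneg hα₀ T 0
  exact Real.sqrt_le_iff.2 ⟨by positivity, M.horizon_mul_stepSize_sq_le α₀ hT⟩

theorem natCast_mul_biasBound_le (hl : 0 ≤ l) (hR : 0 ≤ R) (hL₂ : 0 ≤ L₂) (hL₁ : 0 ≤ L₁)
    (hα₀ : 0 ≤ α₀) (hT : T = N + 1) :
    N * M.biasBound l R L₂ L₁ (horizon M.γ T) (stepSize α₀ T 0) ≤ ((T : ℝ) ^ (1 / 3 : ℝ)) ^ 2 *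
      (M.effHorizon ^ 3 * (2 * l * L₂ + 11 * l * R) +
        8 * l ^ 2 * L₁ * (√(Real.log ((T : ℝ) + 1)) * (M.effHorizon ^ 4 * α₀))) := by
  have hT₁ : 1 ≤ T := hT.symm ▸ N.succ_pos
  have hκ := M.one_le_effHorizon
  have root_ge := one_le_rpow_one_third hT₁
  have cube_eq := rpow_one_third_cubed (Nat.cast_nonneg T : (0 : ℝ) ≤ T)
  have bias_le := M.biasBound_horizon_le hl hR hL₂ hL₁ hα₀ hT₁ 0
  have N_le : (N : ℝ) ≤ T := by exact_mod_cast (Nat.lt_of_lt_of_eq N.lt_succ_self hT.symm).le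
  set ν := M.effHorizon ^ 3 * (2 * l * L₂ + 11 * l * R) +
    8 * l ^ 2 * L₁ * (√(Real.log ((T : ℝ) + 1)) * (M.effHorizon ^ 4 * α₀))
  set X := (T : ℝ) ^ (1 / 3 : ℝ)
  calc N * M.biasBound l R L₂ L₁ (horizon M.γ T) (stepSize α₀ T 0) ≤ N * (ν / X) := by gcongr
    _ ≤ X ^ 3 * (ν / X) := by
        rw [cube_eq]
        gcongr
    _ = X ^ 2 * ν := by field_simp

theorem sum_deviationBound_le (hl : 0 ≤ l) (hR : 0 ≤ R) (hL₂ : 0 ≤ L₂) (hL₁ : 0 ≤ L₁)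
    (hα₀ : 0 ≤ α₀) (hT : T = N + 1) :
    ∑ n ∈ Finset.range N, (M.effHorizon ^ 3 * (noiseRate l R L₂ * √(momentum (n + 1)) +
        driftRate l L R L₂ * √(horizon M.γ T * stepSize α₀ T 0 ^ 2) *
          √(1 / momentum (n + 1))) +
        M.biasBound l R L₂ L₁ (horizon M.γ T) (stepSize α₀ T 0)) ≤
      ((T : ℝ) ^ (1 / 3 : ℝ)) ^ 2 *
        (M.effHorizon ^ 3 * (2 * noiseRate l R L₂ + 2 * l * L₂ + 11 * l * R) +
          √(Real.log ((T : ℝ) + 1)) * (M.effHorizon ^ 4 * α₀) *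
            (2 * driftRate l L R L₂ + 8 * l ^ 2 * L₁)) := by
  have T_eq : (T : ℝ) = N + 1 := by rw [hT, Nat.cast_succ]
  have hT₁ : 1 ≤ T := hT.symm ▸ N.succ_pos
  have hκ := M.one_le_effHorizon
  have noise_nonneg := noiseRate_nonneg R hl hL₂
  have drift_nonneg := driftRate_nonneg L R hl hL₂
  have sum_noise_le := sum_sqrt_momentum_le N
  have sum_drift_le := sum_sqrt_one_div_momentum_le N
  have sum_bias_le := M.natCast_mul_biasBound_le hl hR hL₂ hL₁ hα₀ hT
  have sqrt_le := M.sqrt_horizon_mul_stepSize_sq_le hα₀ hT₁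
  have step_nonneg := stepSize_nonneg hα₀ T 0
  have step_mul := stepSize_mul_root_sq (α₀ := α₀) hT₁ 0
  rw [← T_eq] at sum_noise_le sum_drift_le
  set X := (T : ℝ) ^ (1 / 3 : ℝ)
  set Y := √(Real.log ((T : ℝ) + 1))
  set κ := M.effHorizon
  set a := stepSize α₀ T 0
  set c₁ := noiseRate l R L₂
  set c₂ := driftRate l L R L₂
  set ν := κ ^ 3 * (2 * l * L₂ + 11 * l * R) + 8 * l ^ 2 * L₁ * (Y * (κ ^ 4 * α₀))
  rw [Finset.sum_add_distrib, ← Finset.mul_sum, Finset.sum_add_distrib, ← Finset.mul_sum,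
    ← Finset.mul_sum, Finset.sum_const, Finset.card_range, nsmul_eq_mul]
  calc _ ≤ κ ^ 3 * (c₁ * (2 * X ^ 2) + c₂ * (2 * κ * Y * a) * X ^ 4) + X ^ 2 * ν := by gcongr
    _ = κ ^ 3 * (c₁ * (2 * X ^ 2) + c₂ * (2 * κ * Y) * (a * X ^ 2) * X ^ 2) + X ^ 2 * ν := by ring
    _ = _ := by rw [step_mul]; ring

end DeviationBound

section Rate

variable {S A : Type*} {d : ℕ} [Fintype S] [DecidableEq S] [Fintype A] [DecidableEq A]
  [Nonempty A] {M : UtilityMDP S A d} {D : Set (SAVec S A)} {l L R L₂ L₁ α₀ : ℝ} {θ₀ : Param d}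
  {T N : ℕ}

theorem expGradNorm_eq (M : UtilityMDP S A d) (θ₀ : Param d) (α₀ : ℝ) (T : ℕ) [NeZero T] :
    M.expGradNorm θ₀ α₀ T = (T : ℝ)⁻¹ *
      ∑ n ∈ Finset.range T, M.meanGradNorm θ₀ (stepSize α₀ T) momentum (horizon M.γ T) n := by
  rw [expGradNorm, expect_eq_mean, outputLaw, mean_bind]
  simp only [mean_map, mean_uniformOfFintype_fin, mean_const_mul, mean_sum]
  rw [← Fin.sum_univ_eq_sum_range]
  exact congrArg _ <| Finset.sum_congr rfl fun i _ =>
    M.mean_runLaw_castLE θ₀ _ _ (Nat.succ_le_of_lt i.isLt) fun st => ‖gradient M.objective st.θ‖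

theorem initialGap_eq (M : UtilityMDP S A d) (θ₀ : Param d) (α₀ : ℝ) (T : ℕ) [NeZero T] :
    M.initialGap θ₀ α₀ T =
      M.optValue - M.meanObjective θ₀ (stepSize α₀ T) momentum (horizon M.γ T) 0 := by
  rw [initialGap, expect_eq_mean]
  exact congrArg _ <| M.mean_runLaw_castLE θ₀ _ _ (NeZero.one_le (n := T)) fun st =>
    M.objective st.θ

theorem initialGap_nonneg (hB : BddAbove (Set.range M.objective)) (θ₀ : Param d) (α₀ : ℝ) (T : ℕ)
    [NeZero T] : 0 ≤ M.initialGap θ₀ α₀ T := by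
  rw [initialGap_eq, sub_nonneg]
  exact meanObjective_le_optValue hB 0

theorem UtilityRegular.expGradNorm_le_const [NeZero T] (hF : M.UtilityRegular D R L₂ L₁)
    (hM : M.PolicyRegular l L) (hD : M.occupancySet ⊆ D) :
    M.expGradNorm θ₀ α₀ T ≤ 2 * l * R * M.effHorizon ^ 2 := by
  have T_pos : (0 : ℝ) < T := by exact_mod_cast NeZero.pos T
  rw [expGradNorm_eq, inv_mul_le_iff₀ T_pos]
  refine (Finset.sum_le_card_nsmul _ _ _ fun n _ => hF.meanGradNorm_le hM hD n).trans_eq ?_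
  rw [Finset.card_range, nsmul_eq_mul]

theorem UtilityRegular.expGradNorm_le_of_one_le_stepSize [NeZero T]
    (hF : M.UtilityRegular D R L₂ L₁) (hM : M.PolicyRegular l L) (hD : M.occupancySet ⊆ D)
    (hα₀ : 0 ≤ α₀)
    (large : 1 ≤ 2 * M.effHorizon * √(Real.log ((T : ℝ) + 1)) * stepSize α₀ T 0) :
    M.expGradNorm θ₀ α₀ T ≤ 4 * l * R *
      (√(Real.log ((T : ℝ) + 1)) * (M.effHorizon ^ 4 * α₀)) / (T : ℝ) ^ (1 / 3 : ℝ) := by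
  have hl := hM.nonneg_left
  have hR := hF.nonneg hD
  have hκ := M.one_le_effHorizon
  have step_le := stepSize_le hα₀ (NeZero.one_le (n := T)) 0
  set κ := M.effHorizon
  set X := (T : ℝ) ^ (1 / 3 : ℝ)
  set Y := √(Real.log ((T : ℝ) + 1))
  calc M.expGradNorm θ₀ α₀ T ≤ 2 * l * R * κ ^ 2 := hF.expGradNorm_le_const hM hD
    _ ≤ 2 * l * R * κ ^ 2 * (2 * κ * Y * stepSize α₀ T 0) :=
        le_mul_of_one_le_right (by positivity) large
    _ ≤ 2 * l * R * κ ^ 2 * (2 * κ * Y * (α₀ / X)) := by gcongr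
    _ = 4 * l * R * (Y * (κ ^ 3 * α₀)) / X := by ring
    _ ≤ 4 * l * R * (Y * (κ ^ 4 * α₀)) / X := by
        gcongr
        norm_num

theorem UtilityRegular.stepSize_mul_sum_meanGradNorm_le [NeZero T] (hF : M.UtilityRegular D R L₂ L₁)
    (hM : M.PolicyRegular l L) (hD : M.occupancySet ⊆ D) (hB : BddAbove (Set.range M.objective))
    (hL₂ : 0 ≤ L₂) (hL₁ : 0 ≤ L₁) (hα₀ : 0 ≤ α₀) (hrun : M.RunStaysIn θ₀ α₀ T D)
    (small : horizon M.γ T * stepSize α₀ T 0 ^ 2 ≤ 1) (hT : T = N + 1) :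
    stepSize α₀ T 0 * ∑ n ∈ Finset.range N,
        M.meanGradNorm θ₀ (stepSize α₀ T) momentum (horizon M.γ T) n ≤
      M.initialGap θ₀ α₀ T + 2 * stepSize α₀ T 0 * (((T : ℝ) ^ (1 / 3 : ℝ)) ^ 2 *
        (M.effHorizon ^ 3 * (2 * noiseRate l R L₂ + 2 * l * L₂ + 11 * l * R) +
          √(Real.log ((T : ℝ) + 1)) * (M.effHorizon ^ 4 * α₀) *
            (2 * driftRate l L R L₂ + 8 * l ^ 2 * L₁))) +
        N * (smoothConst l L R L₁ * M.effHorizon ^ 4 / 2 * stepSize α₀ T 0 ^ 2) := by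
  have horizon_ge := M.one_le_horizon (NeZero.one_le (n := T))
  have step_nonneg := stepSize_nonneg hα₀ T 0
  have step_le_one : stepSize α₀ T 0 ≤ 1 := by
    rw [← sq_le_one_iff₀ step_nonneg]
    exact (le_mul_of_one_le_left (sq_nonneg _) (by exact_mod_cast horizon_ge)).trans small
  have ascent := hF.mul_sum_meanGradNorm_le hM hD hL₁ step_nonneg (α := stepSize α₀ T)
    (fun _ => rfl) fun n (hn : n < N) => hF.runMean_norm_dir_sub_gradient_le hM
      (fun _ => (abs_of_nonneg step_nonneg).le) step_le_one small hD hL₂ hL₁ hrun.estimatesIn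
      horizon_ge (hT.symm ▸ Nat.succ_lt_succ hn : n + 1 < T)
  have final_le := meanObjective_le_optValue (θ₀ := θ₀) (α := stepSize α₀ T) (η := momentum)
    (H := horizon M.γ T) hB N
  have deviation_le := mul_le_mul_of_nonneg_left
    (M.sum_deviationBound_le (L := L) hM.nonneg_left (hF.nonneg hD) hL₂ hL₁ hα₀ hT)
    (mul_nonneg zero_le_two step_nonneg)
  rw [initialGap_eq]
  linarith

theorem UtilityRegular.sum_meanGradNorm_le [NeZero T] (hF : M.UtilityRegular D R L₂ L₁)
    (hM : M.PolicyRegular l L) (hD : M.occupancySet ⊆ D) (hB : BddAbove (Set.range M.objective))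
    (hL₂ : 0 ≤ L₂) (hL₁ : 0 ≤ L₁) (hα₀ : 0 < α₀) (hrun : M.RunStaysIn θ₀ α₀ T D)
    (small : horizon M.γ T * stepSize α₀ T 0 ^ 2 ≤ 1) (hT : T = N + 1) :
    ∑ n ∈ Finset.range N, M.meanGradNorm θ₀ (stepSize α₀ T) momentum (horizon M.γ T) n ≤
      ((T : ℝ) ^ (1 / 3 : ℝ)) ^ 2 * (M.initialGap θ₀ α₀ T / α₀ +
        M.effHorizon ^ 3 * (4 * noiseRate l R L₂ + 4 * l * L₂ + 22 * l * R) +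
        √(Real.log ((T : ℝ) + 1)) * (M.effHorizon ^ 4 * α₀) *
          (4 * driftRate l L R L₂ + 16 * l ^ 2 * L₁ + smoothConst l L R L₁)) := by
  have hκ := M.one_le_effHorizon
  have smooth_nonneg := smoothConst_nonneg (l := l) hM.nonneg_right (hF.nonneg hD) hL₁
  have step_mul := stepSize_mul_root_sq (α₀ := α₀) (NeZero.one_le (n := T)) 0
  have step_pos : 0 < stepSize α₀ T 0 := pos_of_mul_pos_left (step_mul ▸ hα₀) (sq_nonneg _)
  have weighted_le := hF.stepSize_mul_sum_meanGradNorm_le hM hD hB hL₂ hL₁ hα₀.le hrun small hT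
  have steps_le := mul_le_mul_of_nonneg_left (natCast_mul_stepSize_le hα₀.le hT)
    (by positivity : 0 ≤ smoothConst l L R L₁ * M.effHorizon ^ 4 / 2 * stepSize α₀ T 0)
  have gap_eq : M.initialGap θ₀ α₀ T = stepSize α₀ T 0 *
      (((T : ℝ) ^ (1 / 3 : ℝ)) ^ 2 * (M.initialGap θ₀ α₀ T / α₀)) := by
    rw [← mul_assoc, step_mul, mul_div_cancel₀ _ hα₀.ne']
  refine le_of_mul_le_mul_left ?_ step_pos
  linarith

theorem UtilityRegular.expGradNorm_le_of_stepSize_le [NeZero T] (hF : M.UtilityRegular D R L₂ L₁)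
    (hM : M.PolicyRegular l L) (hD : M.occupancySet ⊆ D) (hB : BddAbove (Set.range M.objective))
    (hL₂ : 0 ≤ L₂) (hL₁ : 0 ≤ L₁) (hα₀ : 0 < α₀) (hrun : M.RunStaysIn θ₀ α₀ T D)
    (small : horizon M.γ T * stepSize α₀ T 0 ^ 2 ≤ 1) :
    M.expGradNorm θ₀ α₀ T ≤ (M.initialGap θ₀ α₀ T / α₀ +
        M.effHorizon ^ 3 * (4 * noiseRate l R L₂ + 4 * l * L₂ + 24 * l * R) +
        √(Real.log ((T : ℝ) + 1)) * (M.effHorizon ^ 4 * α₀) *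
          (4 * driftRate l L R L₂ + 16 * l ^ 2 * L₁ + smoothConst l L R L₁)) /
        (T : ℝ) ^ (1 / 3 : ℝ) := by
  obtain ⟨N, hT⟩ := Nat.exists_eq_succ_of_ne_zero (NeZero.ne T)
  have hl := hM.nonneg_left
  have hR := hF.nonneg hD
  have hκ := M.one_le_effHorizon
  have root_ge := one_le_rpow_one_third (NeZero.one_le (n := T))
  have cube_eq := rpow_one_third_cubed (Nat.cast_nonneg T : (0 : ℝ) ≤ T)
  have sum_le := hF.sum_meanGradNorm_le hM hD hB hL₂ hL₁ hα₀ hrun small hT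
  have last_le := hF.meanGradNorm_le (θ₀ := θ₀) (α := stepSize α₀ T) (η := momentum)
    (H := horizon M.γ T) hM hD N
  have range_eq : Finset.range T = Finset.range (N + 1) := congrArg _ hT
  rw [expGradNorm_eq, range_eq, Finset.sum_range_succ]
  set X := (T : ℝ) ^ (1 / 3 : ℝ)
  set Y := √(Real.log ((T : ℝ) + 1))
  have const_le : 2 * l * R * M.effHorizon ^ 2 ≤ X ^ 2 * (M.effHorizon ^ 3 * (2 * l * R)) := by
    calc _ = 1 ^ 2 * (M.effHorizon ^ 2 * (2 * l * R)) := by ring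
      _ ≤ _ := by
        gcongr
        norm_num
  rw [← cube_eq, inv_mul_le_iff₀ (by positivity)]
  refine (add_le_add sum_le (last_le.trans const_le)).trans_eq ?_
  field_simp
  ring

theorem UtilityRegular.expGradNorm_le [NeZero T] (hF : M.UtilityRegular D R L₂ L₁)
    (hM : M.PolicyRegular l L) (hD : M.occupancySet ⊆ D) (hB : BddAbove (Set.range M.objective))
    (hL₂ : 0 ≤ L₂) (hL₁ : 0 ≤ L₁) (hα₀ : 0 < α₀) (hrun : M.RunStaysIn θ₀ α₀ T D) :
    M.expGradNorm θ₀ α₀ T ≤ rateConst l L R L₂ L₁ *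
      ((M.effHorizon ^ 3 + M.initialGap θ₀ α₀ T / α₀ +
        √(Real.log ((T : ℝ) + 1)) * (M.effHorizon ^ 4 * α₀)) / (T : ℝ) ^ (1 / 3 : ℝ)) := by
  have hT := NeZero.one_le (n := T)
  have hl := hM.nonneg_left
  have hR := hF.nonneg hD
  have hκ := M.one_le_effHorizon
  have const_pos := rateConst_pos hl hM.nonneg_right hR hL₂ hL₁
  have gap_nonneg := div_nonneg (initialGap_nonneg hB θ₀ α₀ T) hα₀.le
  have step_nonneg := stepSize_nonneg hα₀.le T 0
  rw [mul_div_assoc']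
  rcases le_total 1 (2 * M.effHorizon * √(Real.log ((T : ℝ) + 1)) * stepSize α₀ T 0) with
    large | small
  · refine (hF.expGradNorm_le_of_one_le_stepSize hM hD hα₀.le large).trans ?_
    have coeff_le := four_mul_le_rateConst hl hM.nonneg_right hR hL₂ hL₁
    gcongr
    exact le_add_of_nonneg_left (by positivity)
  · refine (hF.expGradNorm_le_of_stepSize_le hM hD hB hL₂ hL₁ hα₀ hrun
      ((M.horizon_mul_stepSize_sq_le α₀ hT).trans (pow_le_one₀ (by positivity) small))).trans ?_
    gcongr
    exact add_le_rateConst_mul hl hM.nonneg_right hR hL₂ hL₁ (by positivity) (by positivity)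
      gap_nonneg

end Rate

end UtilityMDP

/-! ### The number of iterations -/

namespace UtilityMDP

/-- The number of iterations that makes the rate `√(log (T + 1)) / T^{1/3}` of order `ε`; the scale
`m` absorbs the constant in front of the rate. -/
noncomputable def iterations (m ε : ℝ) : ℕ := ⌈m ^ 3 * ε⁻¹ ^ 3 * Real.log (1 / ε) ^ 2⌉₊

section Iterations

variable {m ε : ℝ}

theorem half_le_log_one_div (hε : 0 < ε) (hε' : ε ≤ 1 / 2) : 1 / 2 ≤ Real.log (1 / ε) := by
  have two_le : 2 ≤ 1 / ε := by rwa [le_one_div two_pos hε]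
  linarith [Real.log_two_gt_d9, Real.log_le_log two_pos two_le]

theorem log_one_div_le_inv (hε : 0 < ε) : Real.log (1 / ε) ≤ ε⁻¹ := by
  rw [one_div]
  linarith [Real.log_le_sub_one_of_pos (inv_pos.2 hε)]

section

variable (hm : 1 ≤ m) (hε : 0 < ε) (hε' : ε ≤ 1 / 2)

include hm hε hε'

theorem one_le_iterations_bound : 1 ≤ m ^ 3 * ε⁻¹ ^ 3 * Real.log (1 / ε) ^ 2 := by
  have log_ge := half_le_log_one_div hε hε'
  have inv_ge : 2 ≤ ε⁻¹ := by rw [le_inv_comm₀ two_pos hε]; linarith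
  calc (1 : ℝ) ≤ 1 ^ 3 * 2 ^ 3 * (1 / 2) ^ 2 := by norm_num
    _ ≤ m ^ 3 * ε⁻¹ ^ 3 * Real.log (1 / ε) ^ 2 := by gcongr

theorem one_le_iterations : 1 ≤ iterations m ε :=
  Nat.one_le_ceil_iff.2 (zero_lt_one.trans_le (one_le_iterations_bound hm hε hε'))

theorem iterations_le :
    (iterations m ε : ℝ) ≤ 2 * (m ^ 3 * ε⁻¹ ^ 3 * Real.log (1 / ε) ^ 2) :=
  Nat.ceil_le_two_mul (by linarith [one_le_iterations_bound hm hε hε'])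

theorem log_iterations_succ_le :
    Real.log ((iterations m ε : ℝ) + 1) ≤ 11 * m * Real.log (1 / ε) := by
  have log_ge := half_le_log_one_div hε hε'
  have succ_le : (iterations m ε : ℝ) + 1 ≤ 3 * m ^ 3 * ε⁻¹ ^ 5 := by
    calc (iterations m ε : ℝ) + 1 ≤ 3 * (m ^ 3 * ε⁻¹ ^ 3 * Real.log (1 / ε) ^ 2) := by
          linarith [iterations_le hm hε hε', one_le_iterations_bound hm hε hε']
      _ ≤ 3 * (m ^ 3 * ε⁻¹ ^ 3 * ε⁻¹ ^ 2) := by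
          gcongr
          exact log_one_div_le_inv hε
      _ = 3 * m ^ 3 * ε⁻¹ ^ 5 := by ring
  have log_three_le : Real.log 3 ≤ 2 := (Real.log_le_sub_one_of_pos three_pos).trans (by norm_num)
  have log_m_le : Real.log m ≤ m - 1 := Real.log_le_sub_one_of_pos (by linarith)
  calc Real.log ((iterations m ε : ℝ) + 1) ≤ Real.log (3 * m ^ 3 * ε⁻¹ ^ 5) :=
        Real.log_le_log (by positivity) succ_le
    _ = Real.log 3 + 3 * Real.log m + 5 * Real.log (1 / ε) := by
        rw [Real.log_mul (by positivity) (by positivity),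
          Real.log_mul three_ne_zero (by positivity), Real.log_pow, Real.log_pow, one_div]
        push_cast
        ring
    _ ≤ 3 * m + 5 * Real.log (1 / ε) := by linarith
    _ ≤ 11 * m * Real.log (1 / ε) := by nlinarith

theorem iterations_mul_log_succ_le :
    iterations m ε * Real.log ((iterations m ε : ℝ) + 1) ≤
      22 * m ^ 4 * ε⁻¹ ^ 3 * Real.log (1 / ε) ^ 3 := by
  have log_nonneg : 0 ≤ Real.log ((iterations m ε : ℝ) + 1) :=
    Real.log_nonneg (le_add_of_nonneg_left (Nat.cast_nonneg _))
  calc _ ≤ 2 * (m ^ 3 * ε⁻¹ ^ 3 * Real.log (1 / ε) ^ 2) * (11 * m * Real.log (1 / ε)) :=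
        mul_le_mul (iterations_le hm hε hε') (log_iterations_succ_le hm hε hε') log_nonneg
          (by positivity)
    _ = 22 * m ^ 4 * ε⁻¹ ^ 3 * Real.log (1 / ε) ^ 3 := by ring

end

theorem mul_sqrt_log_div_root_iterations_le {c : ℝ} (hm : 1 + 14 * c ^ 2 ≤ m)
    (hε : 0 < ε) (hε' : ε ≤ 1 / 2) :
    c * (√(Real.log ((iterations m ε : ℝ) + 1)) / (iterations m ε : ℝ) ^ (1 / 3 : ℝ)) ≤ ε := by
  have m_ge : 1 ≤ m := by linarith [sq_nonneg c]
  have log_ge := half_le_log_one_div hε hε'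
  have log_le := log_iterations_succ_le m_ge hε hε'
  have root_ge := one_le_rpow_one_third (one_le_iterations m_ge hε hε')
  have cube_eq := rpow_one_third_cubed (Nat.cast_nonneg (iterations m ε) : (0 : ℝ) ≤ _)
  have le_iterations : m ^ 3 * ε⁻¹ ^ 3 * Real.log (1 / ε) ^ 2 ≤ iterations m ε := Nat.le_ceil _
  have log_nonneg : 0 ≤ Real.log ((iterations m ε : ℝ) + 1) :=
    Real.log_nonneg (le_add_of_nonneg_left (Nat.cast_nonneg _))
  set X := (iterations m ε : ℝ) ^ (1 / 3 : ℝ)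
  set Λ := Real.log (1 / ε)
  have sq_le : 14 * c ^ 2 ≤ m := by linarith
  have sixth_powers_le : (c * √(Real.log ((iterations m ε : ℝ) + 1)) * ε⁻¹) ^ 6 ≤ X ^ 6 := by
    calc _ = (c ^ 2) ^ 3 * (√(Real.log ((iterations m ε : ℝ) + 1)) ^ 2) ^ 3 * ε⁻¹ ^ 6 := by ring
      _ ≤ (c ^ 2) ^ 3 * (11 * m * Λ) ^ 3 * ε⁻¹ ^ 6 := by
          rw [Real.sq_sqrt log_nonneg]
          gcongr
      _ ≤ (14 * c ^ 2) ^ 3 * m ^ 3 * Λ ^ 3 * (1 / 2) * ε⁻¹ ^ 6 := by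
          have : 0 ≤ c ^ 6 * m ^ 3 * Λ ^ 3 * ε⁻¹ ^ 6 := by positivity
          linear_combination 41 * this
      _ ≤ m ^ 3 * m ^ 3 * Λ ^ 3 * Λ * ε⁻¹ ^ 6 := by gcongr
      _ = (m ^ 3 * ε⁻¹ ^ 3 * Λ ^ 2) ^ 2 := by ring
      _ ≤ (X ^ 3) ^ 2 := by
          rw [cube_eq]
          gcongr
      _ = X ^ 6 := by ring
  have root_le := le_of_pow_le_pow_left₀ (by norm_num) (by positivity) sixth_powers_le
  rw [← div_eq_mul_inv, div_le_iff₀ hε] at root_le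
  rwa [mul_div_assoc', div_le_iff₀ (by positivity), mul_comm ε]

end Iterations

end UtilityMDP

/-! ### Convergence and sample complexity -/

namespace UtilityMDP

/-- The constant in front of `√(log (T + 1)) / T^{1/3}` in the convergence rate, in terms of the
effective horizon `κ`, the step size scale `α₀` and an upper bound `B` for the optimality gap of the
initial parameter. -/
noncomputable def logRateConst (l L R L₂ L₁ κ α₀ B : ℝ) : ℝ :=
  rateConst l L R L₂ L₁ *
    (2 * κ ^ 3 + 2 * (B / α₀ + 2 * l * R * κ ^ 2) + κ ^ 4 * α₀)

theorem iterations_mul_horizon_le {S A : Type*} {d : ℕ} (M : UtilityMDP S A d) {m ε : ℝ}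
    (hm : 1 ≤ m) (hε : 0 < ε) (hε' : ε ≤ 1 / 2) :
    (iterations m ε : ℝ) * horizon M.γ (iterations m ε) ≤
      66 * M.effHorizon * m ^ 4 * ε⁻¹ ^ 3 * Real.log (1 / ε) ^ 3 := by
  have hκ := M.one_le_effHorizon
  calc _ ≤ iterations m ε * (3 * M.effHorizon * Real.log ((iterations m ε : ℝ) + 1)) := by
        gcongr
        exact M.horizon_le (one_le_iterations hm hε hε')
    _ = 3 * M.effHorizon * (iterations m ε * Real.log ((iterations m ε : ℝ) + 1)) := by ring
    _ ≤ 3 * M.effHorizon * (22 * m ^ 4 * ε⁻¹ ^ 3 * Real.log (1 / ε) ^ 3) :=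
        mul_le_mul_of_nonneg_left (iterations_mul_log_succ_le hm hε hε') (by positivity)
    _ = 66 * M.effHorizon * m ^ 4 * ε⁻¹ ^ 3 * Real.log (1 / ε) ^ 3 := by ring

namespace UtilityRegular

variable {S A : Type*} {d : ℕ} [Fintype S] [DecidableEq S] [Fintype A] [DecidableEq A]
  [Nonempty A] {M : UtilityMDP S A d} {D : Set (SAVec S A)} {l L R L₂ L₁ α₀ B : ℝ}
  {θ₀ : Param d} {T : ℕ} [NeZero T]

theorem expGradNorm_le_rate (hF : M.UtilityRegular D R L₂ L₁) (hM : M.PolicyRegular l L)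
    (hD : M.occupancySet ⊆ D) (hB : BddAbove (Set.range M.objective)) (hL₂ : 0 ≤ L₂)
    (hL₁ : 0 ≤ L₁) (hα₀ : 0 < α₀) (hrun : M.RunStaysIn θ₀ α₀ T D) :
    M.expGradNorm θ₀ α₀ T ≤ rateConst l L R L₂ L₁ *
      ((1 + (1 - M.γ) ^ 3 * M.initialGap θ₀ α₀ T / α₀ +
          √(Real.log ((T : ℝ) + 1)) * (α₀ / (1 - M.γ))) /
        ((1 - M.γ) ^ 3 * (T : ℝ) ^ (1 / 3 : ℝ))) := by
  have rate := hF.expGradNorm_le hM hD hB hL₂ hL₁ hα₀ hrun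
  have one_sub_pos := sub_pos.2 M.γ_lt_one
  rw [effHorizon] at rate
  refine rate.trans_eq (congrArg _ ?_)
  field_simp

theorem expGradNorm_le_tuned_rate (hF : M.UtilityRegular D R L₂ L₁) (hM : M.PolicyRegular l L)
    (hD : M.occupancySet ⊆ D) (hB : BddAbove (Set.range M.objective)) (hL₂ : 0 ≤ L₂)
    (hL₁ : 0 ≤ L₁) (hα₀ : 0 < α₀) (hrun : M.RunStaysIn θ₀ α₀ T D)
    (tuned : α₀ = (1 - M.γ) ^ 2 * √(M.initialGap θ₀ α₀ T)) :
    M.expGradNorm θ₀ α₀ T ≤ 3 * rateConst l L R L₂ L₁ *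
      ((1 + √(Real.log ((T : ℝ) + 1)) * ((1 - M.γ) * √(M.initialGap θ₀ α₀ T))) /
        ((1 - M.γ) ^ 3 * (T : ℝ) ^ (1 / 3 : ℝ))) := by
  have hT := NeZero.one_le (n := T)
  have const_pos := rateConst_pos hM.nonneg_left hM.nonneg_right (hF.nonneg hD) hL₂ hL₁
  have one_sub_pos := sub_pos.2 M.γ_lt_one
  have sqrt_log_ge := half_le_sqrt_log_succ hT
  have gap_eq := Real.sq_sqrt (initialGap_nonneg hB θ₀ α₀ T)
  have rate := hF.expGradNorm_le_rate hM hD hB hL₂ hL₁ hα₀ hrun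
  set Δ := M.initialGap θ₀ α₀ T
  set g := 1 - M.γ
  set Y := √(Real.log ((T : ℝ) + 1))
  have gap_div_eq : g ^ 3 * Δ / α₀ = g * √Δ := by
    rw [div_eq_iff hα₀.ne']
    linear_combination -g ^ 3 * gap_eq - g * √Δ * tuned
  have step_div_eq : α₀ / g = g * √Δ := by
    rw [div_eq_iff one_sub_pos.ne']
    linear_combination tuned
  rw [gap_div_eq, step_div_eq] at rate
  refine rate.trans ?_
  rw [mul_comm 3, mul_assoc, mul_div_assoc' (3 : ℝ)]
  gcongr
  linarith [mul_le_mul_of_nonneg_right sqrt_log_ge (by positivity : 0 ≤ g * √Δ)]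

theorem initialGap_le (hF : M.UtilityRegular D R L₂ L₁) (hM : M.PolicyRegular l L)
    (hD : M.occupancySet ⊆ D) (hα₀ : 0 ≤ α₀) (hgap : M.optValue - M.objective θ₀ ≤ B) :
    M.initialGap θ₀ α₀ T ≤ B + 2 * l * R * M.effHorizon ^ 2 * α₀ := by
  have hl := hM.nonneg_left
  have hR := hF.nonneg hD
  have hT := NeZero.one_le (n := T)
  have step_nonneg := stepSize_nonneg hα₀ T 0
  have step_le : stepSize α₀ T 0 ≤ α₀ :=
    (stepSize_le hα₀ hT 0).trans (div_le_self hα₀ (one_le_rpow_one_third hT))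
  have first_ge : M.objective θ₀ - 2 * l * R * M.effHorizon ^ 2 * α₀ ≤
      M.meanObjective θ₀ (stepSize α₀ T) momentum (horizon M.γ T) 0 := by
    refine (runMean_const _).symm.trans_le (runMean_mono fun st hst => ?_)
    have move_le : ‖θ₀ - st.θ‖ ≤ α₀ := by
      rw [← hst.θprev_zero]
      exact hst.norm_θprev_sub_le.trans ((abs_of_nonneg step_nonneg).trans_le step_le)
    have change_le := abs_sub_le_of_hasGradientAt
      (fun θ => (hF.hasGradientAt_objective hM hD θ).differentiableAt.hasGradientAt)
      (hF.norm_gradient_objective_le hM hD) θ₀ st.θ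
    have change_le' := (le_abs_self _).trans (change_le.trans
      (mul_le_mul_of_nonneg_left move_le (by positivity)))
    linarith
  rw [initialGap_eq]
  linarith

theorem expGradNorm_le_mul_sqrt_log (hF : M.UtilityRegular D R L₂ L₁) (hM : M.PolicyRegular l L)
    (hD : M.occupancySet ⊆ D) (hB : BddAbove (Set.range M.objective)) (hL₂ : 0 ≤ L₂)
    (hL₁ : 0 ≤ L₁) (hα₀ : 0 < α₀) (hrun : M.RunStaysIn θ₀ α₀ T D)
    (hgap : M.optValue - M.objective θ₀ ≤ B) :
    M.expGradNorm θ₀ α₀ T ≤ logRateConst l L R L₂ L₁ M.effHorizon α₀ B *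
      (√(Real.log ((T : ℝ) + 1)) / (T : ℝ) ^ (1 / 3 : ℝ)) := by
  have hT := NeZero.one_le (n := T)
  have hκ := M.one_le_effHorizon
  have const_pos := rateConst_pos hM.nonneg_left hM.nonneg_right (hF.nonneg hD) hL₂ hL₁
  have sqrt_log_ge := half_le_sqrt_log_succ hT
  have gap_nonneg := div_nonneg (initialGap_nonneg hB θ₀ α₀ T) hα₀.le
  have gap_le : M.initialGap θ₀ α₀ T / α₀ ≤ B / α₀ + 2 * l * R * M.effHorizon ^ 2 := by
    rw [div_le_iff₀ hα₀, add_mul, div_mul_cancel₀ _ hα₀.ne']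
    exact hF.initialGap_le hM hD hα₀.le hgap
  refine (hF.expGradNorm_le hM hD hB hL₂ hL₁ hα₀ hrun).trans ?_
  rw [logRateConst, mul_assoc, mul_div_assoc' (2 * M.effHorizon ^ 3 + _ + _)]
  gcongr
  set Y := √(Real.log ((T : ℝ) + 1))
  set G := B / α₀ + 2 * l * R * M.effHorizon ^ 2
  have sum_nonneg : 0 ≤ M.effHorizon ^ 3 + G := add_nonneg (by positivity) (gap_nonneg.trans gap_le)
  linarith [mul_le_mul_of_nonneg_right sqrt_log_ge sum_nonneg]

theorem expGradNorm_iterations_le {c m ε : ℝ} [NeZero (iterations m ε)]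
    (hF : M.UtilityRegular D R L₂ L₁) (hM : M.PolicyRegular l L) (hD : M.occupancySet ⊆ D)
    (hB : BddAbove (Set.range M.objective)) (hL₂ : 0 ≤ L₂) (hL₁ : 0 ≤ L₁) (hα₀ : 0 < α₀)
    (hrun : M.RunStaysIn θ₀ α₀ (iterations m ε) D) (hgap : M.optValue - M.objective θ₀ ≤ B)
    (hc : logRateConst l L R L₂ L₁ M.effHorizon α₀ B = c) (hm : 1 + 14 * c ^ 2 ≤ m)
    (hε : 0 < ε) (hε' : ε ≤ 1 / 2) : M.expGradNorm θ₀ α₀ (iterations m ε) ≤ ε :=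
  (hF.expGradNorm_le_mul_sqrt_log hM hD hB hL₂ hL₁ hα₀ hrun hgap).trans
    (hc ▸ mul_sqrt_log_div_root_iterations_le hm hε hε')

end UtilityRegular

end UtilityMDP

theorem mainTheorem1 (lψ Lψ lF LF LFinf : ℝ) (hlψ : 0 < lψ) (hLψ : 0 < Lψ)
    (hlF : 0 < lF) (hLF : 0 < LF) (hLFinf : 0 < LFinf) :
    -- the rate, with a constant that depends on the regularity constants only
    (∃ C : ℝ, 0 < C ∧
      ∀ (S : Type u) [Fintype S] [DecidableEq S] (A : Type v) [Fintype A] [DecidableEq A]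
        [Nonempty A] (d : ℕ) (M : UtilityMDP S A d) (D : Set (SAVec S A)),
        M.PolicyRegular lψ Lψ →
        M.UtilityRegular D lF LF LFinf →
        M.occupancySet ⊆ D →
        BddAbove (Set.range M.objective) →
        Differentiable ℝ M.objective ∧
        ∀ (θ₀ : Param d) (α₀ : ℝ) (T : ℕ) [NeZero T], 0 < α₀ →
          M.RunStaysIn θ₀ α₀ T D →
          M.expGradNorm θ₀ α₀ T ≤
            C * ((1 + (1 - M.γ) ^ 3 * M.initialGap θ₀ α₀ T / α₀
                + √(Real.log ((T : ℝ) + 1)) * (α₀ / (1 - M.γ)))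
              / ((1 - M.γ) ^ 3 * (T : ℝ) ^ (1 / 3 : ℝ))) ∧
          (α₀ = (1 - M.γ) ^ 2 * √(M.initialGap θ₀ α₀ T) →
            M.expGradNorm θ₀ α₀ T ≤
              C * ((1 + √(Real.log ((T : ℝ) + 1)) * ((1 - M.γ) * √(M.initialGap θ₀ α₀ T)))
                / ((1 - M.γ) ^ 3 * (T : ℝ) ^ (1 / 3 : ℝ))))) ∧
    -- the sample complexity: `T` trajectories of length `H` are sampled
    (∀ γ α₀ B : ℝ, 0 < α₀ → ∃ K : ℝ, 0 < K ∧
      ∀ (S : Type u) [Fintype S] [DecidableEq S] (A : Type v) [Fintype A] [DecidableEq A]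
        [Nonempty A] (d : ℕ) (M : UtilityMDP S A d) (D : Set (SAVec S A)) (θ₀ : Param d),
        M.γ = γ →
        M.PolicyRegular lψ Lψ →
        M.UtilityRegular D lF LF LFinf →
        M.occupancySet ⊆ D →
        BddAbove (Set.range M.objective) →
        M.optValue - M.objective θ₀ ≤ B →
        (∀ T : ℕ, 1 ≤ T → M.RunStaysIn θ₀ α₀ T D) →
        ∀ ε : ℝ, 0 < ε → ε ≤ 1 / 2 →
          ∃ (T : ℕ) (_ : NeZero T),
            (T : ℝ) * (UtilityMDP.horizon M.γ T : ℝ) ≤ K * ε⁻¹ ^ 3 * Real.log (1 / ε) ^ 3 ∧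
            M.expGradNorm θ₀ α₀ T ≤ ε) := by
  have const_pos := UtilityMDP.rateConst_pos hlψ.le hLψ.le hlF.le hLF.le hLFinf.le
  refine ⟨⟨3 * UtilityMDP.rateConst lψ Lψ lF LF LFinf, by positivity, ?_⟩, ?_⟩
  · intro S _ _ A _ _ _ d M D hM hF hD hB
    refine ⟨fun θ => (hF.hasGradientAt_objective hM hD θ).differentiableAt,
      fun θ₀ α₀ T _ hα₀ hrun => ⟨?_, ?_⟩⟩
    · have gap_nonneg := UtilityMDP.initialGap_nonneg hB θ₀ α₀ T
      have one_sub_pos := sub_pos.2 M.γ_lt_one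
      exact (hF.expGradNorm_le_rate hM hD hB hLF.le hLFinf.le hα₀ hrun).trans
        (mul_le_mul_of_nonneg_right (by linarith) (by positivity))
    · exact hF.expGradNorm_le_tuned_rate hM hD hB hLF.le hLFinf.le hα₀ hrun
  · intro γ α₀ B hα₀
    set m := 1 + 14 * UtilityMDP.logRateConst lψ Lψ lF LF LFinf (1 - γ)⁻¹ α₀ B ^ 2 with m_eq
    have hm : 1 ≤ m := le_add_of_nonneg_right (by positivity)
    -- `γ` is an arbitrary real number here, so `66 * (1 - γ)⁻¹ * m ^ 4` need not be positive.
    refine ⟨max (66 * (1 - γ)⁻¹ * m ^ 4) 1, lt_max_of_lt_right one_pos, ?_⟩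
    rintro S _ _ A _ _ _ d M D θ₀ rfl hM hF hD hB hgap hrun ε hε hε'
    have hT := UtilityMDP.one_le_iterations hm hε hε'
    have : NeZero (UtilityMDP.iterations m ε) := ⟨Nat.one_le_iff_ne_zero.1 hT⟩
    have log_ge := UtilityMDP.half_le_log_one_div hε hε'
    refine ⟨UtilityMDP.iterations m ε, this, ?_, ?_⟩
    · refine (M.iterations_mul_horizon_le hm hε hε').trans ?_
      gcongr
      exact le_max_left _ _
    · exact hF.expGradNorm_iterations_le hM hD hB hLF.le hLFinf.le hα₀ (hrun _ hT) hgap rfl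
        m_eq.ge hε hε'
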